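/- **Setting.** Let $n\ge 1$, $a_0<0<a_1<\dots<a_n$, $A=\mathrm{diag}(a_0,\dots,a_n)$, $B=A^{-1}$, and let $x(s)$, $s\in\mathbb R$, be a complete geodesic, parametrised by arc length, on the hyperboloid $(Bx,x)=1$ in $\mathbb R^{n+1}$. Assume that $J=(Bx,Bx)(Bx',x')\neq0$ and put $\varepsilon=\operatorname{sign}J$, $b_k=\varepsilon/a_k$, $q=Bx/|Bx|$, $p=dq/d\tau$, where $d\tau/ds=|(Bx',x')|^{1/2}/|Bx|$. With $R_u=(u-\varepsilon B)^{-1}$ and $B(u)=\prod_{k=0}^n(u-b_k)$ let $$\Psi_u(p,q)=(1+(R_up,p))(R_uq,q)-(R_up,q)^2,\qquad R(u)=-4B(u)^2\,\Psi_u(p,q),$$ the polynomial $R$ being computed at $s=0$, and assume that $R$ has no multiple roots (the spectral curve $y^2=R(u)$ is nonsingular). The elliptic coordinates $u_1,\dots,u_n$ of $q$ are the roots of $(R_uq,q)=0$ (with the denominators cleared), and $P_i=(u_i,y_i)$ with $y_i=2(R_{u_i}p,q)B(u_i)$. **Theorem.** 1. There are real $d_1,\dots,d_{n-1}$ such that $\Psi_u(p,q)=u\prod_{i=1}^{n-1}(u-d_i)\big/\prod_{k=0}^n(u-b_k)$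 for all $s$; thus $R(u)=-4u\prod_i(u-d_i)\prod_k(u-b_k)$ has $2n+1$ distinct real roots $e_0<\dots<e_{2n}$. The real curve $y^2=R(u)$ has $n$ ovals, over $[e_1,e_2],[e_3,e_4],\dots,[e_{2n-1},e_{2n}]$. One of them contains $(0,0)$; call it $\alpha_n$, and let $\alpha_1,\dots,\alpha_{n-1}$ be the others. After labelling, $P_i(s)\in\alpha_i$ for all $i$ and $s$. Orient the ovals by the direction of motion of the $P_i$, that is, by $du_i/d\tau=-y_i/\prod_{j\ne i}(u_i-u_j)$. 2. Let $\omega_j=u^{j-1}du/y$, $1\le j\le n-1$, and $\Omega_i=\big(\oint_{\alpha_i}\omega_1,\dots,\oint_{\alpha_i}\omega_{n-1}\big)$ for $i=1,\dots,n-1$. These vectors are linearly independent; let $\mathcal L$ be the lattice that they generate. The map $$\mathbb A:\alpha_1\times\dots\times\alpha_{n-1}\to\mathbb T^{n-1}=\mathbb R^{n-1}/\mathcal L,\qquad \mathbb A(D)_j=\sum_{i=1}^{n-1}\int^{P_i}\omega_j,$$ is bijective. 3. (Scattering.) As $s\to\pm\infty$ the point $P_n$ tends to $(0,0)$, and $(P_1,\dots,P_{n-1})$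 tends to a limit $D_\pm\in\alpha_1\times\dots\times\alpha_{n-1}$. These limits satisfy $$\mathbb A(D_+)=\mathbb A(D_-)-\Delta,\qquad \Delta_j=\oint_{\alpha_n}\omega_j .$$ 4. (Topology.) Let $\theta$ be the angular parameter (of period $2\pi$) on the universal covering of an oriented oval, and let $\tilde{\mathbb A}:\mathbb R^{n-1}\to\mathbb R^{n-1}$ be the lift of $\mathbb A$ in these parameters. The points $P_i(s)$ lift to continuous strictly increasing functions $\Theta_i(s)$ with finite limits $\theta_i^\pm$ as $s\to\pm\infty$. - $\theta_n^+=\theta_n^-+2\pi$, so $P_n$ goes exactly once around $\alpha_n$. - $(\theta^+_1,\dots,\theta^+_{n-1})$ is the unique $\theta\in\mathbb R^{n-1}$ with $\tilde{\mathbb A}(\theta)=\tilde{\mathbb A}(\theta^-_1,\dots,\theta^-_{n-1})-\Delta$. Hence, given $D_-$, the vector $\Delta\in\mathbb R^{n-1}$ determines $D_+$ and the homotopy class of the path $(P_1,\dots,P_{n-1})$ from $D_-$ to $D_+$ in the product of the ovals. - The numbers $N_i=\lfloor(\theta_i^+-\theta_i^-)/2\pi\rfloor$, $i<n$, of full turns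 of the $P_i$ are given by the position of $\Delta$ with respect to $\mathcal L$: $(N_1,\dots,N_{n-1})$ is the only integer vector such that $-\Delta$ lies in the translate by $\sum_iN_i\Omega_i$ of the cell $\{\tilde{\mathbb A}(\theta^-+\varphi)-\tilde{\mathbb A}(\theta^-):\varphi\in[0,2\pi)^{n-1}\}$. - Each coordinate $x_l(s)$, $0\le l\le n$, has finitely many zeros, all of them simple. Their number is the total number, over $i=1,\dots,n$, of the parameters $\theta\in(\theta_i^-,\theta_i^+)$ at which the $i$-th oval passes through the branch point $(b_l,0)$. -/

import Mathlib

open Polynomial Filter Topology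

noncomputable section

namespace GeodesicScattering

/-! ### Geodesics on the one-sheeted hyperboloid and their normals

Throughout `n = m + 1`; the ambient space is `ℝ ^ (n + 1)` with coordinates indexed by
`Fin (m + 2)`, and the hyperboloid is `∑ i, x i ^ 2 / a i = 1`, i.e. `(B x, x) = 1` with
`B = A⁻¹`, `A = diag a`. -/

/-- `x` is a complete geodesic, in arc length, on the quadric `∑ i, x i ^ 2 / a i = 1`:
the acceleration is proportional to the normal vector `B x`. -/
structure IsGeodesic {m : ℕ} (a : Fin (m + 2) → ℝ) (x : ℝ → Fin (m + 2) → ℝ) : Prop where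
  contDiff : ContDiff ℝ 2 x
  mem : ∀ s, ∑ i, x s i ^ 2 / a i = 1
  unit_speed : ∀ s, ∑ i, deriv x s i ^ 2 = 1
  normal_acc : ∃ lam : ℝ → ℝ, ∀ s i, deriv (deriv x) s i = -lam s * (x s i / a i)

/-- The Joachimsthal integral `J(x, y) = (B x, B x) (B y, y)`. -/
def joachimsthal {m : ℕ} (a x y : Fin (m + 2) → ℝ) : ℝ :=
  (∑ i, (x i / a i) ^ 2) * ∑ i, y i ^ 2 / a i

/-- The numbers `b k = ε / a k`, where `ε = ± 1` is the sign of the Joachimsthal integral. -/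
def bCoef {m : ℕ} (a : Fin (m + 2) → ℝ) (x : ℝ → Fin (m + 2) → ℝ) (k : Fin (m + 2)) : ℝ :=
  Real.sign (joachimsthal a (x 0) (deriv x 0)) / a k

/-- The unit normal `q = B x / |B x|`. -/
def normalVec {m : ℕ} (a : Fin (m + 2) → ℝ) (x : ℝ → Fin (m + 2) → ℝ) (s : ℝ) :
    Fin (m + 2) → ℝ :=
  fun i => (x s i / a i) / √(∑ j, (x s j / a j) ^ 2)

/-- The speed `dτ/ds = |λ| ^ (1/2)`, `λ = (B x', x') / (B x, B x)`, of the new time `τ`. -/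
def timeSpeed {m : ℕ} (a : Fin (m + 2) → ℝ) (x : ℝ → Fin (m + 2) → ℝ) (s : ℝ) : ℝ :=
  √(|∑ i, deriv x s i ^ 2 / a i| / ∑ i, (x s i / a i) ^ 2)

/-- The momentum `p = dq/dτ`. -/
def momentum {m : ℕ} (a : Fin (m + 2) → ℝ) (x : ℝ → Fin (m + 2) → ℝ) (s : ℝ) :
    Fin (m + 2) → ℝ :=
  fun i => deriv (normalVec a x) s i / timeSpeed a x s

/-! ### The spectral curve -/

/-- `Ψ_u(p, q) = (1 + (R_u p, p)) (R_u q, q) - (R_u p, q) ^ 2`, `R_u = (u - diag b)⁻¹`. -/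
def psi {m : ℕ} (b p q : Fin (m + 2) → ℝ) (u : ℝ) : ℝ :=
  (1 + ∑ k, p k ^ 2 / (u - b k)) * (∑ k, q k ^ 2 / (u - b k))
    - (∑ k, p k * q k / (u - b k)) ^ 2

/-- The residue `F_k(p, q)` of `Ψ_u(p, q)` at `u = b k`. -/
def integralF {m : ℕ} (b p q : Fin (m + 2) → ℝ) (k : Fin (m + 2)) : ℝ :=
  q k ^ 2 + ∑ j ∈ Finset.univ.erase k, (p k * q j - p j * q k) ^ 2 / (b k - b j)

/-- `B(u) = ∏ k, (u - b k)`. -/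
def polyB {m : ℕ} (b : Fin (m + 2) → ℝ) : ℝ[X] := ∏ k, (X - C (b k))

/-- The polynomial `∑ k, w k * ∏ j ≠ k, (u - b j) = B(u) * ∑ k, w k / (u - b k)`. -/
def fracNumerator {m : ℕ} (b w : Fin (m + 2) → ℝ) : ℝ[X] :=
  ∑ k, C (w k) * ∏ j ∈ Finset.univ.erase k, (X - C (b j))

/-- The polynomial `R(u) = -4 B(u) ^ 2 Ψ_u(p, q)` of degree `2 n + 1`, where
`B(u) Ψ_u = ∑ k, F_k * ∏ j ≠ k, (u - b j)`. -/
def spectralPoly {m : ℕ} (b p q : Fin (m + 2) → ℝ) : ℝ[X] :=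
  C (-4) * fracNumerator b (integralF b p q) * polyB b

/-- The polynomial `R` of a geodesic (computed at `s = 0`; it is an integral of motion). -/
def geodesicPoly {m : ℕ} (a : Fin (m + 2) → ℝ) (x : ℝ → Fin (m + 2) → ℝ) : ℝ[X] :=
  spectralPoly (bCoef a x) (momentum a x 0) (normalVec a x 0)

/-- `P = (u, y)` is one of the points given by `(p, q)`: `u` is an elliptic coordinate of `q`,
i.e. a root of `(R_u q, q) = 0`, and `y = 2 (R_u p, q) B(u)`. Both conditions are written with
denominators cleared, so that they make sense also where a coordinate of `q` vanishes. -/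
def IsSpectralPoint {m : ℕ} (b p q : Fin (m + 2) → ℝ) (P : ℝ × ℝ) : Prop :=
  (fracNumerator b (fun k => q k ^ 2)).eval P.1 = 0 ∧
    P.2 = 2 * (fracNumerator b (fun k => p k * q k)).eval P.1

/-! ### The ovals of `y ^ 2 = R(u)`

If `R` has negative leading coefficient and simple real roots `e 0 < e 1 < ⋯ < e (2 n)`, the
ovals lie over the intervals `[e 1, e 2], [e 3, e 4], …, [e (2 n - 1), e (2 n)]`. -/

/-- The `i`-th real root of `R` in increasing order, `i = 0, 1, …`. -/
def branchPoint (R : ℝ[X]) (i : ℕ) : ℝ := (R.roots.sort (· ≤ ·)).getD i 0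

/-- Left end of the projection of the `i`-th oval. -/
def ovalLeft (R : ℝ[X]) (i : ℕ) : ℝ := branchPoint R (2 * i + 1)

/-- Right end of the projection of the `i`-th oval. -/
def ovalRight (R : ℝ[X]) (i : ℕ) : ℝ := branchPoint R (2 * i + 2)

/-- The `i`-th oval of the real curve `y ^ 2 = R(u)`. -/
def oval (R : ℝ[X]) (i : ℕ) : Set (ℝ × ℝ) :=
  {P | P.1 ∈ Set.Icc (ovalLeft R i) (ovalRight R i) ∧ P.2 ^ 2 = R.eval P.1}

/-- The centre of the projection of the `i`-th oval. -/
def ovalMid (R : ℝ[X]) (i : ℕ) : ℝ := (ovalLeft R i + ovalRight R i) / 2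

/-- The half-length of the projection of the `i`-th oval. -/
def ovalRad (R : ℝ[X]) (i : ℕ) : ℝ := (ovalRight R i - ovalLeft R i) / 2

/-- The orientation of the ovals `0, …, m` by the Dubrovin equations, which for
`y i = 2 (R_u p, q) B(u)`, `p = dq/dτ`, read `du i/dτ = - y i / ∏ j ≠ i, (u i - u j)`:
it is `1` if `u i` increases where `y i > 0`, and `-1` if `u i` decreases there. The sign of the
product does not depend on the points of the ovals, so that it is evaluated at the centres. -/
def ovalOrient (R : ℝ[X]) {m : ℕ} (i : Fin (m + 1)) : ℝ :=
  -Real.sign (∏ j ∈ Finset.univ.erase i, (ovalMid R i - ovalMid R j))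

/-- The universal covering `ℝ → α_i` of the `i`-th oval, of period `2 π`, positively oriented:
`θ = 0` is the left branch point, `θ = π` the right one. -/
def ovalParam (R : ℝ[X]) {m : ℕ} (i : Fin (m + 1)) (θ : ℝ) : ℝ × ℝ :=
  (ovalMid R i - ovalRad R i * Real.cos θ,
    ovalOrient R i * Real.sign (Real.sin θ) *
      √(R.eval (ovalMid R i - ovalRad R i * Real.cos θ)))

/-- The line integral of the form `u ^ j du / y` along the `i`-th oval, from the left branch
point (parameter `0`) to the parameter `θ`. Here `du = ovalRad R i * sin t dt`. -/
def ovalIntegral (R : ℝ[X]) {m : ℕ} (i : Fin (m + 1)) (j : ℕ) (θ : ℝ) : ℝ :=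
  ∫ t in (0 : ℝ)..θ,
    (ovalParam R i t).1 ^ j * (ovalRad R i * Real.sin t) / (ovalParam R i t).2

/-- The vector of the periods of `u ^ j du / y`, `j = 0, …, m - 1 = n - 2`, over the oval `i`. -/
def ovalPeriod (R : ℝ[X]) {m : ℕ} (i : Fin (m + 1)) : Fin m → ℝ :=
  fun j => ovalIntegral R i j (2 * Real.pi)

/-! ### The real partial Abel map

The index `k` is the one of the distinguished oval `α_n`; the other ones are `k.succAbove i`. -/

/-- The period lattice, generated by the periods over the ovals other than `k`. -/
def periodLattice (R : ℝ[X]) {m : ℕ} (k : Fin (m + 1)) : AddSubgroup (Fin m → ℝ) :=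
  AddSubgroup.closure (Set.range fun i : Fin m => ovalPeriod R (k.succAbove i))

/-- The Abel map lifted to the universal coverings: `j ↦ ∑ i, ∫ ω_j` along the ovals `≠ k`. -/
def liftedAbel (R : ℝ[X]) {m : ℕ} (k : Fin (m + 1)) (θ : Fin m → ℝ) : Fin m → ℝ :=
  fun j => ∑ i, ovalIntegral R (k.succAbove i) j (θ i)

/-- The real partial Abel map `𝔸`, from the product of the ovals other than `k` to
`ℝ ^ (n - 1)` modulo the period lattice. Modulo periods the integral from the base point to `P`
does not depend on the parameter chosen for `P`. -/
def abelMap (R : ℝ[X]) {m : ℕ} (k : Fin (m + 1)) (D : (i : Fin m) → oval R (k.succAbove i)) :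
    (Fin m → ℝ) ⧸ periodLattice R k :=
  QuotientAddGroup.mk
    (liftedAbel R k fun i => Function.invFun (ovalParam R (k.succAbove i)) (D i : ℝ × ℝ))

end GeodesicScattering

end

open GeodesicScattering

noncomputable section

namespace GeodesicScattering

/-! ### Algebra of the spectral polynomial -/

section Algebra

variable {m : ℕ} {b p q w : Fin (m + 2) → ℝ}

/-! The Gauss map `q = Bx / |Bx|`, with the time `τ`, turns the geodesic into a solution of the
Neumann system on the unit sphere that lies on the level `Ψ_0 = 0` (`exists_neumannMotion`,
`psi_zero`). The residues of `Ψ_u` are integrals of motion, so `R` is constant and `0` is one of its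
roots. While no coordinate of `q` vanishes, the zeros `u i` of `(R_u q, q)` interlace the numbers `b
k`, and `R(u i) = y i ^ 2 ≥ 0`. A point with `R > 0` between any two neighbouring `b k` makes all
roots of `R` real and puts one oval in each such gap (`exists_branchPoints`, `exists_branchData`).
The points `P i` obey the Dubrovin equations (`ovalMotion`), so their angles increase with speeds in
`τ` that lie between positive constants.

Scattering: `dτ/ds` is a constant multiple of `|∑ q k ^ 2 / b k|`, and this sum is a constant
multiple of `∏ u i`. Hence no `u i` vanishes, `P k` is confined to its oval without the origin, its
angle is bounded, and the total time `τ` is finite (`integrable_of_bounded`). Therefore all angles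
converge. The sum `∑ q k ^ 2 / b k` and its derivative are integrable, so it tends to zero
(`tendsto_sum_div`); some `u i` tends to zero, and only the oval `k` contains the origin. Thus `P k`
makes exactly one turn (`turn_around`). By Euler's identities the Abelian integrals summed over all
the ovals are constant (`sum_integral_eq`), so the other points must compensate the period of that
turn.

Abel map: the combinations of the forms `ω_j` are the `Q(u) du / y` with `deg Q < m`, and `Q` can be
given arbitrary signs on the `m` ovals other than `k`. This one remark (`eq_zero_of_moments`) gives
injectivity of the lifted map, independence of the periods and invertibility of the derivative;
surjectivity follows by openness, closedness and connectedness. Since the lift is injective, the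
scattering relation determines the limit angles and the numbers of turns.

The zeros of `x l` are the passages of some `u i` through `b l`, counted on the coverings because
the angles are monotone. A multiple zero would make `b l` a double root of `R`. -/

theorem eval_polyB (b : Fin (m + 2) → ℝ) (u : ℝ) : (polyB b).eval u = ∏ k, (u - b k) := by
  simp [polyB, eval_prod]

theorem eval_fracNumerator (b w : Fin (m + 2) → ℝ) (u : ℝ) :
    (fracNumerator b w).eval u = ∑ k, w k * ∏ j ∈ Finset.univ.erase k, (u - b j) := by
  simp [fracNumerator, eval_finsetSum, eval_prod]

theorem eval_fracNumerator_of_ne {u : ℝ} (hu : ∀ l, u ≠ b l) :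
    (fracNumerator b w).eval u = (∏ k, (u - b k)) * ∑ k, w k / (u - b k) := by
  rw [eval_fracNumerator, Finset.mul_sum]
  refine Finset.sum_congr rfl fun k _ => ?_
  rw [← Finset.mul_prod_erase _ _ (Finset.mem_univ k)]
  have := sub_ne_zero.2 (hu k)
  field_simp

theorem eval_fracNumerator_self (b w : Fin (m + 2) → ℝ) (l : Fin (m + 2)) :
    (fracNumerator b w).eval (b l) = w l * ∏ j ∈ Finset.univ.erase l, (b l - b j) := by
  rw [eval_fracNumerator]
  refine Finset.sum_eq_single l (fun k _ hk => ?_) (by simp)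
  rw [Finset.prod_eq_zero (i := l) (by simp [hk.symm]) (sub_self _), mul_zero]

theorem prod_erase_sub_ne_zero (hb : Function.Injective b) (l : Fin (m + 2)) :
    ∏ j ∈ Finset.univ.erase l, (b l - b j) ≠ 0 :=
  Finset.prod_ne_zero_iff.2 fun _ hj => sub_ne_zero.2 fun h =>
    Finset.ne_of_mem_erase hj (hb h.symm)

theorem fracNumerator_add (b v w : Fin (m + 2) → ℝ) :
    fracNumerator b (fun k => v k + w k) = fracNumerator b v + fracNumerator b w := by
  simp [fracNumerator, add_mul, Finset.sum_add_distrib]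

theorem fracNumerator_smul (b w : Fin (m + 2) → ℝ) (c : ℝ) :
    fracNumerator b (fun k => c * w k) = C c * fracNumerator b w := by
  simp [fracNumerator, Finset.mul_sum, mul_assoc]

/-- This is `b k / (u - b k) = u / (u - b k) - 1` with denominators cleared. It is what brings
`B(u)` into the equation of motion of `y`. -/
theorem fracNumerator_mul_self (b w : Fin (m + 2) → ℝ) :
    fracNumerator b (fun k => b k * w k) =
      X * fracNumerator b w - C (∑ k, w k) * polyB b := by
  rw [fracNumerator, fracNumerator, Finset.mul_sum, map_sum, Finset.sum_mul,
    ← Finset.sum_sub_distrib]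
  refine Finset.sum_congr rfl fun k _ => ?_
  rw [polyB, ← Finset.mul_prod_erase _ _ (Finset.mem_univ k)]
  simp only [C_mul]
  ring

theorem natDegree_fracNumerator_le (b w : Fin (m + 2) → ℝ) :
    (fracNumerator b w).natDegree ≤ m + 1 := by
  refine natDegree_sum_le_of_forall_le _ _ fun k _ => (natDegree_C_mul_le _ _).trans ?_
  simp

theorem coeff_fracNumerator (b w : Fin (m + 2) → ℝ) :
    (fracNumerator b w).coeff (m + 1) = ∑ k, w k := by
  rw [fracNumerator, finsetSum_coeff]
  refine Finset.sum_congr rfl fun k _ => ?_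
  have h := (monic_prod_X_sub_C b (Finset.univ.erase k)).coeff_natDegree
  rw [natDegree_finsetProd_X_sub_C_eq_card] at h
  simp only [Finset.mem_univ, Finset.card_erase_of_mem, Finset.card_univ, Fintype.card_fin,
    Nat.add_one_sub_one] at h
  rw [coeff_C_mul, h, mul_one]

theorem fracNumerator_monic (h : ∑ k, w k = 1) : (fracNumerator b w).Monic :=
  monic_of_natDegree_le_of_coeff_eq_one (m + 1) (natDegree_fracNumerator_le b w)
    (by rw [coeff_fracNumerator, h])

theorem natDegree_fracNumerator (h : ∑ k, w k = 1) : (fracNumerator b w).natDegree = m + 1 :=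
  natDegree_eq_of_le_of_coeff_ne_zero (natDegree_fracNumerator_le b w)
    (by rw [coeff_fracNumerator, h]; exact one_ne_zero)

/-- A sum over pairs of a kernel antisymmetrised by `1 / (b k - b j)`. -/
theorem sum_div_sub_mul (b : Fin (m + 2) → ℝ) (f : Fin (m + 2) → Fin (m + 2) → ℝ)
    (hf : ∀ k j, f k j = f j k) (g : Fin (m + 2) → ℝ) :
    ∑ k, (∑ j ∈ Finset.univ.erase k, f k j / (b k - b j)) * g k =
      (∑ k, ∑ j ∈ Finset.univ.erase k, f k j * ((g k - g j) / (b k - b j))) / 2 := by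
  have swap : ∑ k, ∑ j ∈ Finset.univ.erase k, f k j * g j / (b k - b j) =
      ∑ k, ∑ j ∈ Finset.univ.erase k, -(f k j * g k / (b k - b j)) := by
    rw [Finset.sum_comm' (t' := Finset.univ) (s' := fun j => Finset.univ.erase j)
      (by intro x y; simp [eq_comm])]
    refine Finset.sum_congr rfl fun k _ => Finset.sum_congr rfl fun j _ => ?_
    rw [hf j k, ← neg_sub (b k) (b j), div_neg]
  have h : ∑ k, ∑ j ∈ Finset.univ.erase k, f k j * ((g k - g j) / (b k - b j)) =
      ∑ k, ∑ j ∈ Finset.univ.erase k, f k j * g k / (b k - b j) -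
      ∑ k, ∑ j ∈ Finset.univ.erase k, f k j * g j / (b k - b j) := by
    simp_rw [← Finset.sum_sub_distrib]
    refine Finset.sum_congr rfl fun k _ => Finset.sum_congr rfl fun j _ => ?_
    ring
  rw [h, swap]
  simp_rw [Finset.sum_neg_distrib, Finset.sum_mul]
  rw [sub_neg_eq_add, add_self_div_two]
  refine Finset.sum_congr rfl fun k _ => Finset.sum_congr rfl fun j _ => ?_
  ring

/-- The pair terms are antisymmetric and cancel. On the unit sphere the numerator of `Ψ_u` is
therefore monic of degree `m + 1`. -/
theorem sum_integralF (b p q : Fin (m + 2) → ℝ) :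
    ∑ k, integralF b p q k = ∑ k, q k ^ 2 := by
  have h := sum_div_sub_mul b (fun k j => (p k * q j - p j * q k) ^ 2) (fun k j => by ring)
    (fun _ => 1)
  simp only [sub_self, zero_div, mul_zero, mul_one, Finset.sum_const_zero] at h
  simp only [integralF, Finset.sum_add_distrib, h, add_zero]

theorem lagrange_identity (p q z : Fin (m + 2) → ℝ) :
    (∑ k, p k ^ 2 * z k) * (∑ k, q k ^ 2 * z k) - (∑ k, p k * q k * z k) ^ 2 =
      (∑ k, ∑ j, (p k * q j - p j * q k) ^ 2 * (z k * z j)) / 2 := by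
  have h1 : (∑ k, p k ^ 2 * z k) * (∑ k, q k ^ 2 * z k) =
      ∑ k, ∑ j, p k ^ 2 * z k * (q j ^ 2 * z j) := Finset.sum_mul_sum _ _ _ _
  have h2 : (∑ k, p k ^ 2 * z k) * (∑ k, q k ^ 2 * z k) =
      ∑ k, ∑ j, q k ^ 2 * z k * (p j ^ 2 * z j) := by rw [mul_comm]; exact Finset.sum_mul_sum _ _ _ _
  have h3 : (∑ k, p k * q k * z k) ^ 2 =
      ∑ k, ∑ j, p k * q k * z k * (p j * q j * z j) := by rw [sq]; exact Finset.sum_mul_sum _ _ _ _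
  have h4 : ∑ k, ∑ j, (p k * q j - p j * q k) ^ 2 * (z k * z j) =
      ∑ k, ∑ j, p k ^ 2 * z k * (q j ^ 2 * z j) + ∑ k, ∑ j, q k ^ 2 * z k * (p j ^ 2 * z j)
        - 2 * ∑ k, ∑ j, p k * q k * z k * (p j * q j * z j) := by
    simp_rw [Finset.mul_sum, ← Finset.sum_add_distrib, ← Finset.sum_sub_distrib]
    refine Finset.sum_congr rfl fun k _ => Finset.sum_congr rfl fun j _ => ?_
    ring
  rw [h4, ← h1, ← h2, ← h3]
  ring

/-- The quadratic terms form a Lagrange identity with weights `1 / (u - b k)`, whose diagonal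
vanishes; so there are no double poles, and each product of two weights splits as their difference
over `b k - b j`. -/
theorem psi_eq_sum (hb : Function.Injective b) {u : ℝ} (hu : ∀ l, u ≠ b l) :
    psi b p q u = ∑ k, integralF b p q k / (u - b k) := by
  have h := sum_div_sub_mul b (fun k j => (p k * q j - p j * q k) ^ 2) (fun k j => by ring)
    (fun k => (u - b k)⁻¹)
  have hl := lagrange_identity p q (fun k => (u - b k)⁻¹)
  have e : ∑ k, ∑ j ∈ Finset.univ.erase k, (p k * q j - p j * q k) ^ 2 *
      (((u - b k)⁻¹ - (u - b j)⁻¹) / (b k - b j)) =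
      ∑ k, ∑ j, (p k * q j - p j * q k) ^ 2 * ((u - b k)⁻¹ * (u - b j)⁻¹) := by
    refine Finset.sum_congr rfl fun k _ => ?_
    rw [← Finset.add_sum_erase _ _ (Finset.mem_univ k)]
    simp only [sub_self, ne_eq, OfNat.ofNat_ne_zero, not_false_eq_true, zero_pow, zero_mul,
      zero_add]
    refine Finset.sum_congr rfl fun j hj => ?_
    have h1 := sub_ne_zero.2 (hu k)
    have h2 := sub_ne_zero.2 (hu j)
    have h3 : b k - b j ≠ 0 := sub_ne_zero.2 fun h => Finset.ne_of_mem_erase hj (hb h.symm)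
    field_simp
    ring
  rw [e] at h
  simp only [psi, integralF, add_mul, Finset.sum_add_distrib, div_eq_mul_inv] at *
  linear_combination hl - h

/-- The polynomial form stays valid at `u = b k`, where the rational one breaks down. This is needed
when a coordinate of `q` vanishes and an elliptic coordinate equals some `b k`. -/
theorem fracNumerator_identity (hb : Function.Injective b) :
    (fracNumerator b (fun k => p k ^ 2) + polyB b) * fracNumerator b (fun k => q k ^ 2) -
      fracNumerator b (fun k => p k * q k) ^ 2 =
      polyB b * fracNumerator b (integralF b p q) := by
  refine eq_of_infinite_eval_eq _ _ (Set.Infinite.mono (s := (Set.range b)ᶜ) (fun u hu => ?_)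
    (Set.finite_range b).infinite_compl)
  have hu' : ∀ l, u ≠ b l := fun l h => hu ⟨l, h.symm⟩
  have h := psi_eq_sum (p := p) (q := q) hb hu'
  simp only [Set.mem_ofPred_eq, eval_sub, eval_mul, eval_add, eval_pow, eval_polyB,
    eval_fracNumerator_of_ne hu', ← h, psi]
  ring

theorem spectralPoly_eq (hb : Function.Injective b) :
    spectralPoly b p q = C (-4) *
      ((fracNumerator b (fun k => p k ^ 2) + polyB b) * fracNumerator b (fun k => q k ^ 2) -
      fracNumerator b (fun k => p k * q k) ^ 2) := by
  rw [fracNumerator_identity hb, spectralPoly]; ring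

/-- `y² = R(u)` at the zeros of `(R_u q, q)`. -/
theorem eval_spectralPoly_of_root (hb : Function.Injective b) {u : ℝ}
    (hu : (fracNumerator b (fun k => q k ^ 2)).eval u = 0) :
    (spectralPoly b p q).eval u = (2 * (fracNumerator b (fun k => p k * q k)).eval u) ^ 2 := by
  rw [spectralPoly_eq hb]
  simp only [eval_mul, eval_sub, eval_C, hu, eval_pow]
  ring

/-- Euler's identities `∑ u i ^ j / ∏ (u i - u l) = 0`. -/
theorem sum_pow_div_prod_eq_zero {n : ℕ} {u : Fin (n + 1) → ℝ} (hu : Function.Injective u) {j : ℕ}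
    (hj : j < n) : ∑ i, u i ^ j / ∏ l ∈ Finset.univ.erase i, (u i - u l) = 0 := by
  -- The sum is the coefficient of degree `n` of the interpolation polynomial of `X ^ j` at `n + 1`
  -- nodes, which is `X ^ j` itself.
  have h := Lagrange.coeff_eq_sum (s := Finset.univ) (v := u) hu.injOn (P := X ^ j)
    (by rw [degree_X_pow]; simp; exact_mod_cast (by omega : j < n + 1))
  simp only [Finset.card_univ, Fintype.card_fin, Nat.add_one_sub_one, coeff_X_pow, eval_pow,
    eval_X, if_neg (show ¬ n = j by omega)] at h
  exact h.symm

end Algebra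

/-! ### Interlacing and the branch points -/

section Interlacing

theorem neg_one_pow_mul_prod_pos {ι : Type*} (s : Finset ι) (f : ι → ℝ) (u : ℝ)
    (h : ∀ k ∈ s, u ≠ f k) :
    0 < (-1) ^ (s.filter fun k => u < f k).card * ∏ k ∈ s, (u - f k) := by
  have e : (-1 : ℝ) ^ (s.filter fun k => u < f k).card = ∏ k ∈ s, if u < f k then -1 else 1 := by
    rw [Finset.prod_ite]; simp
  rw [e, ← Finset.prod_mul_distrib]
  refine Finset.prod_pos fun k hk => ?_
  split_ifs with h1
  · linarith
  · have := lt_of_le_of_ne (not_lt.1 h1) (h k hk).symm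
    linarith

theorem prod_interleave {M : Type*} [CommMonoid M] (f : ℕ → M) (n : ℕ) :
    ∏ j ∈ Finset.range (2 * n), f j = ∏ i ∈ Finset.range n, (f (2 * i) * f (2 * i + 1)) := by
  induction n with
  | zero => simp
  | succ n ih =>
    rw [show 2 * (n + 1) = 2 * n + 1 + 1 by ring, Finset.prod_range_succ, Finset.prod_range_succ,
      ih, Finset.prod_range_succ, mul_assoc]

/-- The increasing rearrangement of two sequences that are separated in pairs. -/
theorem exists_interleave {β d v : ℕ → ℝ} (h1 : ∀ i, β i < v i) (h2 : ∀ i, d i < v i)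
    (h3 : ∀ i, v i < β (i + 1)) (h4 : ∀ i, v i < d (i + 1)) (h5 : ∀ i, β i ≠ d i) :
    ∃ E : ℕ → ℝ, StrictMono E ∧ (∀ i, E (2 * i) = min (β i) (d i)) ∧
      ∀ i, E (2 * i + 1) = max (β i) (d i) := by
  refine ⟨fun j => if Even j then min (β (j / 2)) (d (j / 2)) else max (β (j / 2)) (d (j / 2)),
    ?_, fun i => ?_, fun i => ?_⟩
  · refine strictMono_nat_of_lt_succ fun j => ?_
    obtain ⟨i, rfl | rfl⟩ := j.even_or_odd'
    · have e : (2 * i + 1) / 2 = i := by omega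
      have e' : ¬ Even (2 * i + 1) := by simp
      simp only [even_two, Even.mul_right, if_true, e', if_false, e, ne_eq, OfNat.ofNat_ne_zero,
        not_false_eq_true, mul_div_cancel_left₀]
      exact min_lt_max.2 (h5 i)
    · have e : (2 * i + 1) / 2 = i := by omega
      have e' : ¬ Even (2 * i + 1) := by simp
      have f : (2 * i + 1 + 1) / 2 = i + 1 := by omega
      have f' : Even (2 * i + 1 + 1) := ⟨i + 1, by ring⟩
      simp only [e', if_false, e, f', if_true, f]
      exact (max_lt (h1 i) (h2 i)).trans (lt_min (h3 i) (h4 i))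
  · simp
  · have e : (2 * i + 1) / 2 = i := by omega
    have e' : ¬ Even (2 * i + 1) := by simp
    simp only [e', if_false, e]

theorem exists_zero_of_mul_neg {f : ℝ → ℝ} (hf : Continuous f) {α β : ℝ} (hαβ : α < β)
    (h : f α * f β < 0) : ∃ u ∈ Set.Ioo α β, f u = 0 := by
  rcases mul_neg_iff.1 h with ⟨ha, hb⟩ | ⟨ha, hb⟩
  · exact intermediate_value_Ioo' hαβ.le hf.continuousOn ⟨hb, ha⟩
  · exact intermediate_value_Ioo hαβ.le hf.continuousOn ⟨ha, hb⟩

theorem derivative_eval_ne_zero_of_squarefree {R : ℝ[X]} (hR : Squarefree R) {u : ℝ}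
    (hu : R.eval u = 0) : (derivative R).eval u ≠ 0 := by
  have h := (PerfectField.separable_iff_squarefree.2 hR).eval₂_derivative_ne_zero (RingHom.id ℝ)
    (x := u)
  exact h hu

/-- If `R(u) = 0` and `R ≤ 0` nearby, then `u` is a local maximum and hence a multiple root. This
upgrades `R(u i) = y i ^ 2 ≥ 0` to a strict inequality somewhere in the same gap. -/
theorem exists_eval_pos_of_squarefree {R : ℝ[X]} (hR : Squarefree R) {α β u : ℝ}
    (hu : u ∈ Set.Ioo α β) (h0 : 0 ≤ R.eval u) : ∃ v ∈ Set.Ioo α β, 0 < R.eval v := by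
  rcases h0.lt_or_eq with h | h
  · exact ⟨u, hu, h⟩
  by_contra! hc
  have hmax : IsLocalMax (fun t => R.eval t) u := by
    filter_upwards [Ioo_mem_nhds hu.1 hu.2] with t ht
    rw [← h]
    exact hc t ht
  exact derivative_eval_ne_zero_of_squarefree hR h.symm (hmax.hasDerivAt_eq_zero (R.hasDerivAt u))

variable {m : ℕ}

theorem card_filter_lt {β : Fin (m + 2) → ℝ} (hβ : StrictMono β) {i : Fin (m + 1)} {u : ℝ}
    (hu : u ∈ Set.Ioo (β i.castSucc) (β i.succ)) :
    (Finset.univ.filter fun k => u < β k).card = m + 1 - i := by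
  have : (Finset.univ.filter fun k => u < β k) = Finset.Ioi i.castSucc := by
    ext k
    simp only [Finset.mem_filter, Finset.mem_univ, true_and, Finset.mem_Ioi]
    constructor
    · intro h
      exact hβ.lt_iff_lt.1 (hu.1.trans h)
    · intro h
      exact hu.2.trans_le (hβ.monotone (Fin.castSucc_lt_iff_succ_le.1 h))
  rw [this, Fin.card_Ioi]
  simp

/-- At a node only one summand survives, with the sign of `∏ (β l - β j)`, and these signs alternate
along the sorted nodes. -/
theorem exists_root_fracNumerator {β w : Fin (m + 2) → ℝ} (hβ : StrictMono β) (hw : ∀ k, 0 < w k)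
    (i : Fin (m + 1)) :
    ∃ u ∈ Set.Ioo (β i.castSucc) (β i.succ), (fracNumerator β w).eval u = 0 := by
  have key : ∀ l : Fin (m + 2), 0 < (-1) ^ (m + 1 - (l : ℕ)) * (fracNumerator β w).eval (β l) := by
    intro l
    have h := neg_one_pow_mul_prod_pos (Finset.univ.erase l) β (β l)
      (fun k hk h => Finset.ne_of_mem_erase hk (hβ.injective h.symm))
    have e : ((Finset.univ.erase l).filter fun k => β l < β k) = Finset.Ioi l := by
      ext k
      simp only [Finset.mem_filter, Finset.mem_erase, Finset.mem_univ, and_true, hβ.lt_iff_lt,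
        Finset.mem_Ioi]
      exact ⟨fun h => h.2, fun h => ⟨h.ne', h⟩⟩
    rw [e, Fin.card_Ioi] at h
    rw [eval_fracNumerator_self, mul_left_comm]
    refine mul_pos (hw l) ?_
    simpa using h
  refine exists_zero_of_mul_neg (fracNumerator β w).continuous (hβ (Fin.castSucc_lt_succ (i := i))) ?_
  have h1 := key i.castSucc
  have h2 := key i.succ
  have e : m + 1 - (i.castSucc : ℕ) = (m + 1 - (i.succ : ℕ)) + 1 := by
    simp only [Fin.val_castSucc, Fin.val_succ]; omega
  rw [e, pow_succ] at h1
  have h3 := mul_pos h1 h2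
  have h4 : ((-1 : ℝ) ^ (m + 1 - (i.succ : ℕ))) ^ 2 = 1 := by
    rw [← pow_mul, mul_comm, pow_mul]; simp
  nlinarith

/-- The sign changes give `m` roots between the points `v i`. The remaining monic linear factor has
its root to the left of `v 0`, by the sign of `F` there. -/
theorem eq_prod_of_alternating {F : ℝ[X]} (hF : F.Monic) (hdeg : F.natDegree = m + 1)
    {v : Fin (m + 1) → ℝ} (hv : StrictMono v)
    (hsign : ∀ i : Fin (m + 1), 0 < (-1) ^ (m - (i : ℕ)) * F.eval (v i)) :
    ∃ d : Fin (m + 1) → ℝ, F = ∏ i, (X - C (d i)) ∧ (∀ i, d i < v i) ∧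
      ∀ i : Fin m, v i.castSucc < d i.succ := by
  have h1 : ∀ i : Fin m, ∃ t ∈ Set.Ioo (v i.castSucc) (v i.succ), F.eval t = 0 := by
    intro i
    refine exists_zero_of_mul_neg F.continuous (hv (Fin.castSucc_lt_succ (i := i))) ?_
    have h1 := hsign i.castSucc
    have h2 := hsign i.succ
    have e : m - (i.castSucc : ℕ) = (m - (i.succ : ℕ)) + 1 := by
      simp only [Fin.val_castSucc, Fin.val_succ]; omega
    rw [e, pow_succ] at h1
    have h3 := mul_pos h1 h2
    have h4 : ((-1 : ℝ) ^ (m - (i.succ : ℕ))) ^ 2 = 1 := by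
      rw [← pow_mul, mul_comm, pow_mul]; simp
    nlinarith
  choose t ht h0 using h1
  have tmono : StrictMono t := by
    intro i j hij
    exact (ht i).2.trans_le ((hv.monotone (by
      rw [Fin.le_def]; simpa using hij)).trans (ht j).1.le)
  have hdvd : ∏ i, (X - C (t i)) ∣ F :=
    Finset.prod_dvd_of_coprime
      (fun i _ j _ hij => pairwise_coprime_X_sub_C tmono.injective hij)
      (fun i _ => dvd_iff_isRoot.2 (h0 i))
  obtain ⟨G, hG⟩ := hdvd
  have hmon : (∏ i, (X - C (t i))).Monic := monic_prod_X_sub_C t _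
  have hGm : G.Monic := hmon.of_mul_monic_left (hG ▸ hF)
  have hGd : G.natDegree = 1 := by
    have := hmon.natDegree_mul hGm
    rw [← hG, hdeg] at this
    simp at this
    omega
  have hGe : G = X - C (-G.coeff 0) := by
    rw [hGm.eq_X_add_C hGd]; simp
  set c := -G.coeff 0
  have hc : c < v 0 := by
    have hs := hsign 0
    have hp := neg_one_pow_mul_prod_pos Finset.univ t (v 0) (fun k _ => by
      have := (ht k).1
      have h' : v 0 ≤ v k.castSucc := hv.monotone (Fin.zero_le _)
      exact (h'.trans_lt this).ne)
    have hcard : (Finset.univ.filter fun k => v 0 < t k).card = m := by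
      rw [Finset.filter_true_of_mem (fun k _ => by
        have := (ht k).1
        have h' : v 0 ≤ v k.castSucc := hv.monotone (Fin.zero_le _)
        exact (h'.trans_lt this))]
      simp
    rw [hcard] at hp
    rw [hG, hGe, eval_mul, eval_prod] at hs
    simp only [eval_sub, eval_X, eval_C] at hs
    rw [← mul_assoc] at hs
    linarith [pos_of_mul_pos_right hs hp.le]
  refine ⟨Fin.cons c t, ?_, fun i => ?_, fun i => ?_⟩
  · rw [Fin.prod_univ_succ, hG]
    simp only [Fin.cons_zero, Fin.cons_succ]
    rw [← hGe, mul_comm]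
  · refine Fin.cases ?_ (fun j => ?_) i
    · simpa using hc
    · simpa using (ht j).2
  · simpa using (ht i).1

/-- Between consecutive `β` the sign of `polyB β` is known, so `R > 0` at the points `v i` makes the
signs of `F` alternate there. Hence `F` splits, and the `v i` separate the successive pairs `β i`,
`d i`; within a pair the order is unknown, but equality would give a double root. Sorting each pair
yields `E`. -/
theorem exists_branchPoints {β : Fin (m + 2) → ℝ} (hβ : StrictMono β) {F R : ℝ[X]} (hF : F.Monic)
    (hdeg : F.natDegree = m + 1) (hR : R = C (-4) * F * polyB β) (hsq : Squarefree R)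
    {v : Fin (m + 1) → ℝ} (hv : ∀ i, v i ∈ Set.Ioo (β i.castSucc) (β i.succ))
    (hpos : ∀ i, 0 < R.eval (v i)) :
    (∃ d : Fin (m + 1) → ℝ, F = ∏ i, (X - C (d i))) ∧
    ∃ E : ℕ → ℝ, StrictMono E ∧ R = C (-4) * ∏ j ∈ Finset.range (2 * m + 3), (X - C (E j)) ∧
      ∀ i : Fin (m + 1), E (2 * i) ≤ β i.castSucc ∧ β i.castSucc ≤ E (2 * i + 1) ∧
        E (2 * i + 2) ≤ β i.succ ∧ β i.succ ≤ E (2 * i + 3) := by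
  have vmono : StrictMono v := by
    intro i j hij
    exact (hv i).2.trans_le ((hβ.monotone (by
      rw [Fin.le_def]; simpa using hij)).trans (hv j).1.le)
  have hsign : ∀ i : Fin (m + 1), 0 < (-1) ^ (m - (i : ℕ)) * F.eval (v i) := by
    intro i
    have hβv : ∀ k ∈ Finset.univ, v i ≠ β k := by
      intro k _ h
      have := hpos i
      rw [hR, eval_mul, eval_polyB, Finset.prod_eq_zero (Finset.mem_univ k) (by rw [h, sub_self]),
        mul_zero] at this
      exact lt_irrefl _ this
    have h1 := neg_one_pow_mul_prod_pos Finset.univ β (v i) hβv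
    rw [card_filter_lt hβ (hv i)] at h1
    have h2 := hpos i
    rw [hR, eval_mul, eval_mul, eval_C, eval_polyB] at h2
    rw [show m + 1 - (i : ℕ) = (m - i) + 1 by omega, pow_succ] at h1
    have h3 := mul_pos h1 h2
    have h5 : 0 < (∏ k, (v i - β k)) ^ 2 * ((-1) ^ (m - (i : ℕ)) * F.eval (v i)) := by
      nlinarith
    exact pos_of_mul_pos_right h5 (sq_nonneg _)
  obtain ⟨d, hd, hdv, hvd⟩ := eq_prod_of_alternating hF hdeg vmono hsign
  refine ⟨⟨d, hd⟩, ?_⟩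
  have hne : ∀ i k, β k ≠ d i := by
    intro i k h
    have h0 : (derivative R).eval (β k) = 0 := by
      have hB : (polyB β).eval (β k) = 0 := by
        rw [eval_polyB]; exact Finset.prod_eq_zero (Finset.mem_univ k) (sub_self _)
      have hFk : F.eval (β k) = 0 := by
        rw [hd, eval_prod]
        exact Finset.prod_eq_zero (Finset.mem_univ i) (by simp [h])
      rw [hR, derivative_mul, eval_add, eval_mul, eval_mul, eval_mul, hB, hFk]
      simp
    refine derivative_eval_ne_zero_of_squarefree hsq ?_ h0
    rw [hR, eval_mul, eval_polyB, Finset.prod_eq_zero (Finset.mem_univ k) (sub_self _), mul_zero]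
  -- The finite sequences are continued to infinite ones that are still separated, so that the
  -- merged sequence is strictly increasing on `ℕ`. Only its first `2 m + 3` terms are roots; the
  -- last of them is the unpaired largest `β`.
  let β' : ℕ → ℝ := fun i => if h : i < m + 2 then β ⟨i, h⟩ else β (Fin.last _) + (i - (m + 1))
  let d' : ℕ → ℝ := fun i => if h : i < m + 1 then d ⟨i, h⟩ else β' i + 1 / 2
  let v' : ℕ → ℝ := fun i => if h : i < m + 1 then v ⟨i, h⟩ else β' i + 3 / 4
  have hβ'succ : ∀ i, m + 1 ≤ i → β' (i + 1) = β' i + 1 := by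
    intro i hi
    rcases hi.eq_or_lt with rfl | h
    · simp [β', Fin.last]
    · simp only [β', dif_neg (show ¬ i + 1 < m + 2 by omega), dif_neg (show ¬ i < m + 2 by omega)]
      push_cast; ring
  have hβ'v : ∀ i (h : i < m + 1), v ⟨i, h⟩ ∈ Set.Ioo (β' i) (β' (i + 1)) := by
    intro i h
    have := hv ⟨i, h⟩
    simpa [β', dif_pos (show i < m + 2 by omega), dif_pos (show i + 1 < m + 2 by omega)] using this
  obtain ⟨E, hE, hE0, hE1⟩ := exists_interleave (β := β') (d := d') (v := v')
    (fun i => by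
      simp only [v']
      split_ifs with h
      · exact (hβ'v i h).1
      · linarith)
    (fun i => by
      simp only [v', d']
      split_ifs with h
      · exact hdv _
      · linarith)
    (fun i => by
      simp only [v']
      split_ifs with h
      · exact (hβ'v i h).2
      · rw [hβ'succ i (by omega)]; linarith)
    (fun i => by
      simp only [v', d']
      split_ifs with h h' h'
      · exact hvd ⟨i, by omega⟩
      · linarith [(hβ'v i h).2]
      · omega
      · rw [hβ'succ i (by omega)]; linarith)
    (fun i => by
      simp only [d']
      split_ifs with h
      · simp only [β', dif_pos (show i < m + 2 by omega)]
        exact hne _ _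
      · linarith)
  refine ⟨E, hE, ?_, fun i => ?_⟩
  · rw [hR, mul_assoc, show 2 * m + 3 = 2 * (m + 1) + 1 by ring, Finset.prod_range_succ,
      prod_interleave]
    have hlast : E (2 * (m + 1)) = β (Fin.last _) := by
      rw [hE0, min_eq_left]
      · simp [β', Fin.last]
      · simp only [d', lt_self_iff_false, dite_false]; linarith
    have hpair : ∀ i (h : i < m + 1), (X - C (E (2 * i))) * (X - C (E (2 * i + 1))) =
        (X - C (d ⟨i, h⟩)) * (X - C (β (Fin.castSucc ⟨i, h⟩))) := by
      intro i h
      have e1 : β' i = β (Fin.castSucc ⟨i, h⟩) := by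
        simp only [β', dif_pos (show i < m + 2 by omega)]; rfl
      have e2 : d' i = d ⟨i, h⟩ := by simp only [d', dif_pos h]
      rw [hE0, hE1, e1, e2]
      rcases le_total (β (Fin.castSucc ⟨i, h⟩)) (d ⟨i, h⟩) with h' | h'
      · rw [min_eq_left h', max_eq_right h', mul_comm]
      · rw [min_eq_right h', max_eq_left h']
    rw [hlast, hd, polyB, Fin.prod_univ_castSucc (n := m + 1),
      ← mul_assoc (∏ i, (X - C (d i))), ← Finset.prod_mul_distrib, Finset.prod_range]
    congr 2
    exact Finset.prod_congr rfl fun i _ => (hpair i i.2).symm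
  · have e1 : β' i = β i.castSucc := by
      simp only [β', dif_pos (show (i : ℕ) < m + 2 by omega)]; rfl
    have e2 : β' (i + 1) = β i.succ := by
      simp only [β', dif_pos (show (i : ℕ) + 1 < m + 2 by omega)]; rfl
    rw [show 2 * (i : ℕ) + 2 = 2 * (i + 1) by ring, show 2 * (i : ℕ) + 3 = 2 * (i + 1) + 1 by ring,
      hE0, hE1, hE0, hE1, e1, e2]
    exact ⟨min_le_left _ _, le_max_left _ _, min_le_left _ _, le_max_left _ _⟩

/-- An even number of roots lies to the right and the leading coefficient is negative. For `i = m +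
1` the upper end is not a root but a term of the continuation of `E`. -/
theorem eval_neg_of_mem_gap {R : ℝ[X]} {E : ℕ → ℝ} (hE : StrictMono E)
    (hR : R = C (-4) * ∏ j ∈ Finset.range (2 * m + 3), (X - C (E j))) {i : ℕ} (hi : i ≤ m + 1)
    {u : ℝ} (hu : u ∈ Set.Ioo (E (2 * i)) (E (2 * i + 1))) : R.eval u < 0 := by
  have h := neg_one_pow_mul_prod_pos (Finset.range (2 * m + 3)) E u (fun k _ h => by
    rw [h, Set.mem_Ioo, hE.lt_iff_lt, hE.lt_iff_lt] at hu; omega)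
  have e : ((Finset.range (2 * m + 3)).filter fun k => u < E k) =
      Finset.Ioo (2 * i) (2 * m + 3) := by
    ext k
    simp only [Finset.mem_filter, Finset.mem_range, Finset.mem_Ioo]
    constructor
    · rintro ⟨h1, h2⟩
      exact ⟨hE.lt_iff_lt.1 (hu.1.trans h2), h1⟩
    · rintro ⟨h1, h2⟩
      exact ⟨h2, hu.2.trans_le (hE.monotone h1)⟩
  rw [e, Nat.card_Ioo, show 2 * m + 3 - 2 * i - 1 = 2 * (m + 1 - i) by omega, pow_mul] at h
  simp only [even_two, Even.neg_pow, one_pow, one_mul] at h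
  rw [hR, eval_mul, eval_C, eval_prod]
  simp only [eval_sub, eval_X, eval_C]
  linarith

/-- Between `E (2 i)` and `E (2 i + 3)` the polynomial is negative outside the closed interval in
the middle. -/
theorem mem_oval_of_interlacing {R : ℝ[X]} {E : ℕ → ℝ} (hE : StrictMono E)
    (hR : R = C (-4) * ∏ j ∈ Finset.range (2 * m + 3), (X - C (E j))) {i : ℕ} (hi : i < m + 1)
    {α β u : ℝ} (hα : E (2 * i) ≤ α) (hβ : β ≤ E (2 * i + 3)) (hu : u ∈ Set.Ioo α β)
    (h0 : 0 ≤ R.eval u) : u ∈ Set.Icc (E (2 * i + 1)) (E (2 * i + 2)) := by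
  constructor
  · by_contra! h
    exact absurd h0 (not_le.2 (eval_neg_of_mem_gap hE hR (i := i) (by omega)
      ⟨hα.trans_lt hu.1, h⟩))
  · by_contra! h
    exact absurd h0 (not_le.2 (eval_neg_of_mem_gap hE hR (i := i + 1) (by omega)
      ⟨h, hu.2.trans_le hβ⟩))

end Interlacing

/-! ### The ovals -/

/-- `R = -4 ∏ (u - E j)`, `0 ≤ j ≤ 2 m + 2`, with `E` strictly increasing. -/
structure BranchData (m : ℕ) (R : ℝ[X]) (E : ℕ → ℝ) : Prop where
  strictMono : StrictMono E
  eq_prod : R = C (-4) * ∏ j ∈ Finset.range (2 * m + 3), (X - C (E j))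

/-- The cofactor `G` in `R = (u - e (2 i + 1)) (e (2 i + 2) - u) G(u)`. -/
def ovalCofactor (m : ℕ) (E : ℕ → ℝ) (i : ℕ) : ℝ[X] :=
  C 4 * (∏ j ∈ Finset.range (2 * i + 1), (X - C (E j))) *
    ∏ j ∈ Finset.Ico (2 * i + 3) (2 * m + 3), (C (E j) - X)

/-- The abscissa of the point of the `i`-th oval with parameter `θ`. -/
def ovalAbscissa (R : ℝ[X]) (i : ℕ) (θ : ℝ) : ℝ := ovalMid R i - ovalRad R i * Real.cos θ

theorem exists_cos_sin {c σ : ℝ} (h : c ^ 2 + σ ^ 2 = 1) : ∃ θ, Real.cos θ = c ∧ Real.sin θ = σ := by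
  have h1 : -1 ≤ c := by nlinarith [sq_nonneg σ]
  have h2 : c ≤ 1 := by nlinarith [sq_nonneg σ]
  rcases le_total 0 σ with hs | hs
  · refine ⟨Real.arccos c, Real.cos_arccos h1 h2, ?_⟩
    rw [Real.sin_arccos, show 1 - c ^ 2 = σ ^ 2 by linarith, Real.sqrt_sq hs]
  · refine ⟨-Real.arccos c, by rw [Real.cos_neg, Real.cos_arccos h1 h2], ?_⟩
    rw [Real.sin_neg, Real.sin_arccos, show 1 - c ^ 2 = (-σ) ^ 2 by linarith,
      Real.sqrt_sq (by linarith), neg_neg]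

theorem eq_add_two_pi_of_cos_sin_eq {θ η : ℝ} (hc : Real.cos θ = Real.cos η)
    (hs : Real.sin θ = Real.sin η) : ∃ n : ℤ, θ = η + n * (2 * Real.pi) := by
  have h : Real.cos (θ - η) = 1 := by
    rw [Real.cos_sub, hc, hs]; nlinarith [Real.sin_sq_add_cos_sq η]
  obtain ⟨n, hn⟩ := (Real.cos_eq_one_iff _).1 h
  exact ⟨n, by linarith⟩

namespace BranchData

variable {m : ℕ} {R : ℝ[X]} {E : ℕ → ℝ} (h : BranchData m R E)
include h

theorem branchPoint_eq {j : ℕ} (hj : j < 2 * m + 3) : branchPoint R j = E j := by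
  have hr : R.roots = (Multiset.range (2 * m + 3)).map E := by
    rw [h.eq_prod, roots_C_mul _ (by norm_num)]
    have : ∏ j ∈ Finset.range (2 * m + 3), (X - C (E j)) =
        (((Multiset.range (2 * m + 3)).map E).map fun a => X - C a).prod := by
      rw [Multiset.map_map]; rfl
    rw [this, roots_multiset_prod_X_sub_C]
  rw [branchPoint, hr, ← Multiset.map_sort (r := (· ≤ ·)) _ _ _ (fun a _ b _ =>
    h.strictMono.le_iff_le.symm), Multiset.sort_range]
  simp [List.getD, hj]

theorem ovalLeft_eq (i : Fin (m + 1)) : ovalLeft R i = E (2 * i + 1) :=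
  h.branchPoint_eq (by omega)

theorem ovalRight_eq (i : Fin (m + 1)) : ovalRight R i = E (2 * i + 2) :=
  h.branchPoint_eq (by omega)

theorem left_lt_right (i : Fin (m + 1)) : ovalLeft R i < ovalRight R i := by
  rw [h.ovalLeft_eq, h.ovalRight_eq]; exact h.strictMono (by omega)

theorem right_lt_left {i j : Fin (m + 1)} (hij : i < j) : ovalRight R i < ovalLeft R j := by
  rw [h.ovalLeft_eq, h.ovalRight_eq]
  exact h.strictMono (by have : (i : ℕ) < j := hij; omega)

theorem rad_pos (i : Fin (m + 1)) : 0 < ovalRad R i :=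
  half_pos (sub_pos.2 (h.left_lt_right i))

theorem eval_eq (u : ℝ) : R.eval u = -4 * ∏ j ∈ Finset.range (2 * m + 3), (u - E j) := by
  rw [h.eq_prod]; simp [eval_prod]

theorem eq_mul_cofactor (i : Fin (m + 1)) :
    R = (X - C (ovalLeft R i)) * (C (ovalRight R i) - X) * ovalCofactor m E i := by
  rw [h.ovalLeft_eq, h.ovalRight_eq]
  conv_lhs => rw [h.eq_prod]
  have hi : (i : ℕ) < m + 1 := i.2
  have e1 : ∏ j ∈ Finset.Ico (2 * (i : ℕ) + 3) (2 * m + 3), (C (E j) - X) =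
      ∏ j ∈ Finset.Ico (2 * (i : ℕ) + 3) (2 * m + 3), (X - C (E j)) := by
    have : ∀ j ∈ Finset.Ico (2 * (i : ℕ) + 3) (2 * m + 3), C (E j) - X = -1 * (X - C (E j)) :=
      fun j _ => by ring
    rw [Finset.prod_congr rfl this, Finset.prod_mul_distrib, Finset.prod_const, Nat.card_Ico,
      show 2 * m + 3 - (2 * (i : ℕ) + 3) = 2 * (m - i) by omega, pow_mul]
    simp
  rw [← Finset.prod_range_mul_prod_Ico _ (show 2 * (i : ℕ) + 3 ≤ 2 * m + 3 by omega),
    Finset.prod_range_succ, Finset.prod_range_succ, ovalCofactor, e1]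
  simp only [map_neg]
  ring

theorem cofactor_pos (i : Fin (m + 1)) {u : ℝ}
    (hu : u ∈ Set.Icc (ovalLeft R i) (ovalRight R i)) : 0 < (ovalCofactor m E i).eval u := by
  rw [h.ovalLeft_eq, h.ovalRight_eq] at hu
  rw [ovalCofactor, eval_mul, eval_mul, eval_prod, eval_prod, eval_C]
  refine mul_pos (mul_pos (by norm_num) (Finset.prod_pos fun j hj => ?_))
    (Finset.prod_pos fun j hj => ?_)
  · simp only [eval_sub, eval_X, eval_C, sub_pos]
    exact (h.strictMono (Finset.mem_range.1 hj)).trans_le hu.1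
  · simp only [eval_sub, eval_X, eval_C, sub_pos]
    exact hu.2.trans_lt (h.strictMono (by have := (Finset.mem_Ico.1 hj).1; omega))

theorem abscissa_mem (i : Fin (m + 1)) (θ : ℝ) :
    ovalAbscissa R i θ ∈ Set.Icc (ovalLeft R i) (ovalRight R i) := by
  have hr := h.rad_pos i
  have h1 := Real.cos_le_one θ
  have h2 := Real.neg_one_le_cos θ
  have e1 : ovalLeft R i = ovalMid R i - ovalRad R i := by simp only [ovalMid, ovalRad]; ring
  have e2 : ovalRight R i = ovalMid R i + ovalRad R i := by simp only [ovalMid, ovalRad]; ring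
  rw [e1, e2, ovalAbscissa]
  constructor <;> nlinarith

theorem eval_eq_cofactor (i : Fin (m + 1)) (u : ℝ) :
    R.eval u = (ovalRad R i ^ 2 - (ovalMid R i - u) ^ 2) * (ovalCofactor m E i).eval u := by
  conv_lhs => rw [h.eq_mul_cofactor i]
  simp only [eval_mul, eval_sub, eval_X, eval_C, ovalMid, ovalRad]
  ring

theorem eval_abscissa (i : Fin (m + 1)) (θ : ℝ) :
    R.eval (ovalAbscissa R i θ) =
      (ovalRad R i * Real.sin θ) ^ 2 * (ovalCofactor m E i).eval (ovalAbscissa R i θ) := by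
  rw [h.eval_eq_cofactor i]
  congr 1
  rw [ovalAbscissa]
  have := Real.sin_sq_add_cos_sq θ
  linear_combination (ovalRad R i) ^ 2 * (-this)

/-- On the oval `√R = rad |sin θ| √G`, and the sign of `sin θ` absorbs the absolute value. What
remains has no singularity at the branch points, since the cofactor `G` is positive on the oval. -/
theorem param_eq (i : Fin (m + 1)) (θ : ℝ) :
    ovalParam R i θ = (ovalAbscissa R i θ, ovalOrient R i * (ovalRad R i * Real.sin θ *
      √((ovalCofactor m E i).eval (ovalAbscissa R i θ)))) := by
  rw [ovalParam, ← ovalAbscissa, h.eval_abscissa i, Real.sqrt_mul (sq_nonneg _), Real.sqrt_sq_eq_abs,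
    abs_mul, abs_of_pos (h.rad_pos i)]
  have hs : Real.sign (Real.sin θ) * |Real.sin θ| = Real.sin θ := by
    rcases lt_trichotomy (Real.sin θ) 0 with hs | hs | hs
    · rw [Real.sign_of_neg hs, abs_of_neg hs]; ring
    · simp [hs]
    · rw [Real.sign_of_pos hs, abs_of_pos hs]; ring
  ext
  · rfl
  · simp only
    linear_combination (ovalOrient R i * ovalRad R i *
      √((ovalCofactor m E i).eval (ovalAbscissa R i θ))) * hs

theorem prod_mul_prod_mid_pos {u : Fin (m + 1) → ℝ}
    (hu : ∀ i : Fin (m + 1), u i ∈ Set.Icc (ovalLeft R i) (ovalRight R i)) (i : Fin (m + 1)) :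
    0 < (∏ j ∈ Finset.univ.erase i, (ovalMid R i - ovalMid R j)) *
      ∏ j ∈ Finset.univ.erase i, (u i - u j) := by
  rw [← Finset.prod_mul_distrib]
  refine Finset.prod_pos fun j hj => ?_
  have hi := h.left_lt_right i
  have hj' := h.left_lt_right j
  simp only [ovalMid]
  rcases lt_or_gt_of_ne (Finset.ne_of_mem_erase hj) with hlt | hlt
  · have := h.right_lt_left hlt
    exact mul_pos (by linarith) (by linarith [(hu i).1, (hu j).2])
  · have := h.right_lt_left hlt
    exact mul_pos_of_neg_of_neg (by linarith) (by linarith [(hu i).2, (hu j).1])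

theorem orient_mul_prod_neg {u : Fin (m + 1) → ℝ}
    (hu : ∀ i : Fin (m + 1), u i ∈ Set.Icc (ovalLeft R i) (ovalRight R i)) (i : Fin (m + 1)) :
    ovalOrient R i * ∏ j ∈ Finset.univ.erase i, (u i - u j) < 0 := by
  have h1 := h.prod_mul_prod_mid_pos hu i
  rw [ovalOrient]
  rcases mul_pos_iff.1 h1 with ⟨ha, hb⟩ | ⟨ha, hb⟩
  · rw [Real.sign_of_pos ha]; linarith
  · rw [Real.sign_of_neg ha]; linarith

theorem orient_sq (i : Fin (m + 1)) : ovalOrient R i * ovalOrient R i = 1 := by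
  have h1 := h.prod_mul_prod_mid_pos (u := fun j : Fin (m + 1) => ovalLeft R j)
    (fun j => ⟨le_rfl, (h.left_lt_right j).le⟩) i
  rw [ovalOrient]
  rcases Real.sign_apply_eq_of_ne_zero _ (left_ne_zero_of_mul h1.ne') with h2 | h2 <;> rw [h2] <;>
    norm_num

theorem orient_ne_zero (i : Fin (m + 1)) : ovalOrient R i ≠ 0 :=
  left_ne_zero_of_mul (h.orient_sq i ▸ one_ne_zero)

theorem cofactor_abscissa_pos (i : Fin (m + 1)) (θ : ℝ) :
    0 < (ovalCofactor m E i).eval (ovalAbscissa R i θ) :=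
  h.cofactor_pos i (h.abscissa_mem i θ)

theorem param_mem (i : Fin (m + 1)) (θ : ℝ) : ovalParam R i θ ∈ oval R i := by
  rw [h.param_eq]
  refine ⟨h.abscissa_mem i θ, ?_⟩
  simp only
  rw [h.eval_abscissa, mul_pow, mul_pow, Real.sq_sqrt (h.cofactor_abscissa_pos i θ).le, sq,
    h.orient_sq, one_mul]

/-- The normalised coordinates of a point of an oval lie on the unit circle. -/
theorem circle_of_mem {i : Fin (m + 1)} {P : ℝ × ℝ} (hP : P ∈ oval R i) :
    ((ovalMid R i - P.1) / ovalRad R i) ^ 2 +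
      (ovalOrient R i * P.2 / (ovalRad R i * √((ovalCofactor m E i).eval P.1))) ^ 2 = 1 := by
  have hG := h.cofactor_pos i hP.1
  have hr := h.rad_pos i
  have hy := hP.2
  rw [h.eval_eq_cofactor i] at hy
  rw [div_pow, div_pow, mul_pow, mul_pow, Real.sq_sqrt hG.le, hy, sq (ovalOrient R i),
    h.orient_sq]
  field_simp
  ring

theorem param_of_cos_sin {i : Fin (m + 1)} {P : ℝ × ℝ} (hP : P ∈ oval R i) {θ : ℝ}
    (hc : Real.cos θ = (ovalMid R i - P.1) / ovalRad R i)
    (hs : Real.sin θ = ovalOrient R i * P.2 / (ovalRad R i * √((ovalCofactor m E i).eval P.1))) :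
    ovalParam R i θ = P := by
  have hr := (h.rad_pos i).ne'
  have hG := (Real.sqrt_pos.2 (h.cofactor_pos i hP.1)).ne'
  have ha : ovalAbscissa R i θ = P.1 := by
    rw [ovalAbscissa, hc]; field_simp; ring
  rw [h.param_eq, ha, hs]
  ext
  · rfl
  · simp only
    have := h.orient_sq i
    field_simp
    linear_combination P.2 * this

theorem exists_param {i : Fin (m + 1)} {P : ℝ × ℝ} (hP : P ∈ oval R i) :
    ∃ θ, ovalParam R i θ = P := by
  obtain ⟨θ, hc, hs⟩ := exists_cos_sin (h.circle_of_mem hP)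
  exact ⟨θ, h.param_of_cos_sin hP hc hs⟩

theorem param_eq_iff (i : Fin (m + 1)) (θ η : ℝ) :
    ovalParam R i θ = ovalParam R i η ↔ ∃ n : ℤ, θ = η + n * (2 * Real.pi) := by
  constructor
  · intro he
    rw [h.param_eq, h.param_eq, Prod.mk.injEq] at he
    obtain ⟨h1, h2⟩ := he
    rw [h1] at h2
    have hr := (h.rad_pos i).ne'
    have hG := (Real.sqrt_pos.2 (h.cofactor_abscissa_pos i η)).ne'
    refine eq_add_two_pi_of_cos_sin_eq ?_ ?_
    · simp only [ovalAbscissa] at h1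
      exact mul_left_cancel₀ hr (by linarith)
    · exact mul_left_cancel₀ hr (mul_right_cancel₀ hG (mul_left_cancel₀ (h.orient_ne_zero i) h2))
  · rintro ⟨n, rfl⟩
    rw [ovalParam, ovalParam, Real.cos_add_int_mul_two_pi, Real.sin_add_int_mul_two_pi]

theorem continuous_param (i : Fin (m + 1)) : Continuous (ovalParam R i) := by
  rw [show ovalParam R i = _ from funext (h.param_eq i)]
  have h1 : Continuous (ovalAbscissa R i) := by unfold ovalAbscissa; fun_prop
  have h2 : Continuous fun θ => (ovalCofactor m E i).eval (ovalAbscissa R i θ) :=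
    (ovalCofactor m E i).continuous.comp h1
  fun_prop

theorem oval_disjoint {i j : Fin (m + 1)} (hij : i ≠ j) {P : ℝ × ℝ} (hi : P ∈ oval R i) :
    P ∉ oval R j := by
  intro hj
  rcases lt_or_gt_of_ne hij with hlt | hlt
  · have := h.right_lt_left hlt
    linarith [hi.1.2, hj.1.1]
  · have := h.right_lt_left hlt
    linarith [hj.1.2, hi.1.1]

/-! ### Abelian integrals along the ovals -/

omit h in
/-- The density `1 / √G(u)` of the form `du / y` in the parameter of the oval, up to the sign
of the orientation. -/
def _root_.GeodesicScattering.abelDensity (m : ℕ) (R : ℝ[X]) (E : ℕ → ℝ) (i : ℕ) (θ : ℝ) : ℝ :=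
  1 / √((ovalCofactor m E i).eval (ovalAbscissa R i θ))

theorem density_pos (i : Fin (m + 1)) (θ : ℝ) : 0 < abelDensity m R E i θ :=
  one_div_pos.2 (Real.sqrt_pos.2 (h.cofactor_abscissa_pos i θ))

omit h in
theorem _root_.GeodesicScattering.continuous_abscissa (R : ℝ[X]) (i : ℕ) :
    Continuous (ovalAbscissa R i) := by
  unfold ovalAbscissa; fun_prop

theorem continuous_density (i : Fin (m + 1)) : Continuous (abelDensity m R E i) := by
  unfold abelDensity
  refine continuous_const.div
    (((ovalCofactor m E i).continuous.comp (continuous_abscissa R i)).sqrt) fun θ => ?_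
  exact (Real.sqrt_pos.2 (h.cofactor_abscissa_pos i θ)).ne'

theorem continuous_integrand (i : Fin (m + 1)) (j : ℕ) :
    Continuous fun t => ovalOrient R i * (ovalAbscissa R i t ^ j * abelDensity m R E i t) :=
  continuous_const.mul (((continuous_abscissa R i).pow j).mul (h.continuous_density i))

/-- The factor `rad * sin t` of `du` cancels against `y`. At the multiples of `π` the original
integrand is `0 / 0`, hence `0` by convention, but these points form a null set. -/
theorem integral_eq (i : Fin (m + 1)) (j : ℕ) (θ : ℝ) :
    ovalIntegral R i j θ =
      ∫ t in (0 : ℝ)..θ, ovalOrient R i * (ovalAbscissa R i t ^ j * abelDensity m R E i t) := by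
  refine intervalIntegral.integral_congr_ae ?_
  have hc : {t | Real.sin t = 0}.Countable := by
    refine (Set.countable_range fun n : ℤ => (n : ℝ) * Real.pi).mono fun t ht => ?_
    exact Real.sin_eq_zero_iff.1 ht
  filter_upwards [hc.ae_notMem MeasureTheory.volume] with t ht _
  have hs : Real.sin t ≠ 0 := ht
  have hr := (h.rad_pos i).ne'
  have hG := (Real.sqrt_pos.2 (h.cofactor_abscissa_pos i t)).ne'
  have ho := h.orient_ne_zero i
  have ho2 := h.orient_sq i
  rw [h.param_eq, abelDensity]
  simp only
  field_simp
  linear_combination (-1) * (ovalAbscissa R i t) ^ j * ho2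

theorem hasStrictDerivAt_integral (i : Fin (m + 1)) (j : ℕ) (θ : ℝ) :
    HasStrictDerivAt (ovalIntegral R i j)
      (ovalOrient R i * (ovalAbscissa R i θ ^ j * abelDensity m R E i θ)) θ := by
  rw [show ovalIntegral R i j = _ from funext (h.integral_eq i j)]
  have hc := h.continuous_integrand i j
  exact intervalIntegral.integral_hasStrictDerivAt_right (hc.intervalIntegrable _ _)
    (hc.stronglyMeasurableAtFilter _ _) hc.continuousAt

theorem integral_add_int_mul (i : Fin (m + 1)) (j : Fin m) (θ : ℝ) (n : ℤ) :
    ovalIntegral R i j (θ + n * (2 * Real.pi)) = ovalIntegral R i j θ + n * ovalPeriod R i j := by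
  have hc := h.continuous_integrand i j
  have hp : Function.Periodic
      (fun t => ovalOrient R i * (ovalAbscissa R i t ^ (j : ℕ) * abelDensity m R E i t))
      (2 * Real.pi) := by
    intro t
    simp only [abelDensity, ovalAbscissa, Real.cos_add_two_pi]
  have hi : ∀ t₁ t₂, IntervalIntegrable
      (fun t => ovalOrient R i * (ovalAbscissa R i t ^ (j : ℕ) * abelDensity m R E i t))
      MeasureTheory.volume t₁ t₂ := fun _ _ => hc.intervalIntegrable _ _
  have h1 := hp.intervalIntegral_add_zsmul_eq n θ hi
  rw [hp.intervalIntegral_add_eq θ 0, zero_add] at h1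
  rw [ovalPeriod, h.integral_eq, h.integral_eq, h.integral_eq,
    ← intervalIntegral.integral_add_adjacent_intervals (hi 0 θ) (hi _ _)]
  rw [zsmul_eq_mul, zsmul_eq_mul] at h1
  rw [h1]

/-- Pairing with the coefficients of `Q` replaces the vector of the basic forms by the single form
`Q(u) du / y`. -/
theorem sum_coeff_mul_integral_sub (i : Fin (m + 1)) {Q : ℝ[X]} (hQ : Q.natDegree < m) (θ η : ℝ) :
    ∑ j : Fin m, Q.coeff j * (ovalIntegral R i j θ - ovalIntegral R i j η) =
      ovalOrient R i * ∫ t in η..θ, Q.eval (ovalAbscissa R i t) * abelDensity m R E i t := by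
  have hi : ∀ (j : ℕ) t₁ t₂, IntervalIntegrable
      (fun t => ovalOrient R i * (ovalAbscissa R i t ^ (j : ℕ) * abelDensity m R E i t))
      MeasureTheory.volume t₁ t₂ := fun j _ _ => (h.continuous_integrand i j).intervalIntegrable _ _
  have h1 : ∀ j : Fin m, Q.coeff j * (ovalIntegral R i j θ - ovalIntegral R i j η) =
      ∫ t in η..θ, Q.coeff j *
        (ovalOrient R i * (ovalAbscissa R i t ^ (j : ℕ) * abelDensity m R E i t)) := by
    intro j
    rw [intervalIntegral.integral_const_mul, h.integral_eq, h.integral_eq,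
      intervalIntegral.integral_interval_sub_left (hi _ _ _) (hi _ _ _)]
  rw [Finset.sum_congr rfl fun j _ => h1 j, ← intervalIntegral.integral_finsetSum
    (fun j _ => (hi _ _ _).const_mul _), ← intervalIntegral.integral_const_mul]
  refine intervalIntegral.integral_congr fun t _ => ?_
  rw [eval_eq_sum_range' hQ, Finset.sum_range, Finset.sum_mul, Finset.mul_sum]
  exact Finset.sum_congr rfl fun j _ => by ring

end BranchData

/-! ### The real partial Abel map -/

/-- A polynomial of degree at most `n` with prescribed signs on `n + 1` successive intervals. -/
theorem exists_poly_with_signs (n : ℕ) {A B σ : ℕ → ℝ} (hAB : ∀ i < n, B i < A (i + 1))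
    (hA : ∀ i ≤ n, A i ≤ B i) (hσ : ∀ i, σ i = 1 ∨ σ i = -1) :
    ∃ Q : ℝ[X], Q.natDegree ≤ n ∧ (∀ i ≤ n, ∀ u ∈ Set.Icc (A i) (B i), 0 < σ i * Q.eval u) ∧
      ∀ u, A n ≤ u → 0 < σ n * Q.eval u := by
  induction n with
  | zero =>
    have hs : σ 0 * σ 0 = 1 := by rcases hσ 0 with h | h <;> rw [h] <;> norm_num
    refine ⟨C (σ 0), by simp, fun i hi u _ => ?_, fun u _ => ?_⟩
    · rw [Nat.le_zero.1 hi, eval_C, hs]; exact one_pos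
    · rw [eval_C, hs]; exact one_pos
  | succ n ih =>
    obtain ⟨Q, hQ, h1, h2⟩ := ih (fun i hi => hAB i (hi.trans n.lt_succ_self))
      (fun i hi => hA i (hi.trans n.le_succ))
    have hAn : A n ≤ A (n + 1) := (hA n n.le_succ).trans (hAB n n.lt_succ_self).le
    -- The sign on the whole half-line beyond `A n` is carried through the induction: without a sign
    -- change the same `Q` serves the next interval. With a change, a factor `t - X` with `t` in the
    -- gap flips the sign on the right and keeps it on the left.
    by_cases hs : σ (n + 1) = σ n
    · refine ⟨Q, hQ.trans n.le_succ, fun i hi u hu => ?_, fun u hu => ?_⟩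
      · rcases hi.eq_or_lt with rfl | hi
        · rw [hs]; exact h2 u (hAn.trans hu.1)
        · exact h1 i (Nat.lt_succ_iff.1 hi) u hu
      · rw [hs]; exact h2 u (hAn.trans hu)
    · have hs' : σ (n + 1) = -σ n := by
        rcases hσ n with h | h <;> rcases hσ (n + 1) with h' | h' <;> rw [h, h'] at hs <;>
          simp_all
      obtain ⟨t, ht1, ht2⟩ := exists_between (hAB n n.lt_succ_self)
      have hmono : ∀ i ≤ n, B i ≤ B n := by
        intro i hi
        rcases hi.eq_or_lt with rfl | hi
        · exact le_rfl
        · have : ∀ k, i + k + 1 ≤ n → B i ≤ A (i + k + 1) := by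
            intro k
            induction k with
            | zero => intro hk; exact (hAB i (by omega)).le
            | succ k ihk =>
              intro hk
              exact (ihk (by omega)).trans ((hA _ (by omega)).trans (hAB (i + k + 1) (by omega)).le)
          have := this (n - i - 1) (by omega)
          rw [show i + (n - i - 1) + 1 = n by omega] at this
          exact this.trans (hA n n.le_succ)
      have hlast : ∀ u, A (n + 1) ≤ u → 0 < σ (n + 1) * (Q * (C t - X)).eval u := by
        intro u hu
        have := h2 u (hAn.trans hu)
        rw [hs', eval_mul, eval_sub, eval_C, eval_X]
        have ht : 0 < u - t := by linarith
        nlinarith [mul_pos this ht]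
      refine ⟨Q * (C t - X), ?_, fun i hi u hu => ?_, hlast⟩
      · refine natDegree_mul_le.trans (add_le_add hQ ?_)
        exact (natDegree_sub_le _ _).trans (by simp)
      · rcases hi.eq_or_lt with rfl | hi
        · exact hlast u hu.1
        · have hi' := Nat.lt_succ_iff.1 hi
          have := h1 i hi' u hu
          rw [eval_mul, eval_sub, eval_C, eval_X]
          have ht : 0 < t - u := by linarith [hu.2, hmono i hi']
          nlinarith [mul_pos this ht]

/-- Reduction of an angle to `[0, 2 π)`. -/
theorem exists_mem_Ico_two_pi (θ : ℝ) :
    ∃ n : ℤ, ∃ φ ∈ Set.Ico (0 : ℝ) (2 * Real.pi), θ = φ + n * (2 * Real.pi) := by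
  have hp := Real.two_pi_pos
  refine ⟨⌊θ / (2 * Real.pi)⌋, θ - ⌊θ / (2 * Real.pi)⌋ * (2 * Real.pi), ⟨?_, ?_⟩, by ring⟩
  · have := Int.floor_le (θ / (2 * Real.pi))
    rw [le_div_iff₀ hp] at this
    linarith
  · have := Int.lt_floor_add_one (θ / (2 * Real.pi))
    rw [div_lt_iff₀ hp] at this
    linarith

theorem mem_periodLattice_iff {R : ℝ[X]} {m : ℕ} {k : Fin (m + 1)} {v : Fin m → ℝ} :
    v ∈ periodLattice R k ↔ ∃ N : Fin m → ℤ, ∑ i, N i • ovalPeriod R (k.succAbove i) = v := by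
  rw [periodLattice, ← Submodule.span_int_eq_addSubgroupClosure]
  exact Submodule.mem_span_range_iff_exists_fun ℤ

namespace BranchData

variable {m : ℕ} {R : ℝ[X]} {E : ℕ → ℝ} (h : BranchData m R E) (k : Fin (m + 1))
include h

/-- A vector of weights vanishes if the corresponding moments do. -/
theorem eq_zero_of_moments (v : Fin m → Fin m → ℝ) (t : Fin m → ℝ)
    (h0 : ∀ i, t i = 0 → ∀ j, v i j = 0)
    (hpos : ∀ i, t i ≠ 0 → ∀ Q : ℝ[X], Q.natDegree < m →
      (∀ θ, 0 < Q.eval (ovalAbscissa R (k.succAbove i) θ)) → 0 < t i * ∑ j : Fin m, Q.coeff j * v i j)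
    (hsum : ∀ j, ∑ i, v i j = 0) : t = 0 := by
  obtain _ | n := m
  · exact Subsingleton.elim _ _
  have hk := Fin.strictMono_succAbove k
  let A : ℕ → ℝ := fun i => if hi : i < n + 1 then ovalLeft R (k.succAbove ⟨i, hi⟩) else 0
  let B : ℕ → ℝ := fun i => if hi : i < n + 1 then ovalRight R (k.succAbove ⟨i, hi⟩) else 0
  let σ : ℕ → ℝ := fun i => if hi : i < n + 1 then (if 0 ≤ t ⟨i, hi⟩ then 1 else -1) else 1
  -- `Q` takes the sign of `t i` on the `i`-th oval. Its pairing with each nonzero weight vector is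
  -- then positive, while the pairings add up to zero. With `m = n + 1` ovals the degree `n` is
  -- admissible.
  obtain ⟨Q, hQ, hs, -⟩ := exists_poly_with_signs n (A := A) (B := B) (σ := σ)
    (fun i hi => by
      simp only [A, B, dif_pos (show i < n + 1 by omega), dif_pos (show i + 1 < n + 1 by omega)]
      exact h.right_lt_left (hk (by rw [Fin.lt_def]; simp)))
    (fun i hi => by
      simp only [A, B, dif_pos (show i < n + 1 by omega)]
      exact (h.left_lt_right _).le)
    (fun i => by simp only [σ]; split_ifs <;> simp)
  have hsum' : ∑ i, ∑ j : Fin (n + 1), Q.coeff j * v i j = 0 := by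
    rw [Finset.sum_comm]
    exact Finset.sum_eq_zero fun j _ => by rw [← Finset.mul_sum, hsum, mul_zero]
  have hQs : ∀ i θ, 0 < (if 0 ≤ t i then (1 : ℝ) else -1) *
      Q.eval (ovalAbscissa R (k.succAbove i) θ) := by
    intro i θ
    have := hs i (Nat.lt_succ_iff.1 i.2) (ovalAbscissa R (k.succAbove i) θ)
    simp only [A, B, σ, dif_pos i.2] at this
    exact this (h.abscissa_mem _ θ)
  have hterm : ∀ i, t i ≠ 0 → 0 < ∑ j : Fin (n + 1), Q.coeff j * v i j := by
    intro i hi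
    have hq := hQs i
    rcases lt_or_gt_of_ne hi with hlt | hlt
    · simp only [if_neg (not_le.2 hlt)] at hq
      have := hpos i hi (-Q) (by rw [natDegree_neg]; omega)
        (fun θ => by rw [eval_neg]; linarith [hq θ])
      simp only [coeff_neg, neg_mul, Finset.sum_neg_distrib] at this
      rw [mul_neg, ← neg_mul] at this
      exact pos_of_mul_pos_right this (by linarith)
    · simp only [if_pos hlt.le] at hq
      have := hpos i hi Q (by omega) (fun θ => by linarith [hq θ])
      exact pos_of_mul_pos_right this hlt.le
  have hnn : ∀ i ∈ Finset.univ, 0 ≤ ∑ j : Fin (n + 1), Q.coeff j * v i j := by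
    intro i _
    by_cases hi : t i = 0
    · simp [h0 i hi]
    · exact (hterm i hi).le
  funext i
  by_contra hi
  exact (hterm i hi).ne' ((Finset.sum_eq_zero_iff_of_nonneg hnn).1 hsum' i (Finset.mem_univ i))

theorem moment_pos (i : Fin (m + 1)) {Q : ℝ[X]} (hQ : Q.natDegree < m)
    (hpos : ∀ θ, 0 < Q.eval (ovalAbscissa R i θ)) {θ η : ℝ} (hne : θ ≠ η) :
    0 < ovalOrient R i * (θ - η) *
      ∑ j : Fin m, Q.coeff j * (ovalIntegral R i j θ - ovalIntegral R i j η) := by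
  rw [h.sum_coeff_mul_integral_sub i hQ]
  have hc : Continuous fun t => Q.eval (ovalAbscissa R i t) * abelDensity m R E i t :=
    (Q.continuous.comp (continuous_abscissa R i)).mul (h.continuous_density i)
  have hp : ∀ t, 0 < Q.eval (ovalAbscissa R i t) * abelDensity m R E i t :=
    fun t => mul_pos (hpos t) (h.density_pos i t)
  have key : 0 < (θ - η) * ∫ t in η..θ, Q.eval (ovalAbscissa R i t) * abelDensity m R E i t := by
    rcases lt_or_gt_of_ne hne with hlt | hlt
    · rw [intervalIntegral.integral_symm]
      have := intervalIntegral.intervalIntegral_pos_of_pos (hc.intervalIntegrable θ η) hp hlt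
      nlinarith
    · exact mul_pos (by linarith)
        (intervalIntegral.intervalIntegral_pos_of_pos (hc.intervalIntegrable η θ) hp hlt)
  linear_combination key + (-1) * ((θ - η) *
    ∫ t in η..θ, Q.eval (ovalAbscissa R i t) * abelDensity m R E i t) * (h.orient_sq i)

/-- The moment argument is applied to the increments between two arbitrary points, so the
injectivity is global; the sign `t i` is that of `θ i - η i`, corrected by the orientation. -/
theorem liftedAbel_injective : Function.Injective (liftedAbel R k) := by
  intro θ η he
  have := h.eq_zero_of_moments k
    (fun i j => ovalIntegral R (k.succAbove i) j (θ i) - ovalIntegral R (k.succAbove i) j (η i))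
    (fun i => ovalOrient R (k.succAbove i) * (θ i - η i))
    (fun i hi j => by
      have : θ i = η i :=
        sub_eq_zero.1 ((mul_eq_zero.1 hi).resolve_left (h.orient_ne_zero _))
      rw [this, sub_self])
    (fun i hi Q hQ hp => h.moment_pos _ hQ hp (sub_ne_zero.1 (right_ne_zero_of_mul hi)))
    (fun j => by
      have := congrFun he j
      simp only [liftedAbel] at this
      rw [Finset.sum_sub_distrib, this, sub_self])
  funext i
  exact sub_eq_zero.1 ((mul_eq_zero.1 (congrFun this i)).resolve_left (h.orient_ne_zero _))

theorem linearIndependent_period :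
    LinearIndependent ℝ (fun i : Fin m => ovalPeriod R (k.succAbove i)) := by
  rw [Fintype.linearIndependent_iff]
  intro g hg i
  have hint0 : ∀ (i : Fin (m + 1)) j, ovalIntegral R i j 0 = 0 := by
    intro i j; simp [ovalIntegral]
  have := h.eq_zero_of_moments k (fun i j => g i * ovalPeriod R (k.succAbove i) j)
    (fun i => ovalOrient R (k.succAbove i) * g i)
    (fun i hi j => by
      rw [(mul_eq_zero.1 hi).resolve_left (h.orient_ne_zero _), zero_mul])
    (fun i hi Q hQ hp => by
      have h1 := h.moment_pos (k.succAbove i) hQ hp (θ := 2 * Real.pi) (η := 0)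
        Real.two_pi_pos.ne'
      simp only [hint0, sub_zero] at h1
      have hg0 : g i ≠ 0 := right_ne_zero_of_mul hi
      have h2 : ∑ j : Fin m, Q.coeff j * (g i * ovalPeriod R (k.succAbove i) j) =
          g i * ∑ j : Fin m, Q.coeff j * ovalIntegral R (k.succAbove i) j (2 * Real.pi) := by
        rw [Finset.mul_sum]
        exact Finset.sum_congr rfl fun j _ => by rw [ovalPeriod]; ring
      rw [h2]
      have h3 := mul_pos (mul_self_pos.2 hg0) h1
      have h4 : 0 < (2 * Real.pi) * (ovalOrient R (k.succAbove i) * g i * (g i *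
          ∑ j : Fin m, Q.coeff j * ovalIntegral R (k.succAbove i) j (2 * Real.pi))) := by
        linarith
      exact pos_of_mul_pos_right h4 Real.two_pi_pos.le)
    (fun j => by simpa using congrFun hg j)
  exact (mul_eq_zero.1 (congrFun this i)).resolve_left (h.orient_ne_zero _)

theorem liftedAbel_add (θ : Fin m → ℝ) (N : Fin m → ℤ) :
    liftedAbel R k (fun i => θ i + N i * (2 * Real.pi)) =
      liftedAbel R k θ + ∑ i, N i • ovalPeriod R (k.succAbove i) := by
  funext j
  simp only [liftedAbel, h.integral_add_int_mul, Finset.sum_add_distrib, Pi.add_apply,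
    Finset.sum_apply, Pi.smul_apply]
  simp only [zsmul_eq_mul]

/-- The derivative of the lifted Abel map. -/
theorem hasStrictFDerivAt_liftedAbel (θ : Fin m → ℝ) :
    HasStrictFDerivAt (liftedAbel R k)
      (ContinuousLinearMap.pi fun j : Fin m => ∑ i, (ovalOrient R (k.succAbove i) *
        (ovalAbscissa R (k.succAbove i) (θ i) ^ (j : ℕ) *
          abelDensity m R E (k.succAbove i) (θ i))) •
            (ContinuousLinearMap.proj i : (Fin m → ℝ) →L[ℝ] ℝ)) θ := by
  refine hasStrictFDerivAt_pi.2 fun j => ?_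
  refine HasStrictFDerivAt.fun_sum fun i _ => ?_
  exact HasStrictDerivAt.comp_hasStrictFDerivAt (f := fun f : Fin m → ℝ => f i) θ
    (h.hasStrictDerivAt_integral (k.succAbove i) j (θ i)) (hasStrictFDerivAt_apply i θ)

/-- The derivative has the columns `u i ^ j` times nonzero factors. The moment argument with point
masses shows that it is injective, hence onto. -/
theorem liftedAbel_isOpenMap : IsOpenMap (liftedAbel R k) := by
  refine IsOpenMap.of_nhds_le fun θ => ?_
  refine ((h.hasStrictFDerivAt_liftedAbel k θ).map_nhds_eq_of_surj ?_).ge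
  refine LinearMap.range_eq_top.2 (LinearMap.injective_iff_surjective.1 ?_)
  refine (injective_iff_map_eq_zero _).2 fun w hw => ?_
  have := h.eq_zero_of_moments k
    (fun i j => ovalOrient R (k.succAbove i) *
        (ovalAbscissa R (k.succAbove i) (θ i) ^ (j : ℕ) *
          abelDensity m R E (k.succAbove i) (θ i)) * w i)
    (fun i => ovalOrient R (k.succAbove i) * w i)
    (fun i hi j => by
      rw [(mul_eq_zero.1 hi).resolve_left (h.orient_ne_zero _), mul_zero])
    (fun i hi Q hQ hp => by
      have e : ∑ j : Fin m, Q.coeff j * (ovalOrient R (k.succAbove i) *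
          (ovalAbscissa R (k.succAbove i) (θ i) ^ (j : ℕ) *
          abelDensity m R E (k.succAbove i) (θ i)) * w i) =
          ovalOrient R (k.succAbove i) * w i * (Q.eval (ovalAbscissa R (k.succAbove i) (θ i)) *
            abelDensity m R E (k.succAbove i) (θ i)) := by
        rw [eval_eq_sum_range' hQ, Finset.sum_range, Finset.sum_mul, Finset.mul_sum]
        exact Finset.sum_congr rfl fun j _ => by ring
      rw [e, ← mul_assoc]
      exact mul_pos (mul_self_pos.2 hi) (mul_pos (hp _) (h.density_pos _ _)))
    (fun j => by simpa using congrFun hw j)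
  funext i
  exact (mul_eq_zero.1 (congrFun this i)).resolve_left (h.orient_ne_zero _)

theorem continuous_liftedAbel : Continuous (liftedAbel R k) :=
  continuous_iff_continuousAt.2 fun θ => (h.hasStrictFDerivAt_liftedAbel k θ).continuousAt

theorem isClosed_periodLattice : IsClosed (periodLattice R k : Set (Fin m → ℝ)) := by
  have hli := h.linearIndependent_period k
  let B := Module.Basis.mk hli (hli.span_eq_top_of_card_eq_finrank' (by simp)).ge
  have e : periodLattice R k = (Submodule.span ℤ (Set.range B)).toAddSubgroup := by
    rw [periodLattice, ← Submodule.span_int_eq_addSubgroupClosure, Module.Basis.coe_mk]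
  rw [e]
  exact AddSubgroup.isClosed_of_discrete

-- By quasi-periodicity the range is the lattice plus the image of a compact box, hence closed. It
-- is also open and nonempty, so it is the whole connected space.
open scoped Pointwise in
theorem liftedAbel_surjective : Function.Surjective (liftedAbel R k) := by
  have hr : Set.range (liftedAbel R k) = (periodLattice R k : Set (Fin m → ℝ)) +
      liftedAbel R k '' (Set.univ.pi fun _ => Set.Icc 0 (2 * Real.pi)) := by
    ext v
    rw [Set.mem_add]
    constructor
    · rintro ⟨θ, rfl⟩
      choose N φ hφ hθ using fun i => exists_mem_Ico_two_pi (θ i)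
      refine ⟨_, mem_periodLattice_iff.2 ⟨N, rfl⟩, _,
        ⟨φ, fun i _ => ⟨(hφ i).1, (hφ i).2.le⟩, rfl⟩, ?_⟩
      rw [add_comm, ← h.liftedAbel_add k, ← funext hθ]
    · rintro ⟨l, hl, _, ⟨φ, -, rfl⟩, rfl⟩
      obtain ⟨N, rfl⟩ := mem_periodLattice_iff.1 hl
      exact ⟨_, (h.liftedAbel_add k φ N).trans (add_comm _ _)⟩
  have hclosed : IsClosed (Set.range (liftedAbel R k)) := by
    rw [hr]
    exact (h.isClosed_periodLattice k).add_right_of_isCompact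
      ((isCompact_univ_pi fun _ => isCompact_Icc).image (h.continuous_liftedAbel k))
  exact Set.range_eq_univ.1
    (IsClopen.eq_univ ⟨hclosed, (h.liftedAbel_isOpenMap k).isOpen_range⟩ (Set.range_nonempty _))

/-- The Abel map can be computed with any lift of the divisor. -/
theorem abelMap_eq {D : (i : Fin m) → oval R (k.succAbove i)} {θ : Fin m → ℝ}
    (hθ : ∀ i, ovalParam R (k.succAbove i) (θ i) = D i) :
    abelMap R k D = QuotientAddGroup.mk (liftedAbel R k θ) := by
  have h1 : ∀ i, ovalParam R (k.succAbove i)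
      (Function.invFun (ovalParam R (k.succAbove i)) (D i : ℝ × ℝ)) = D i :=
    fun i => Function.invFun_eq ⟨θ i, hθ i⟩
  choose N hN using fun i => (h.param_eq_iff (k.succAbove i) _ _).1 ((h1 i).trans (hθ i).symm)
  rw [abelMap, funext hN, h.liftedAbel_add, QuotientAddGroup.eq, neg_add_rev,
    add_assoc, neg_add_cancel, add_zero]
  exact neg_mem (mem_periodLattice_iff.2 ⟨N, rfl⟩)

theorem abelMap_bijective : Function.Bijective (abelMap R k) := by
  constructor
  · intro D D' he
    choose θ hθ using fun i => h.exists_param (D i).2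
    choose θ' hθ' using fun i => h.exists_param (D' i).2
    rw [h.abelMap_eq k hθ, h.abelMap_eq k hθ', QuotientAddGroup.eq] at he
    obtain ⟨N, hN⟩ := mem_periodLattice_iff.1 he
    have h1 : liftedAbel R k θ' = liftedAbel R k (fun i => θ i + N i * (2 * Real.pi)) := by
      rw [h.liftedAbel_add, hN]; abel
    have h2 := h.liftedAbel_injective k h1
    funext i
    apply Subtype.ext
    rw [← hθ, ← hθ', h.param_eq_iff]
    exact ⟨-N i, by rw [h2]; push_cast; ring⟩
  · intro v
    induction v using QuotientAddGroup.induction_on with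
    | H v =>
      obtain ⟨θ, rfl⟩ := h.liftedAbel_surjective k v
      exact ⟨fun i => ⟨ovalParam R (k.succAbove i) (θ i), h.param_mem _ _⟩,
        h.abelMap_eq k fun i => rfl⟩

/-- The integer parts of the turns are characterised by the cells of the period lattice. -/
theorem floor_turns_iff {θm θp : Fin m → ℝ} {Δ : Fin m → ℝ}
    (hΔ : liftedAbel R k θp = liftedAbel R k θm - Δ) (N : Fin m → ℤ) :
    (∀ i, N i = ⌊(θp i - θm i) / (2 * Real.pi)⌋) ↔
      ∃ φ : Fin m → ℝ, (∀ i, φ i ∈ Set.Ico 0 (2 * Real.pi)) ∧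
        -Δ = liftedAbel R k (fun i => θm i + φ i) - liftedAbel R k θm +
          ∑ i, N i • ovalPeriod R (k.succAbove i) := by
  have hp := Real.two_pi_pos
  -- Quasi-periodicity and injectivity of the lifted map turn the condition on the cell into an
  -- equation between angles.
  have key : ∀ φ : Fin m → ℝ, (-Δ = liftedAbel R k (fun i => θm i + φ i) - liftedAbel R k θm +
      ∑ i, N i • ovalPeriod R (k.succAbove i)) ↔
      ∀ i, θp i = θm i + φ i + N i * (2 * Real.pi) := by
    intro φ
    have h1 := h.liftedAbel_add k (fun i => θm i + φ i) N
    rw [← show liftedAbel R k θp = liftedAbel R k (fun i => θm i + φ i + N i * (2 * Real.pi)) ↔ _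
      from (h.liftedAbel_injective k).eq_iff.trans funext_iff, h1, hΔ]
    constructor
    · intro he
      rw [sub_eq_add_neg, he]; abel
    · intro he
      rw [sub_eq_add_neg] at he
      rw [← add_right_inj (liftedAbel R k θm), he]; abel
  simp only [key]
  constructor
  · intro hN
    choose N' φ hφ he using fun i => exists_mem_Ico_two_pi (θp i - θm i)
    refine ⟨φ, hφ, fun i => ?_⟩
    have : N i = N' i := by
      rw [hN, Int.floor_eq_iff, le_div_iff₀ hp, div_lt_iff₀ hp, he]
      constructor <;> nlinarith [(hφ i).1, (hφ i).2]
    rw [this]; linarith [he i]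
  · rintro ⟨φ, hφ, he⟩ i
    rw [eq_comm, Int.floor_eq_iff, le_div_iff₀ hp, div_lt_iff₀ hp, he]
    constructor <;> nlinarith [(hφ i).1, (hφ i).2]

end BranchData

/-! ### The Neumann system -/

/-- A solution of the Neumann system on the unit sphere, with respect to a time `τ`,
`dτ/ds = T(s)`. -/
structure NeumannMotion {m : ℕ} (b : Fin (m + 2) → ℝ) (p q : ℝ → Fin (m + 2) → ℝ)
    (T ν : ℝ → ℝ) : Prop where
  inj : Function.Injective b
  hasDerivAt_q : ∀ s k, HasDerivAt (fun s => q s k) (T s * p s k) s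
  hasDerivAt_p : ∀ s k, HasDerivAt (fun s => p s k) (T s * (-(b k * q s k) + ν s * q s k)) s
  norm : ∀ s, ∑ k, q s k ^ 2 = 1
  orth : ∀ s, ∑ k, p s k * q s k = 0
  T_pos : ∀ s, 0 < T s

/-- The numbers `ε / a k` are not increasing in `k`, so the interlacing arguments are applied after
sorting, which must not change the polynomials. -/
theorem fracNumerator_comp_equiv {m : ℕ} (b w : Fin (m + 2) → ℝ) (σ : Equiv.Perm (Fin (m + 2))) :
    fracNumerator (b ∘ σ) (w ∘ σ) = fracNumerator b w := by
  refine Eq.trans (Finset.sum_congr rfl fun k _ => ?_)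
    (Equiv.sum_comp σ fun k => C (w k) * ∏ j ∈ Finset.univ.erase k, (X - C (b j)))
  refine congrArg (C (w (σ k)) * ·) ?_
  have e : ∀ i, i ∈ Finset.univ.erase k ↔ σ i ∈ Finset.univ.erase (σ k) := by
    simp [σ.injective.eq_iff]
  exact Finset.prod_equiv σ e (fun _ _ => rfl)

theorem polyB_comp_equiv {m : ℕ} (b : Fin (m + 2) → ℝ) (σ : Equiv.Perm (Fin (m + 2))) :
    polyB (b ∘ σ) = polyB b :=
  Equiv.prod_comp σ fun k => X - C (b k)

theorem hasDerivAt_eval_fracNumerator {m : ℕ} {b : Fin (m + 2) → ℝ} {w : ℝ → Fin (m + 2) → ℝ}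
    {w' : Fin (m + 2) → ℝ} {s : ℝ} (hw : ∀ k, HasDerivAt (fun s => w s k) (w' k) s)
    {u : ℝ → ℝ} {u' : ℝ} (hu : HasDerivAt u u' s) :
    HasDerivAt (fun s => (fracNumerator b (w s)).eval (u s))
      ((fracNumerator b w').eval (u s) + (derivative (fracNumerator b (w s))).eval (u s) * u') s := by
  have h1 : ∀ k ∈ Finset.univ, HasDerivAt
      (fun s => w s k * (∏ j ∈ Finset.univ.erase k, (X - C (b j))).eval (u s)) _ s :=
    fun k _ => (hw k).mul (((∏ j ∈ Finset.univ.erase k, (X - C (b j))).hasDerivAt (u s)).comp s hu)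
  have e : (fun s => (fracNumerator b (w s)).eval (u s)) = fun s =>
      ∑ k, w s k * (∏ j ∈ Finset.univ.erase k, (X - C (b j))).eval (u s) := by
    funext s
    simp [fracNumerator, eval_finsetSum]
  rw [e]
  refine (HasDerivAt.fun_sum h1).congr_deriv ?_
  rw [Finset.sum_add_distrib, fracNumerator, fracNumerator, derivative_sum, eval_finsetSum,
    eval_finsetSum, Finset.sum_mul]
  congr 1
  · exact Finset.sum_congr rfl fun k _ => by simp
  · refine Finset.sum_congr rfl fun k _ => ?_
    rw [derivative_C_mul, eval_mul, eval_C]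
    ring

/-- At a zero of `f` the slope of `f / g` is the slope of `f` divided by `g`, so `g` need only be
continuous. Below, `g` is made of elliptic coordinates not yet known to be differentiable. -/
theorem hasDerivAt_div_of_eq_zero {f g : ℝ → ℝ} {f' s : ℝ} (hf : HasDerivAt f f' s) (h0 : f s = 0)
    (hg : ContinuousAt g s) (hgs : g s ≠ 0) : HasDerivAt (fun t => f t / g t) (f' / g s) s := by
  rw [hasDerivAt_iff_tendsto_slope] at hf ⊢
  have h1 := hf.div (hg.tendsto.mono_left nhdsWithin_le_nhds) hgs
  refine h1.congr fun t => ?_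
  simp only [slope_def_field, h0, Pi.div_apply]
  ring

/-- The residue at `b l` vanishes exactly when the numerator of `Ψ_u` shares the root `b l` with
`polyB`; then `b l` is a double root. -/
theorem integralF_ne_zero_of_squarefree {m : ℕ} {b p q : Fin (m + 2) → ℝ}
    (hsq : Squarefree (spectralPoly b p q)) (l : Fin (m + 2)) : integralF b p q l ≠ 0 := by
  intro h0
  have hF : (fracNumerator b (integralF b p q)).eval (b l) = 0 := by
    rw [eval_fracNumerator_self, h0, zero_mul]
  have hB : (polyB b).eval (b l) = 0 := by
    rw [eval_polyB]; exact Finset.prod_eq_zero (Finset.mem_univ l) (sub_self _)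
  refine derivative_eval_ne_zero_of_squarefree hsq (u := b l) ?_ ?_
  · rw [spectralPoly, eval_mul, hB, mul_zero]
  · rw [spectralPoly, derivative_mul, eval_add, eval_mul, eval_mul, eval_mul, hB, hF]
    simp

/-! ### Integrals of the Neumann system and reality of the branch points. -/

namespace NeumannMotion

variable {m : ℕ} {b : Fin (m + 2) → ℝ} {p q : ℝ → Fin (m + 2) → ℝ} {T ν : ℝ → ℝ}
  (M : NeumannMotion b p q T ν)
include M

/-- The multiplier `ν` drops out of `p k q j - p j q k`, whose `τ`-derivative is `-(b k - b j) q k q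
j` and cancels the denominator. The relations `|q| = 1` and `(p, q) = 0` then sum the result to
zero. -/
theorem hasDerivAt_integralF (s : ℝ) (k : Fin (m + 2)) :
    HasDerivAt (fun s => integralF b (p s) (q s) k) 0 s := by
  unfold integralF
  have h1 := (M.hasDerivAt_q s k).pow 2
  have h2 : ∀ j ∈ Finset.univ.erase k, HasDerivAt
      (fun s => (p s k * q s j - p s j * q s k) ^ 2 / (b k - b j))
      (-2 * T s * q s k * (p s k * q s j ^ 2 - q s k * (p s j * q s j))) s := by
    intro j hj
    have hb : b k - b j ≠ 0 := sub_ne_zero.2 fun h => Finset.ne_of_mem_erase hj (M.inj h.symm)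
    have := ((((M.hasDerivAt_p s k).mul (M.hasDerivAt_q s j)).sub
      ((M.hasDerivAt_p s j).mul (M.hasDerivAt_q s k))).pow 2).div_const (b k - b j)
    refine this.congr_deriv ?_
    simp only [Pi.sub_apply, Pi.mul_apply]
    field_simp
    ring
  refine (h1.add (HasDerivAt.fun_sum h2)).congr_deriv ?_
  have h3 : ∑ j ∈ Finset.univ.erase k,
      (-2 * T s * q s k * (p s k * q s j ^ 2 - q s k * (p s j * q s j))) =
      ∑ j, (-2 * T s * q s k * (p s k * q s j ^ 2 - q s k * (p s j * q s j))) := by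
    refine Finset.sum_subset (Finset.erase_subset _ _) fun j _ hj => ?_
    have : j = k := by simpa using hj
    rw [this]; ring
  rw [h3, ← Finset.mul_sum, Finset.sum_sub_distrib, ← Finset.mul_sum, ← Finset.mul_sum, M.norm,
    M.orth]
  ring

theorem integralF_eq (s : ℝ) : integralF b (p s) (q s) = integralF b (p 0) (q 0) := by
  funext k
  exact is_const_of_deriv_eq_zero (fun s => (M.hasDerivAt_integralF s k).differentiableAt)
    (fun s => (M.hasDerivAt_integralF s k).deriv) s 0

theorem spectralPoly_eq (s : ℝ) : spectralPoly b (p s) (q s) = spectralPoly b (p 0) (q 0) := by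
  rw [spectralPoly, spectralPoly, M.integralF_eq]

theorem continuous_q (k : Fin (m + 2)) : Continuous fun s => q s k :=
  continuous_iff_continuousAt.2 fun s => (M.hasDerivAt_q s k).continuousAt

theorem continuous_p (k : Fin (m + 2)) : Continuous fun s => p s k :=
  continuous_iff_continuousAt.2 fun s => (M.hasDerivAt_p s k).continuousAt

theorem p_ne_zero_of_q_eq_zero (hsq : Squarefree (spectralPoly b (p 0) (q 0))) {s : ℝ}
    {l : Fin (m + 2)} (hq : q s l = 0) : p s l ≠ 0 := by
  intro hp
  rw [← M.spectralPoly_eq s] at hsq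
  refine integralF_ne_zero_of_squarefree hsq l ?_
  rw [integralF, hq, hp]
  simp

/-- If `q l` vanished on an open set, so would `p l`, against the simplicity of the root `b l`.
Strict interlacing needs all `q l ≠ 0`; its consequences pass to the other times by density. -/
theorem dense_forall_ne_zero (hsq : Squarefree (spectralPoly b (p 0) (q 0))) :
    Dense {s | ∀ l, q s l ≠ 0} := by
  have h1 : ∀ l, IsOpen {s | q s l ≠ 0} := fun l => isOpen_ne_fun (M.continuous_q l) continuous_const
  have h2 : ∀ l, Dense {s | q s l ≠ 0} := by
    intro l
    rw [dense_iff_inter_open]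
    rintro U hU ⟨s, hs⟩
    by_contra hne
    have hz : (fun s => q s l) =ᶠ[𝓝 s] fun _ => 0 := by
      filter_upwards [hU.mem_nhds hs] with t ht
      by_contra hc
      exact hne ⟨t, ht, hc⟩
    have hd := (M.hasDerivAt_q s l).unique ((hasDerivAt_const s (0 : ℝ)).congr_of_eventuallyEq hz)
    exact M.p_ne_zero_of_q_eq_zero hsq hz.eq_of_nhds
      ((mul_eq_zero.1 hd).resolve_left (M.T_pos s).ne')
  have : {s | ∀ l, q s l ≠ 0} = ⋂ l, {s | q s l ≠ 0} := by ext s; simp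
  rw [this]
  exact dense_iInter_of_isOpen h1 h2

theorem continuous_eval_fracNumerator :
    Continuous fun x : ℝ × ℝ => (fracNumerator b (fun k => q x.1 k ^ 2)).eval x.2 := by
  simp only [eval_fracNumerator]
  refine continuous_finsetSum _ fun k _ => ?_
  exact (((M.continuous_q k).comp continuous_fst).pow 2).mul
    (continuous_finsetProd _ fun j _ => continuous_snd.sub continuous_const)

/-- The branch points are real, and each oval carries a zero of `(R_u q, q)`. -/
theorem exists_branchData (hsq : Squarefree (spectralPoly b (p 0) (q 0))) :
    (∃ d : Fin (m + 1) → ℝ, fracNumerator b (integralF b (p 0) (q 0)) = ∏ i, (X - C (d i))) ∧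
    ∃ E, BranchData m (spectralPoly b (p 0) (q 0)) E ∧ ∀ s (i : Fin (m + 1)),
      ∃ u ∈ Set.Icc (E (2 * i + 1)) (E (2 * i + 2)),
        (fracNumerator b (fun k => q s k ^ 2)).eval u = 0 := by
  set R := spectralPoly b (p 0) (q 0) with hR
  let σ := Tuple.sort b
  have hβ : StrictMono (b ∘ σ) :=
    (Tuple.monotone_sort b).strictMono_of_injective (M.inj.comp σ.injective)
  have hroot : ∀ s, (∀ l, q s l ≠ 0) → ∀ i : Fin (m + 1),
      ∃ u ∈ Set.Ioo ((b ∘ σ) i.castSucc) ((b ∘ σ) i.succ),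
        (fracNumerator b (fun k => q s k ^ 2)).eval u = 0 ∧ 0 ≤ R.eval u := by
    intro s hs i
    obtain ⟨u, hu, h0⟩ := exists_root_fracNumerator hβ (w := (fun k => q s k ^ 2) ∘ σ)
      (fun k => by simp only [Function.comp]; exact by have := hs (σ k); positivity) i
    rw [fracNumerator_comp_equiv] at h0
    refine ⟨u, hu, h0, ?_⟩
    rw [hR, ← M.spectralPoly_eq s, eval_spectralPoly_of_root M.inj h0]
    positivity
  obtain ⟨s₀, hs₀⟩ := (M.dense_forall_ne_zero hsq).nonempty
  choose u hu _ hu0 using hroot s₀ hs₀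
  -- One time suffices here, because `R` does not depend on time.
  choose v hv hpos using fun i => exists_eval_pos_of_squarefree hsq (hu i) (hu0 i)
  have hsum : ∑ k, integralF b (p 0) (q 0) k = 1 := by rw [sum_integralF, M.norm]
  obtain ⟨hd, E, hE, hprod, hint⟩ := exists_branchPoints hβ (fracNumerator_monic (b := b) hsum)
    (natDegree_fracNumerator hsum) (R := R) (by rw [polyB_comp_equiv]; rfl) hsq hv hpos
  refine ⟨hd, E, ⟨hE, hprod⟩, fun s i => ?_⟩
  -- The pairs (time, root on the closed interval) form a closed set, whose projection along the
  -- compact factor is closed. It contains a dense set of times, hence all of them.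
  let Z : Set (ℝ × Set.Icc (E (2 * i + 1)) (E (2 * i + 2))) :=
    {x | (fracNumerator b (fun k => q x.1 k ^ 2)).eval (x.2 : ℝ) = 0}
  have hZ : IsClosed Z := isClosed_eq
    (M.continuous_eval_fracNumerator.comp
      (continuous_fst.prodMk (continuous_subtype_val.comp continuous_snd))) continuous_const
  have hcl : IsClosed (Prod.fst '' Z) := isClosedMap_fst_of_compactSpace _ hZ
  have hsub : {s | ∀ l, q s l ≠ 0} ⊆ Prod.fst '' Z := by
    intro t ht
    obtain ⟨u, hu, h0, hpos⟩ := hroot t ht i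
    exact ⟨(t, ⟨u, mem_oval_of_interlacing hE hprod i.2 (hint i).1 (hint i).2.2.2 hu hpos⟩), h0, rfl⟩
  have huniv : Prod.fst '' Z = Set.univ := by
    rw [← hcl.closure_eq]; exact ((M.dense_forall_ne_zero hsq).mono hsub).closure_eq
  obtain ⟨⟨t, u⟩, hu, rfl⟩ := huniv.ge (Set.mem_univ s)
  exact ⟨u, u.2, hu⟩

end NeumannMotion

/-! ### Elliptic coordinates and the Dubrovin equations. -/

/-- The points `(u i, y i)` move along the ovals by the Dubrovin equations, with respect to a
time `τ`, `dτ/ds = T(s)`. -/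
structure OvalMotion {m : ℕ} (R : ℝ[X]) (T : ℝ → ℝ) (u y : Fin (m + 1) → ℝ → ℝ) : Prop where
  mem : ∀ (i : Fin (m + 1)) s, (u i s, y i s) ∈ oval R i
  T_pos : ∀ s, 0 < T s
  T_cont : Continuous T
  hasDerivAt_u : ∀ i s, HasDerivAt (u i)
    (-(T s * y i s) / ∏ j ∈ Finset.univ.erase i, (u i s - u j s)) s
  hasDerivAt_y : ∀ i s, HasDerivAt (y i)
    (-(T s * (derivative R).eval (u i s)) / (2 * ∏ j ∈ Finset.univ.erase i, (u i s - u j s))) s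

theorem eq_prod_of_roots {P : ℝ[X]} {n : ℕ} (hP : P.Monic) (hdeg : P.natDegree = n)
    {u : Fin n → ℝ} (hu : Function.Injective u) (h0 : ∀ i, P.eval (u i) = 0) :
    P = ∏ i, (X - C (u i)) := by
  have hdvd : ∏ i, (X - C (u i)) ∣ P :=
    Finset.prod_dvd_of_coprime (fun i _ j _ hij => pairwise_coprime_X_sub_C hu hij)
      (fun i _ => dvd_iff_isRoot.2 (h0 i))
  exact eq_of_monic_of_dvd_of_natDegree_le (monic_prod_X_sub_C u _) hP hdvd (by simp [hdeg])

theorem derivative_prod_eval {n : ℕ} (u : Fin n → ℝ) (i : Fin n) :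
    (derivative (∏ j, (X - C (u j)))).eval (u i) = ∏ j ∈ Finset.univ.erase i, (u i - u j) := by
  have := Lagrange.eval_nodal_derivative_eval_node_eq (v := u) (Finset.mem_univ i)
  rw [Lagrange.nodal_eq, Lagrange.nodal_eq] at this
  rw [this, eval_prod]
  simp

namespace BranchData

variable {m : ℕ} {R : ℝ[X]} {E : ℕ → ℝ} (h : BranchData m R E)
include h

theorem injective_of_mem {u : Fin (m + 1) → ℝ}
    (hu : ∀ i : Fin (m + 1), u i ∈ Set.Icc (ovalLeft R i) (ovalRight R i)) :
    Function.Injective u :=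
  StrictMono.injective fun _ _ hij =>
    (hu _).2.trans_lt ((h.right_lt_left hij).trans_le (hu _).1)

theorem prod_sub_ne_zero {u : Fin (m + 1) → ℝ}
    (hu : ∀ i : Fin (m + 1), u i ∈ Set.Icc (ovalLeft R i) (ovalRight R i)) (i : Fin (m + 1)) :
    ∏ j ∈ Finset.univ.erase i, (u i - u j) ≠ 0 :=
  right_ne_zero_of_mul (h.prod_mul_prod_mid_pos hu i).ne'

/-- A positive continuous function on the product of the ovals is bounded from both sides. -/
theorem exists_bounds {f : (Fin (m + 1) → ℝ) → ℝ}
    (hf : ContinuousOn f (Set.univ.pi fun i : Fin (m + 1) => Set.Icc (ovalLeft R i) (ovalRight R i)))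
    (hpos : ∀ u : Fin (m + 1) → ℝ, (∀ i : Fin (m + 1), u i ∈ Set.Icc (ovalLeft R i) (ovalRight R i)) →
      0 < f u) :
    ∃ c C : ℝ, 0 < c ∧ ∀ u : Fin (m + 1) → ℝ,
      (∀ i : Fin (m + 1), u i ∈ Set.Icc (ovalLeft R i) (ovalRight R i)) → c ≤ f u ∧ f u ≤ C := by
  have hK : IsCompact
      (Set.univ.pi fun i : Fin (m + 1) => Set.Icc (ovalLeft R i) (ovalRight R i)) :=
    isCompact_univ_pi fun _ => isCompact_Icc
  have hne : (Set.univ.pi fun i : Fin (m + 1) => Set.Icc (ovalLeft R i) (ovalRight R i)).Nonempty :=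
    ⟨fun i : Fin (m + 1) => ovalLeft R i, fun i _ => ⟨le_rfl, (h.left_lt_right i).le⟩⟩
  obtain ⟨a, ha, hmin⟩ := hK.exists_isMinOn hne hf
  obtain ⟨d, _, hmax⟩ := hK.exists_isMaxOn hne hf
  exact ⟨f a, f d, hpos a fun i => ha i trivial,
    fun u hu => ⟨hmin fun i _ => hu i, hmax fun i _ => hu i⟩⟩

omit h in
theorem _root_.GeodesicScattering.continuous_prod_sub (i : Fin (m + 1)) :
    Continuous fun u : Fin (m + 1) → ℝ => ∏ j ∈ Finset.univ.erase i, (u i - u j) :=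
  continuous_finsetProd _ fun j _ => (continuous_apply i).sub (continuous_apply j)

end BranchData

namespace NeumannMotion

variable {m : ℕ} {b : Fin (m + 2) → ℝ} {p q : ℝ → Fin (m + 2) → ℝ} {T ν : ℝ → ℝ}
  (M : NeumannMotion b p q T ν) {E : ℕ → ℝ} (h : BranchData m (spectralPoly b (p 0) (q 0)) E)
include M

theorem derivative_spectralPoly_eval (s : ℝ) {u : ℝ}
    (hu : (fracNumerator b (fun k => q s k ^ 2)).eval u = 0) :
    (derivative (spectralPoly b (p 0) (q 0))).eval u =
      -4 * (((fracNumerator b (fun k => p s k ^ 2)).eval u + (polyB b).eval u) *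
          (derivative (fracNumerator b (fun k => q s k ^ 2))).eval u -
        2 * (fracNumerator b (fun k => p s k * q s k)).eval u *
          (derivative (fracNumerator b (fun k => p s k * q s k))).eval u) := by
  rw [← M.spectralPoly_eq s, GeodesicScattering.spectralPoly_eq M.inj, derivative_C_mul,
    derivative_sub, derivative_mul, derivative_pow]
  simp only [eval_mul, eval_sub, eval_add, eval_C, hu, eval_pow, derivative_add]
  norm_num

/-- At a root of `(R_u q, q)` the terms with `ν` and with `u` vanish, and the force `-b k q k`
contributes exactly `B(u)`. The bracket is the one that appears in `R'(u)`. -/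
theorem hasDerivAt_eval_pq {s : ℝ} {u : ℝ → ℝ} {u' : ℝ} (hu : HasDerivAt u u' s)
    (h0 : (fracNumerator b (fun k => q s k ^ 2)).eval (u s) = 0) :
    HasDerivAt (fun s => (fracNumerator b (fun k => p s k * q s k)).eval (u s))
      (T s * ((fracNumerator b (fun k => p s k ^ 2)).eval (u s) + (polyB b).eval (u s)) +
        (derivative (fracNumerator b (fun k => p s k * q s k))).eval (u s) * u') s := by
  refine (hasDerivAt_eval_fracNumerator (w := fun s k => p s k * q s k)
    (fun k => (M.hasDerivAt_p s k).mul (M.hasDerivAt_q s k)) hu).congr_deriv ?_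
  congr 1
  have e : (fun k => T s * (-(b k * q s k) + ν s * q s k) * q s k + p s k * (T s * p s k)) =
      fun k => T s * (p s k ^ 2 + ((-1) * (b k * q s k ^ 2) + ν s * q s k ^ 2)) := by
    funext k; ring
  rw [e, fracNumerator_smul, fracNumerator_add, fracNumerator_add, fracNumerator_smul,
    fracNumerator_smul, fracNumerator_mul_self, M.norm]
  simp only [eval_mul, eval_add, eval_C, eval_sub, eval_X, h0]
  ring

theorem hasDerivAt_eval_qq (s v : ℝ) :
    HasDerivAt (fun s => (fracNumerator b (fun k => q s k ^ 2)).eval v)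
      (2 * T s * (fracNumerator b (fun k => p s k * q s k)).eval v) s := by
  refine (hasDerivAt_eval_fracNumerator (w := fun s k => q s k ^ 2)
    (fun k => (M.hasDerivAt_q s k).pow 2) (hasDerivAt_const s v)).congr_deriv ?_
  have e : (fun k => ((2 : ℕ) : ℝ) * q s k ^ (2 - 1) * (T s * p s k)) =
      fun k => (2 * T s) * (p s k * q s k) := by
    funext k; norm_num; ring
  rw [e, fracNumerator_smul]
  simp

include h

theorem exists_ellipticCoordinates
    (hroots : ∀ s (i : Fin (m + 1)), ∃ u ∈ Set.Icc (E (2 * i + 1)) (E (2 * i + 2)),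
        (fracNumerator b (fun k => q s k ^ 2)).eval u = 0) :
    ∃ u : Fin (m + 1) → ℝ → ℝ,
      (∀ s (i : Fin (m + 1)), u i s ∈ Set.Icc (ovalLeft (spectralPoly b (p 0) (q 0)) i)
        (ovalRight (spectralPoly b (p 0) (q 0)) i)) ∧
      ∀ s, fracNumerator b (fun k => q s k ^ 2) = ∏ i, (X - C (u i s)) := by
  choose u hu h0 using hroots
  simp only [← h.ovalLeft_eq, ← h.ovalRight_eq] at hu
  exact ⟨fun i s => u s i, hu, fun s => eq_prod_of_roots (fracNumerator_monic (M.norm s))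
    (natDegree_fracNumerator (M.norm s)) (h.injective_of_mem (hu s)) (h0 s)⟩

/-- At a fixed `v` on the oval, the value of the polynomial is `v - u i` times a product bounded
away from zero, because the ovals are disjoint. So `|u i s - v|` is controlled by a function of `s`
that vanishes at `s₀`. -/
theorem continuous_ellipticCoordinate {u : Fin (m + 1) → ℝ → ℝ}
    (hu : ∀ s (i : Fin (m + 1)), u i s ∈ Set.Icc (ovalLeft (spectralPoly b (p 0) (q 0)) i)
        (ovalRight (spectralPoly b (p 0) (q 0)) i))
    (hN : ∀ s, fracNumerator b (fun k => q s k ^ 2) = ∏ i, (X - C (u i s))) (i : Fin (m + 1)) :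
    Continuous (u i) := by
  obtain ⟨c, C, hc, hb⟩ := h.exists_bounds (f := fun u => |∏ j ∈ Finset.univ.erase i, (u i - u j)|)
    (continuous_prod_sub i).abs.continuousOn
    (fun u hu => abs_pos.2 (h.prod_sub_ne_zero hu i))
  refine continuous_iff_continuousAt.2 fun s₀ => ?_
  set v := u i s₀ with hv
  have h0 : (fracNumerator b (fun k => q s₀ k ^ 2)).eval v = 0 := by
    rw [hN, eval_prod]
    exact Finset.prod_eq_zero (Finset.mem_univ i) (by simp [hv])
  have hbound : ∀ s, |u i s - v| ≤ |(fracNumerator b (fun k => q s k ^ 2)).eval v| / c := by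
    intro s
    rw [le_div_iff₀ hc, hN, eval_prod, ← Finset.mul_prod_erase _ _ (Finset.mem_univ i), abs_mul]
    simp only [eval_sub, eval_X, eval_C]
    rw [abs_sub_comm v]
    refine mul_le_mul_of_nonneg_left ?_ (abs_nonneg _)
    have := (hb (Function.update (fun j => u j s) i v) (fun j => by
      by_cases hj : j = i
      · subst hj; rw [Function.update_self]; exact hu s₀ j
      · rw [Function.update_of_ne hj]; exact hu s j)).1
    simp only [Function.update_self] at this
    refine this.trans_eq (congrArg _ (Finset.prod_congr rfl fun j hj => ?_))
    rw [Function.update_of_ne (Finset.ne_of_mem_erase hj)]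
  rw [ContinuousAt, ← hv, tendsto_iff_norm_sub_tendsto_zero]
  refine squeeze_zero (fun _ => norm_nonneg _) hbound ?_
  have := (((M.hasDerivAt_eval_qq s₀ v).continuousAt.abs).div_const c).tendsto
  simpa only [h0, abs_zero, zero_div] using this

/-- The factorisation gives the exact formula `u i t = v - N_t(v) / ∏ (v - u j t)`, where `N_t` is
the numerator of `(R_u q, q)`. As `N_s(v) = 0`, continuity of the denominator is enough to
differentiate it. -/
theorem hasDerivAt_ellipticCoordinate {u : Fin (m + 1) → ℝ → ℝ}
    (hu : ∀ s (i : Fin (m + 1)), u i s ∈ Set.Icc (ovalLeft (spectralPoly b (p 0) (q 0)) i)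
        (ovalRight (spectralPoly b (p 0) (q 0)) i))
    (hN : ∀ s, fracNumerator b (fun k => q s k ^ 2) = ∏ i, (X - C (u i s))) (i : Fin (m + 1))
    (s : ℝ) :
    HasDerivAt (u i) (-(T s * (2 * (fracNumerator b (fun k => p s k * q s k)).eval (u i s))) /
      ∏ j ∈ Finset.univ.erase i, (u i s - u j s)) s := by
  have hc := M.continuous_ellipticCoordinate h hu hN
  set v := u i s with hv
  have h0 : (fracNumerator b (fun k => q s k ^ 2)).eval v = 0 := by
    rw [hN, eval_prod]
    exact Finset.prod_eq_zero (Finset.mem_univ i) (by simp [hv])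
  have hne : ∀ t, ∏ j ∈ Finset.univ.erase i, (v - u j t) ≠ 0 := by
    intro t
    have := h.prod_sub_ne_zero (u := Function.update (fun j => u j t) i v) (fun j => by
      by_cases hj : j = i
      · subst hj; rw [Function.update_self]; exact hu s j
      · rw [Function.update_of_ne hj]; exact hu t j) i
    rw [Function.update_self] at this
    intro hz
    refine this (Eq.trans (Finset.prod_congr rfl fun j hj => ?_) hz)
    rw [Function.update_of_ne (Finset.ne_of_mem_erase hj)]
  have hcont : Continuous fun t => ∏ j ∈ Finset.univ.erase i, (v - u j t) :=
    continuous_finsetProd _ fun j _ => continuous_const.sub (hc j)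
  have hd := ((hasDerivAt_div_of_eq_zero (M.hasDerivAt_eval_qq s v) h0 hcont.continuousAt
    (hne s)).const_sub v)
  have e : (fun t => v - (fracNumerator b (fun k => q t k ^ 2)).eval v /
      ∏ j ∈ Finset.univ.erase i, (v - u j t)) = u i := by
    funext t
    rw [hN, eval_prod, ← Finset.mul_prod_erase _ _ (Finset.mem_univ i)]
    simp only [eval_sub, eval_X, eval_C]
    rw [mul_div_assoc, div_self (hne t)]
    ring
  rw [e] at hd
  refine hd.congr_deriv ?_
  ring

/-- The elliptic coordinates of a solution of the Neumann system move along the ovals. -/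
theorem ovalMotion (hT : Continuous T) {u : Fin (m + 1) → ℝ → ℝ}
    (hu : ∀ s (i : Fin (m + 1)), u i s ∈ Set.Icc (ovalLeft (spectralPoly b (p 0) (q 0)) i)
        (ovalRight (spectralPoly b (p 0) (q 0)) i))
    (hN : ∀ s, fracNumerator b (fun k => q s k ^ 2) = ∏ i, (X - C (u i s))) :
    OvalMotion (spectralPoly b (p 0) (q 0)) T u
      (fun i s => 2 * (fracNumerator b (fun k => p s k * q s k)).eval (u i s)) := by
  have h0 : ∀ (i : Fin (m + 1)) s, (fracNumerator b (fun k => q s k ^ 2)).eval (u i s) = 0 := by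
    intro i s
    rw [hN, eval_prod]
    exact Finset.prod_eq_zero (Finset.mem_univ i) (by simp)
  refine ⟨fun i s => ⟨hu s i, ?_⟩, M.T_pos, hT, M.hasDerivAt_ellipticCoordinate h hu hN,
    fun i s => ?_⟩
  · rw [← M.spectralPoly_eq s, eval_spectralPoly_of_root M.inj (h0 i s)]
  · have hπ := h.prod_sub_ne_zero (hu s) i
    refine ((M.hasDerivAt_eval_pq (M.hasDerivAt_ellipticCoordinate h hu hN i s)
      (h0 i s)).const_mul 2).congr_deriv ?_
    rw [M.derivative_spectralPoly_eval s (h0 i s), hN, derivative_prod_eval (fun j => u j s) i]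
    field_simp
    ring

end NeumannMotion

/-! ### Lifts to the universal coverings of the ovals -/

/-- The angle is the integral of the angular speed `w`. The inner product of `(c, σ)` with `(cos Θ,
sin Θ)` is constant and starts at `1`, so the two unit vectors coincide. -/
theorem exists_circle_lift {c σ w : ℝ → ℝ} (hc : ∀ s, HasDerivAt c (-(w s * σ s)) s)
    (hσ : ∀ s, HasDerivAt σ (w s * c s) s) (hw : Continuous w) (h1 : ∀ s, c s ^ 2 + σ s ^ 2 = 1) :
    ∃ Θ : ℝ → ℝ, ∀ s, HasDerivAt Θ (w s) s ∧ Real.cos (Θ s) = c s ∧ Real.sin (Θ s) = σ s := by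
  obtain ⟨θ₀, hcos, hsin⟩ := exists_cos_sin (h1 0)
  let Θ : ℝ → ℝ := fun s => θ₀ + ∫ t in (0 : ℝ)..s, w t
  have hΘ : ∀ s, HasDerivAt Θ (w s) s := fun s =>
    (hw.integral_hasStrictDerivAt 0 s).hasDerivAt.const_add θ₀
  have hA : ∀ s, HasDerivAt (fun s => c s * Real.cos (Θ s) + σ s * Real.sin (Θ s)) 0 s := by
    intro s
    refine (((hc s).mul (hΘ s).cos).add ((hσ s).mul (hΘ s).sin)).congr_deriv ?_
    ring
  have h2 : ∀ s, c s * Real.cos (Θ s) + σ s * Real.sin (Θ s) = 1 := by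
    intro s
    have h3 := is_const_of_deriv_eq_zero (fun s => (hA s).differentiableAt) (fun s => (hA s).deriv) s 0
    have h4 : Θ 0 = θ₀ := by simp [Θ]
    rw [h3, h4, hcos, hsin]
    linarith [h1 0]
  refine ⟨Θ, fun s => ⟨hΘ s, ?_⟩⟩
  have h5 := Real.sin_sq_add_cos_sq (Θ s)
  have h6 : (Real.cos (Θ s) - c s) ^ 2 + (Real.sin (Θ s) - σ s) ^ 2 = 0 := by
    linear_combination h5 + h1 s - 2 * h2 s
  constructor
  · nlinarith [sq_nonneg (Real.cos (Θ s) - c s), sq_nonneg (Real.sin (Θ s) - σ s)]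
  · nlinarith [sq_nonneg (Real.cos (Θ s) - c s), sq_nonneg (Real.sin (Θ s) - σ s)]

/-- The speed of the angular parameter on the `i`-th oval with respect to `τ`. -/
def ovalSpeed {m : ℕ} (E : ℕ → ℝ) (i : Fin (m + 1)) (u : Fin (m + 1) → ℝ) : ℝ :=
  √((ovalCofactor m E i).eval (u i)) / |∏ j ∈ Finset.univ.erase i, (u i - u j)|

namespace BranchData

variable {m : ℕ} {R : ℝ[X]} {E : ℕ → ℝ} (h : BranchData m R E)
include h

theorem ovalSpeed_pos {u : Fin (m + 1) → ℝ}
    (hu : ∀ i : Fin (m + 1), u i ∈ Set.Icc (ovalLeft R i) (ovalRight R i)) (i : Fin (m + 1)) :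
    0 < ovalSpeed E i u :=
  div_pos (Real.sqrt_pos.2 (h.cofactor_pos i (hu i))) (abs_pos.2 (h.prod_sub_ne_zero hu i))

/-- The orientation of the ovals was chosen to cancel the sign of the product in the Dubrovin
equations; this makes all angular speeds positive. -/
theorem ovalSpeed_eq {u : Fin (m + 1) → ℝ}
    (hu : ∀ i : Fin (m + 1), u i ∈ Set.Icc (ovalLeft R i) (ovalRight R i)) (i : Fin (m + 1)) :
    ovalSpeed E i u = -(ovalOrient R i * √((ovalCofactor m E i).eval (u i)) /
      ∏ j ∈ Finset.univ.erase i, (u i - u j)) := by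
  have h1 := h.orient_mul_prod_neg hu i
  have h2 := h.prod_sub_ne_zero hu i
  have h3 : |∏ j ∈ Finset.univ.erase i, (u i - u j)| =
      -(ovalOrient R i * ∏ j ∈ Finset.univ.erase i, (u i - u j)) := by
    rw [← abs_of_neg h1, abs_mul]
    have : |ovalOrient R i| = 1 := by
      have := h.orient_sq i
      rw [← abs_mul_abs_self] at this
      nlinarith [abs_nonneg (ovalOrient R i)]
    rw [this, one_mul]
  have h4 := h.orient_ne_zero i
  rw [ovalSpeed, h3]
  field_simp
  linear_combination √((ovalCofactor m E i).eval (u i)) * h.orient_sq i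

theorem exists_ovalSpeed_bounds (i : Fin (m + 1)) : ∃ c C : ℝ, 0 < c ∧ ∀ u : Fin (m + 1) → ℝ,
      (∀ i : Fin (m + 1), u i ∈ Set.Icc (ovalLeft R i) (ovalRight R i)) →
        c ≤ ovalSpeed E i u ∧ ovalSpeed E i u ≤ C := by
  refine h.exists_bounds ?_ fun u hu => h.ovalSpeed_pos hu i
  unfold ovalSpeed
  refine ContinuousOn.div ?_ (continuous_prod_sub i).abs.continuousOn fun u hu =>
    abs_ne_zero.2 (h.prod_sub_ne_zero (fun j => hu j trivial) i)
  exact ((ovalCofactor m E i).continuous.comp (continuous_apply i)).sqrt.continuousOn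

end BranchData

/-! ### Motion of the angles: finite total time, limits, and conservation of the Abelian integrals.
-/

namespace OvalMotion

variable {m : ℕ} {R : ℝ[X]} {E : ℕ → ℝ} {T : ℝ → ℝ} {u y : Fin (m + 1) → ℝ → ℝ}
  (W : OvalMotion R T u y) (h : BranchData m R E)
include W

theorem u_mem (s : ℝ) (i : Fin (m + 1)) : u i s ∈ Set.Icc (ovalLeft R i) (ovalRight R i) :=
  (W.mem i s).1

theorem continuous_u (i : Fin (m + 1)) : Continuous (u i) :=
  continuous_iff_continuousAt.2 fun s => (W.hasDerivAt_u i s).continuousAt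

include h

/-- At a branch point `u` alone does not determine the motion, since `du/dτ = 0` there; the equation
for `y` does. The factorisation of `R` by the cofactor makes both equations those of a rotation. -/
theorem hasDerivAt_sin (i : Fin (m + 1)) (s : ℝ) :
    HasDerivAt (fun s => ovalOrient R i * y i s /
        (ovalRad R i * √((ovalCofactor m E i).eval (u i s))))
      (T s * ovalSpeed E i (fun j => u j s) * ((ovalMid R i - u i s) / ovalRad R i)) s := by
  have hG := h.cofactor_pos i (W.u_mem s i)
  have hr := (h.rad_pos i).ne'
  have hπ := h.prod_sub_ne_zero (W.u_mem s) i
  have hu := W.hasDerivAt_u i s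
  have hy := W.hasDerivAt_y i s
  have hGd := (((ovalCofactor m E i).hasDerivAt (u i s)).comp s hu).sqrt hG.ne'
  have hsq := Real.sq_sqrt hG.le
  have hS := (Real.sqrt_pos.2 hG).ne'
  refine ((hy.const_mul (ovalOrient R i)).div (hGd.const_mul (ovalRad R i))
    (mul_ne_zero hr hS)).congr_deriv ?_
  have hR' : (derivative R).eval (u i s) =
      2 * (ovalMid R i - u i s) * (ovalCofactor m E i).eval (u i s) +
      (ovalRad R i ^ 2 - (ovalMid R i - u i s) ^ 2) *
        (derivative (ovalCofactor m E i)).eval (u i s) := by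
    conv_lhs => rw [h.eq_mul_cofactor i]
    simp only [derivative_mul, derivative_sub, derivative_X, derivative_C, eval_add, eval_mul,
      eval_sub, eval_X, eval_C, eval_one, eval_zero, ovalMid, ovalRad]
    ring
  have hy2 := (W.mem i s).2
  simp only at hy2
  rw [h.eval_eq_cofactor i] at hy2
  rw [h.ovalSpeed_eq (W.u_mem s) i, hR']
  simp only [Function.comp]
  set S := √((ovalCofactor m E i).eval (u i s))
  rw [← hsq] at hy2 ⊢
  set π := ∏ j ∈ Finset.univ.erase i, (u i s - u j s)
  field_simp
  rw [hy2]
  ring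

theorem hasDerivAt_cos (i : Fin (m + 1)) (s : ℝ) :
    HasDerivAt (fun s => (ovalMid R i - u i s) / ovalRad R i)
      (-(T s * ovalSpeed E i (fun j => u j s) * (ovalOrient R i * y i s /
        (ovalRad R i * √((ovalCofactor m E i).eval (u i s)))))) s := by
  have hG := h.cofactor_pos i (W.u_mem s i)
  have hr := (h.rad_pos i).ne'
  have hπ := h.prod_sub_ne_zero (W.u_mem s) i
  have hS := (Real.sqrt_pos.2 hG).ne'
  refine (((W.hasDerivAt_u i s).const_sub (ovalMid R i)).div_const (ovalRad R i)).congr_deriv ?_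
  rw [h.ovalSpeed_eq (W.u_mem s) i]
  field_simp
  linear_combination (-(T s * y i s)) * h.orient_sq i

theorem continuous_speed (i : Fin (m + 1)) :
    Continuous fun s => T s * ovalSpeed E i (fun j => u j s) := by
  refine W.T_cont.mul ?_
  unfold ovalSpeed
  refine Continuous.div ?_ (Continuous.abs ?_) fun s =>
    abs_ne_zero.2 (h.prod_sub_ne_zero (W.u_mem s) i)
  · exact ((ovalCofactor m E i).continuous.comp (W.continuous_u i)).sqrt
  · exact continuous_finsetProd _ fun j _ => (W.continuous_u i).sub (W.continuous_u j)

theorem exists_lift : ∃ Θ : Fin (m + 1) → ℝ → ℝ, ∀ i s,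
    HasDerivAt (Θ i) (T s * ovalSpeed E i (fun j => u j s)) s ∧
      ovalParam R i (Θ i s) = (u i s, y i s) := by
  choose Θ hΘ using fun i => exists_circle_lift (W.hasDerivAt_cos h i) (W.hasDerivAt_sin h i)
    (W.continuous_speed h i) (fun s => h.circle_of_mem (W.mem i s))
  exact ⟨Θ, fun i s => ⟨(hΘ i s).1, h.param_of_cos_sin (W.mem i s) (hΘ i s).2.1 (hΘ i s).2.2⟩⟩

variable {Θ : Fin (m + 1) → ℝ → ℝ}
  (hΘ : ∀ i s, HasDerivAt (Θ i) (T s * ovalSpeed E i (fun j => u j s)) s)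
  (hP : ∀ i s, ovalParam R i (Θ i s) = (u i s, y i s))
include hΘ

theorem strictMono_lift (i : Fin (m + 1)) : StrictMono (Θ i) :=
  strictMono_of_deriv_pos fun s => by
    rw [(hΘ i s).deriv]
    exact mul_pos (W.T_pos s) (h.ovalSpeed_pos (W.u_mem s) i)

include hP

omit W h hΘ hP in
theorem _root_.GeodesicScattering.exists_mem_Ioo_of_continuous {f : ℝ → ℝ} (hf : Continuous f)
    {a : ℝ} (ha : ∀ s (n : ℤ), f s ≠ a + n * (2 * Real.pi)) :
    ∃ n : ℤ, ∀ s, f s ∈ Set.Ioo (a + n * (2 * Real.pi)) (a + n * (2 * Real.pi) + 2 * Real.pi) := by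
  obtain ⟨n, φ, hφ, he⟩ := exists_mem_Ico_two_pi (f 0 - a)
  refine ⟨n, fun s => ?_⟩
  by_contra hs
  have hr : (Set.range f).OrdConnected := (isPreconnected_range hf).ordConnected
  have h0 : f 0 = a + n * (2 * Real.pi) + φ := by linarith
  rw [Set.mem_Ioo, not_and_or, not_lt, not_lt] at hs
  rcases hs with hs | hs
  · obtain ⟨t, ht⟩ := hr.out ⟨s, rfl⟩ ⟨0, rfl⟩ (show a + n * (2 * Real.pi) ∈ Set.Icc (f s) (f 0)
      from ⟨hs, by linarith [hφ.1]⟩)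
    exact ha t n ht
  · obtain ⟨t, ht⟩ := hr.out ⟨0, rfl⟩ ⟨s, rfl⟩
      (show a + n * (2 * Real.pi) + 2 * Real.pi ∈ Set.Icc (f 0) (f s)
        from ⟨by linarith [hφ.2], hs⟩)
    exact ha t (n + 1) (by push_cast; linarith)

omit W in
/-- If `u k` never vanishes, then `P k` stays on an arc between two successive lifts of `(0, 0)`. -/
theorem exists_arc {k : Fin (m + 1)} (hk : ((0, 0) : ℝ × ℝ) ∈ oval R k) (hne : ∀ s, u k s ≠ 0) :
    ∃ a, ovalParam R k a = (0, 0) ∧ ∀ s, Θ k s ∈ Set.Ioo a (a + 2 * Real.pi) := by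
  obtain ⟨a, ha⟩ := h.exists_param hk
  have hnot : ∀ s (n : ℤ), Θ k s ≠ a + n * (2 * Real.pi) := by
    intro s n hs
    have h1 := hP k s
    rw [(h.param_eq_iff k _ a).2 ⟨n, hs⟩, ha, Prod.mk.injEq] at h1
    exact hne s h1.1.symm
  obtain ⟨n, hn⟩ := exists_mem_Ioo_of_continuous
    (continuous_iff_continuousAt.2 fun s => (hΘ k s).continuousAt) hnot
  exact ⟨a + n * (2 * Real.pi), ((h.param_eq_iff k _ a).2 ⟨n, rfl⟩).trans ha, hn⟩

-- The angle has speed at least `c T` and stays in a bounded interval, so the total time `τ` is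
-- finite.
omit hP in
theorem integrable_of_bounded {k : Fin (m + 1)} {a b : ℝ} (hb : ∀ s, Θ k s ∈ Set.Ioo a b) :
    MeasureTheory.Integrable T := by
  obtain ⟨c, C, hc, hcC⟩ := h.exists_ovalSpeed_bounds k
  refine MeasureTheory.integrable_of_intervalIntegral_norm_bounded (ι := ℝ) (l := atTop)
    (a := fun t => -t) (b := fun t => t) ((b - a) / c)
    (fun t => W.T_cont.integrableOn_Ioc) tendsto_neg_atTop_atBot tendsto_id ?_
  filter_upwards [eventually_ge_atTop 0] with t ht
  have h1 : ∫ s in -t..t, T s * ovalSpeed E k (fun j => u j s) = Θ k t - Θ k (-t) :=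
    intervalIntegral.integral_eq_sub_of_hasDerivAt (fun s _ => hΘ k s)
      ((W.continuous_speed h k).intervalIntegrable _ _)
  have h2 : ∫ s in -t..t, c * ‖T s‖ ≤ ∫ s in -t..t, T s * ovalSpeed E k (fun j => u j s) := by
    refine intervalIntegral.integral_mono_on (by linarith)
      ((continuous_const.mul W.T_cont.norm).intervalIntegrable _ _)
      ((W.continuous_speed h k).intervalIntegrable _ _) fun s _ => ?_
    rw [Real.norm_of_nonneg (W.T_pos s).le, mul_comm]
    exact mul_le_mul_of_nonneg_left (hcC _ (W.u_mem s)).1 (W.T_pos s).le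
  rw [intervalIntegral.integral_const_mul, h1] at h2
  rw [le_div_iff₀ hc, mul_comm]
  have h3 := (hb t).2
  have h4 := (hb (-t)).1
  exact h2.trans (by linarith)

omit hP in
theorem exists_limits (hT : MeasureTheory.Integrable T) (i : Fin (m + 1)) :
    ∃ θm θp, Tendsto (Θ i) atBot (𝓝 θm) ∧ Tendsto (Θ i) atTop (𝓝 θp) := by
  obtain ⟨c, C, -, hcC⟩ := h.exists_ovalSpeed_bounds i
  have hint : MeasureTheory.Integrable fun s => T s * ovalSpeed E i (fun j => u j s) := by
    refine (hT.mul_const C).mono' (W.continuous_speed h i).aestronglyMeasurable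
      (MeasureTheory.ae_of_all _ fun s => ?_)
    rw [Real.norm_of_nonneg
      (mul_pos (W.T_pos s) (h.ovalSpeed_pos (W.u_mem s) i)).le]
    exact mul_le_mul_of_nonneg_left (hcC _ (W.u_mem s)).2 (W.T_pos s).le
  exact ⟨_, _, MeasureTheory.tendsto_limUnder_of_hasDerivAt_of_integrableOn_Iic (a := 0)
      (fun s _ => hΘ i s) hint.integrableOn,
    MeasureTheory.tendsto_limUnder_of_hasDerivAt_of_integrableOn_Ioi (a := 0)
      (fun s _ => hΘ i s) hint.integrableOn⟩

/-- The sum of the Abelian integrals over all the ovals is an integral of motion. -/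
theorem sum_integral_eq (j : Fin m) (s : ℝ) :
    ∑ i, ovalIntegral R i j (Θ i s) = ∑ i, ovalIntegral R i j (Θ i 0) := by
  have hd : ∀ s, HasDerivAt (fun s => ∑ i, ovalIntegral R i j (Θ i s)) 0 s := by
    intro s
    have h1 : ∀ i ∈ Finset.univ, HasDerivAt (fun s => ovalIntegral R i j (Θ i s))
        (-T s * (u i s ^ (j : ℕ) / ∏ l ∈ Finset.univ.erase i, (u i s - u l s))) s := by
      intro i _
      refine ((h.hasStrictDerivAt_integral i j (Θ i s)).hasDerivAt.comp s (hΘ i s)).congr_deriv ?_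
      have ha : ovalAbscissa R i (Θ i s) = u i s := by
        have := hP i s
        rw [h.param_eq, Prod.mk.injEq] at this
        exact this.1
      have hS := (Real.sqrt_pos.2 (h.cofactor_pos i (W.u_mem s i))).ne'
      have hπ := h.prod_sub_ne_zero (W.u_mem s) i
      rw [abelDensity, ha, h.ovalSpeed_eq (W.u_mem s) i]
      field_simp
      linear_combination (-(u i s ^ (j : ℕ) * T s)) * h.orient_sq i
    refine (HasDerivAt.fun_sum h1).congr_deriv ?_
    -- Euler's identities apply with `m + 1` nodes and exponents `j < m`.
    rw [← Finset.mul_sum, sum_pow_div_prod_eq_zero (h.injective_of_mem (W.u_mem s)) j.2, mul_zero]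
  exact is_const_of_deriv_eq_zero (fun s => (hd s).differentiableAt) (fun s => (hd s).deriv) s 0

theorem sum_integral_limits {θm θp : Fin (m + 1) → ℝ} (hm : ∀ i, Tendsto (Θ i) atBot (𝓝 (θm i)))
    (hp : ∀ i, Tendsto (Θ i) atTop (𝓝 (θp i))) (j : Fin m) :
    ∑ i, ovalIntegral R i j (θp i) = ∑ i, ovalIntegral R i j (θm i) := by
  have hc : ∀ i : Fin (m + 1), Continuous (ovalIntegral R i j) := fun i =>
    continuous_iff_continuousAt.2 fun θ => (h.hasStrictDerivAt_integral i j θ).hasDerivAt.continuousAt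
  have h1 : Tendsto (fun s => ∑ i, ovalIntegral R i j (Θ i s)) atTop
      (𝓝 (∑ i, ovalIntegral R i j (θp i))) :=
    tendsto_finsetSum _ fun i _ => ((hc i).tendsto _).comp (hp i)
  have h2 : Tendsto (fun s => ∑ i, ovalIntegral R i j (Θ i s)) atBot
      (𝓝 (∑ i, ovalIntegral R i j (θm i))) :=
    tendsto_finsetSum _ fun i _ => ((hc i).tendsto _).comp (hm i)
  simp only [W.sum_integral_eq h hΘ hP j] at h1 h2
  exact (tendsto_nhds_unique h1 tendsto_const_nhds).trans
    (tendsto_nhds_unique h2 tendsto_const_nhds).symm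

/-- The scattering relation for the lifted Abel map. -/
theorem liftedAbel_scattering {k : Fin (m + 1)} {θm θp : Fin (m + 1) → ℝ}
    (hm : ∀ i, Tendsto (Θ i) atBot (𝓝 (θm i))) (hp : ∀ i, Tendsto (Θ i) atTop (𝓝 (θp i)))
    (hk : θp k = θm k + 2 * Real.pi) :
    liftedAbel R k (fun i => θp (k.succAbove i)) =
      liftedAbel R k (fun i => θm (k.succAbove i)) - ovalPeriod R k := by
  funext j
  have h1 := W.sum_integral_limits h hΘ hP hm hp j
  rw [Fin.sum_univ_succAbove _ k, Fin.sum_univ_succAbove _ k, hk] at h1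
  have h2 := h.integral_add_int_mul k j (θm k) 1
  simp only [Int.cast_one, one_mul] at h2
  rw [h2] at h1
  simp only [liftedAbel, Pi.sub_apply]
  linarith

omit W hΘ in
/-- If `∏ u i` tends to zero, then `P k` tends to the origin. -/
theorem limit_eq_origin {k : Fin (m + 1)} (hk : ((0, 0) : ℝ × ℝ) ∈ oval R k) {l : Filter ℝ}
    [l.NeBot] {θ : Fin (m + 1) → ℝ} (hl : ∀ i, Tendsto (Θ i) l (𝓝 (θ i)))
    (h0 : Tendsto (fun s => ∏ i, u i s) l (𝓝 0)) : ovalParam R k (θ k) = (0, 0) := by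
  have hu : ∀ i, Tendsto (u i) l (𝓝 (ovalAbscissa R i (θ i))) := by
    intro i
    have e : u i = fun s => ovalAbscissa R i (Θ i s) := by
      funext s
      have := hP i s
      rw [h.param_eq, Prod.mk.injEq] at this
      exact this.1.symm
    rw [e]
    exact ((continuous_abscissa R i).tendsto _).comp (hl i)
  -- The limit of some `u i` is `0`. Since `R(0) = 0`, the limit point is the origin, which lies on
  -- the oval `k` only.
  have h1 := tendsto_nhds_unique (tendsto_finsetProd Finset.univ fun i _ => hu i) h0
  obtain ⟨i, -, hi⟩ := Finset.prod_eq_zero_iff.1 h1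
  have hR0 : R.eval 0 = 0 := by have := hk.2; simp only at this; rw [← this]; norm_num
  have hmem := h.param_mem i (θ i)
  have hp : ovalParam R i (θ i) = (0, 0) := by
    rw [h.param_eq] at hmem ⊢
    rw [Prod.mk.injEq]
    refine ⟨hi, ?_⟩
    have := hmem.2
    simp only [hi, hR0] at this ⊢
    exact pow_eq_zero_iff two_ne_zero |>.1 this
  have hik : i = k := by
    by_contra hne
    exact h.oval_disjoint hne (hp ▸ hmem) hk
  rw [← hik, hp]

/-- Both limit angles are lifts of the origin in `[a, a + 2 π]`, hence endpoints. Monotonicity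
excludes the upper one in the past and the lower one in the future. -/
theorem turn_around {k : Fin (m + 1)} (hk : ((0, 0) : ℝ × ℝ) ∈ oval R k)
    {a : ℝ} (ha : ovalParam R k a = (0, 0)) (harc : ∀ s, Θ k s ∈ Set.Ioo a (a + 2 * Real.pi))
    {θm θp : Fin (m + 1) → ℝ}
    (hm : ∀ i, Tendsto (Θ i) atBot (𝓝 (θm i))) (hp : ∀ i, Tendsto (Θ i) atTop (𝓝 (θp i)))
    (h0m : Tendsto (fun s => ∏ i, u i s) atBot (𝓝 0))
    (h0p : Tendsto (fun s => ∏ i, u i s) atTop (𝓝 0)) :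
    θm k = a ∧ θp k = a + 2 * Real.pi := by
  have hpi := Real.two_pi_pos
  have hmono := W.strictMono_lift h hΘ k
  have e1 := (limit_eq_origin h hP hk hm h0m).trans ha.symm
  have e2 := (limit_eq_origin h hP hk hp h0p).trans ha.symm
  obtain ⟨n, hn⟩ := (h.param_eq_iff k _ _).1 e1
  obtain ⟨n', hn'⟩ := (h.param_eq_iff k _ _).1 e2
  have l1 : a ≤ θm k := ge_of_tendsto' (hm k) fun s => (harc s).1.le
  have l2 : θm k < a + 2 * Real.pi := by
    refine lt_of_le_of_lt (le_of_tendsto (hm k) ?_) (harc 0).2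
    filter_upwards [eventually_le_atBot 0] with s hs
    exact hmono.monotone hs
  have l3 : θp k ≤ a + 2 * Real.pi := le_of_tendsto' (hp k) fun s => (harc s).2.le
  have l4 : a < θp k := by
    refine lt_of_lt_of_le (harc 0).1 (ge_of_tendsto (hp k) ?_)
    filter_upwards [eventually_ge_atTop 0] with s hs
    exact hmono.monotone hs
  have hn0 : n = 0 := by
    have i1 : (-1 : ℝ) < n := by by_contra! hc; nlinarith
    have i2 : (n : ℝ) < 1 := by by_contra! hc; nlinarith
    have i1' : -1 < n := by exact_mod_cast i1
    have i2' : n < 1 := by exact_mod_cast i2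
    omega
  have hn1 : n' = 1 := by
    have i1 : (0 : ℝ) < n' := by by_contra! hc; nlinarith
    have i2 : (n' : ℝ) < 2 := by by_contra! hc; nlinarith
    have i1' : 0 < n' := by exact_mod_cast i1
    have i2' : n' < 2 := by exact_mod_cast i2
    omega
  subst hn0 hn1
  constructor
  · rw [hn]; simp
  · rw [hn']; simp

end OvalMotion

/-! ### Asymptotics of the Neumann motion: the product of the elliptic coordinates tends to zero. -/

namespace NeumannMotion

variable {m : ℕ} {b : Fin (m + 2) → ℝ} {p q : ℝ → Fin (m + 2) → ℝ} {T ν : ℝ → ℝ}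
  (M : NeumannMotion b p q T ν)
include M

theorem energy_eq (s : ℝ) :
    ∑ k, (p s k ^ 2 + b k * q s k ^ 2) = ∑ k, (p 0 k ^ 2 + b k * q 0 k ^ 2) := by
  have hd : ∀ s, HasDerivAt (fun s => ∑ k, (p s k ^ 2 + b k * q s k ^ 2)) 0 s := by
    intro s
    have h1 : ∀ k ∈ Finset.univ, HasDerivAt (fun s => p s k ^ 2 + b k * q s k ^ 2)
        (2 * T s * ν s * (p s k * q s k)) s := fun k _ =>
      (((M.hasDerivAt_p s k).pow 2).add (((M.hasDerivAt_q s k).pow 2).const_mul (b k))).congr_deriv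
        (by ring)
    refine (HasDerivAt.fun_sum h1).congr_deriv ?_
    rw [← Finset.mul_sum, M.orth, mul_zero]
  exact is_const_of_deriv_eq_zero (fun s => (hd s).differentiableAt) (fun s => (hd s).deriv) s 0

theorem q_sq_le_one (s : ℝ) (k : Fin (m + 2)) : q s k ^ 2 ≤ 1 := by
  rw [← M.norm s]
  exact Finset.single_le_sum (f := fun k => q s k ^ 2) (fun i _ => sq_nonneg _) (Finset.mem_univ k)

/-- The energy is conserved, and its potential part is bounded on the unit sphere. -/
theorem exists_bound_p : ∃ C, ∀ s k, |p s k| ≤ C := by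
  refine ⟨1 + (∑ k, (p 0 k ^ 2 + b k * q 0 k ^ 2) + ∑ k, |b k|), fun s k => ?_⟩
  have h1 : p s k ^ 2 ≤ ∑ k, p s k ^ 2 :=
    Finset.single_le_sum (f := fun k => p s k ^ 2) (fun i _ => sq_nonneg _) (Finset.mem_univ k)
  have h2 : -∑ k, |b k| ≤ ∑ k, b k * q s k ^ 2 := by
    rw [← Finset.sum_neg_distrib]
    refine Finset.sum_le_sum fun k _ => ?_
    have := M.q_sq_le_one s k
    have h3 := neg_abs_le (b k)
    have h4 := abs_nonneg (b k)
    nlinarith [sq_nonneg (q s k)]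
  have h3 := M.energy_eq s
  rw [Finset.sum_add_distrib] at h3
  have h4 := sq_abs (p s k)
  nlinarith [sq_nonneg (|p s k| - 1)]

theorem hasDerivAt_sum_div (s : ℝ) :
    HasDerivAt (fun s => ∑ k, q s k ^ 2 / b k) (∑ k, 2 * T s * (p s k * q s k / b k)) s := by
  refine HasDerivAt.fun_sum fun k _ => ?_
  exact (((M.hasDerivAt_q s k).pow 2).div_const (b k)).congr_deriv (by ring)

/-- The function is dominated by a multiple of `T`, and so is its derivative, because `p` and `q`
are bounded. An integrable function with integrable derivative tends to zero at both ends. -/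
theorem tendsto_sum_div (hT : MeasureTheory.Integrable T) {κ : ℝ} (hκ : 0 < κ)
    (hTκ : ∀ s, T s = κ * |∑ k, q s k ^ 2 / b k|) :
    Tendsto (fun s => ∑ k, q s k ^ 2 / b k) atBot (𝓝 0) ∧
      Tendsto (fun s => ∑ k, q s k ^ 2 / b k) atTop (𝓝 0) := by
  obtain ⟨C, hC⟩ := M.exists_bound_p
  have hcont : Continuous fun s => ∑ k, q s k ^ 2 / b k :=
    continuous_iff_continuousAt.2 fun s => (M.hasDerivAt_sum_div s).continuousAt
  have hTc : Continuous T := by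
    rw [show T = _ from funext hTκ]; exact continuous_const.mul hcont.abs
  have h1 : MeasureTheory.Integrable fun s => ∑ k, q s k ^ 2 / b k := by
    refine (hT.mul_const κ⁻¹).mono' hcont.aestronglyMeasurable
      (MeasureTheory.ae_of_all _ fun s => ?_)
    rw [hTκ, Real.norm_eq_abs]
    field_simp
    exact le_rfl
  have h2 : MeasureTheory.Integrable fun s => ∑ k, 2 * T s * (p s k * q s k / b k) := by
    refine MeasureTheory.integrable_finsetSum _ fun k _ => ?_
    refine (hT.mul_const (2 * C / |b k|)).mono' ?_ (MeasureTheory.ae_of_all _ fun s => ?_)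
    · exact ((continuous_const.mul hTc).mul
        (((M.continuous_p k).mul (M.continuous_q k)).div_const _)).aestronglyMeasurable
    · have hq : |q s k| ≤ 1 := by
        rw [← sq_le_one_iff_abs_le_one]; exact M.q_sq_le_one s k
      rw [Real.norm_eq_abs, abs_mul, abs_mul, abs_div, abs_mul, abs_of_pos (M.T_pos s), abs_two]
      have h3 : |p s k| * |q s k| ≤ C :=
        (mul_le_of_le_one_right (abs_nonneg _) hq).trans (hC s k)
      calc 2 * T s * (|p s k| * |q s k| / |b k|) ≤ 2 * T s * (C / |b k|) := by
            have := M.T_pos s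
            gcongr
        _ = T s * (2 * C / |b k|) := by ring
  exact ⟨MeasureTheory.tendsto_zero_of_hasDerivAt_of_integrableOn_Iic (a := 0)
      (fun s _ => M.hasDerivAt_sum_div s) h2.integrableOn h1.integrableOn,
    MeasureTheory.tendsto_zero_of_hasDerivAt_of_integrableOn_Ioi (a := 0)
      (fun s _ => M.hasDerivAt_sum_div s) h2.integrableOn h1.integrableOn⟩

omit M in
theorem prod_ellipticCoordinates (hb : ∀ l, b l ≠ 0) {u : Fin (m + 1) → ℝ} {s : ℝ}
    (hN : fracNumerator b (fun k => q s k ^ 2) = ∏ i, (X - C (u i))) :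
    ∏ i, u i = ((-1) ^ m * ∏ k, (0 - b k)) * ∑ k, q s k ^ 2 / b k := by
  have h1 := congrArg (eval 0) hN
  rw [eval_fracNumerator_of_ne (fun l => (hb l).symm), eval_prod] at h1
  simp only [eval_sub, eval_X, eval_C, zero_sub, div_neg, Finset.sum_neg_distrib,
    Finset.prod_neg, Finset.card_univ, Fintype.card_fin] at h1 ⊢
  have h2 : ((-1 : ℝ) ^ m) ^ 2 = 1 := by rw [← pow_mul, mul_comm, pow_mul]; simp
  rw [pow_succ, pow_succ] at h1
  rw [pow_succ, pow_succ]
  linear_combination (-∏ i, u i) * h2 + (-1) ^ m * h1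

end NeumannMotion

/-! ### From the geodesic to the Neumann system -/

namespace IsGeodesic

variable {m : ℕ} {a : Fin (m + 2) → ℝ} {x : ℝ → Fin (m + 2) → ℝ} (hx : IsGeodesic a x)
  (ha : ∀ k, a k ≠ 0)
include hx

theorem hasDerivAt (s : ℝ) (i : Fin (m + 2)) : HasDerivAt (fun s => x s i) (deriv x s i) s :=
  hasDerivAt_pi.1 ((hx.contDiff.differentiable (by norm_num)) s).hasDerivAt i

theorem hasDerivAt_deriv (s : ℝ) (i : Fin (m + 2)) :
    HasDerivAt (fun s => deriv x s i) (deriv (deriv x) s i) s := by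
  have h : ContDiff ℝ 1 (deriv x) := by
    have := hx.contDiff
    rw [show (2 : WithTop ℕ∞) = 1 + 1 by norm_num] at this
    exact (contDiff_succ_iff_deriv.1 this).2.2
  exact hasDerivAt_pi.1 ((h.differentiable (by norm_num)) s).hasDerivAt i

theorem sum_x_mul_deriv (s : ℝ) : ∑ i, x s i * deriv x s i / a i = 0 := by
  have h1 : HasDerivAt (fun s => ∑ i, x s i ^ 2 / a i) (∑ i, 2 * (x s i * deriv x s i / a i)) s :=
    HasDerivAt.fun_sum fun i _ =>
      (((hx.hasDerivAt s i).pow 2).div_const (a i)).congr_deriv (by ring)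
  rw [← Finset.mul_sum, show (fun s => ∑ i, x s i ^ 2 / a i) = fun _ => 1 from funext hx.mem] at h1
  have := h1.unique (hasDerivAt_const s (1 : ℝ))
  linarith

theorem sum_deriv_sq {lam : ℝ → ℝ} (hl : ∀ s i, deriv (deriv x) s i = -lam s * (x s i / a i))
    (s : ℝ) : ∑ i, deriv x s i ^ 2 / a i = lam s * ∑ i, (x s i / a i) ^ 2 := by
  have h1 : HasDerivAt (fun s => ∑ i, x s i * deriv x s i / a i)
      (∑ i, (deriv x s i ^ 2 / a i - lam s * (x s i / a i) ^ 2)) s := by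
    refine HasDerivAt.fun_sum fun i _ => ?_
    refine (((hx.hasDerivAt s i).mul (hx.hasDerivAt_deriv s i)).div_const (a i)).congr_deriv ?_
    rw [hl]; ring
  rw [show (fun s => ∑ i, x s i * deriv x s i / a i) = fun _ => 0 from funext hx.sum_x_mul_deriv,
    Finset.sum_sub_distrib, ← Finset.mul_sum] at h1
  have := h1.unique (hasDerivAt_const s (0 : ℝ))
  linarith

theorem joachimsthal_eq (s : ℝ) :
    joachimsthal a (x s) (deriv x s) = joachimsthal a (x 0) (deriv x 0) := by
  obtain ⟨lam, hl⟩ := hx.normal_acc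
  have hd : ∀ s, HasDerivAt (fun s => joachimsthal a (x s) (deriv x s)) 0 s := by
    intro s
    have h1 : HasDerivAt (fun s => ∑ i, (x s i / a i) ^ 2)
        (∑ i, 2 * (x s i * deriv x s i / a i ^ 2)) s := HasDerivAt.fun_sum fun i _ =>
      (((hx.hasDerivAt s i).div_const (a i)).pow 2).congr_deriv (by ring)
    have h2 : HasDerivAt (fun s => ∑ i, deriv x s i ^ 2 / a i)
        (∑ i, -2 * lam s * (x s i * deriv x s i / a i ^ 2)) s := HasDerivAt.fun_sum fun i _ =>
      (((hx.hasDerivAt_deriv s i).pow 2).div_const (a i)).congr_deriv (by rw [hl]; ring)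
    refine (h1.mul h2).congr_deriv ?_
    rw [← Finset.mul_sum, ← Finset.mul_sum, hx.sum_deriv_sq hl]
    ring
  exact is_const_of_deriv_eq_zero (fun s => (hd s).differentiableAt) (fun s => (hd s).deriv) s 0

include ha

theorem sum_sq_pos (s : ℝ) : 0 < ∑ i, (x s i / a i) ^ 2 := by
  have h0 : ∃ i, x s i ≠ 0 := by
    by_contra! hc
    have := hx.mem s
    simp [hc] at this
  obtain ⟨i, hi⟩ := h0
  exact Finset.sum_pos' (fun i _ => sq_nonneg _)
    ⟨i, Finset.mem_univ i, by have := div_ne_zero hi (ha i); positivity⟩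

theorem normalVec_eq_zero_iff (s : ℝ) (l : Fin (m + 2)) : normalVec a x s l = 0 ↔ x s l = 0 := by
  rw [normalVec, div_eq_zero_iff, div_eq_zero_iff]
  have := (Real.sqrt_pos.2 (hx.sum_sq_pos ha s)).ne'
  simp [ha l, this]

theorem hasDerivAt_sqrt (s : ℝ) : HasDerivAt (fun s => √(∑ i, (x s i / a i) ^ 2))
    ((∑ i, x s i * deriv x s i / a i ^ 2) / √(∑ i, (x s i / a i) ^ 2)) s := by
  have h1 : HasDerivAt (fun s => ∑ i, (x s i / a i) ^ 2)
      (∑ i, 2 * (x s i * deriv x s i / a i ^ 2)) s := HasDerivAt.fun_sum fun i _ =>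
    (((hx.hasDerivAt s i).div_const (a i)).pow 2).congr_deriv (by ring)
  refine (h1.sqrt (hx.sum_sq_pos ha s).ne').congr_deriv ?_
  rw [← Finset.mul_sum]
  have := (Real.sqrt_pos.2 (hx.sum_sq_pos ha s)).ne'
  field_simp

/-- Conservation of the Joachimsthal integral expresses the speed by `|Bx|` alone: `dτ/ds = |J| ^
(1/2) / |Bx| ^ 2`. -/
theorem timeSpeed_eq (s : ℝ) : timeSpeed a x s =
    √|joachimsthal a (x 0) (deriv x 0)| / √(∑ i, (x s i / a i) ^ 2) ^ 2 := by
  have hp := hx.sum_sq_pos ha s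
  rw [timeSpeed, ← hx.joachimsthal_eq s, joachimsthal, Real.sq_sqrt hp.le, abs_mul, abs_of_pos hp,
    Real.sqrt_eq_iff_mul_self_eq (by positivity) (by positivity), div_mul_div_comm,
    Real.mul_self_sqrt (by positivity)]
  field_simp

theorem hasDerivAt_normalVec (s : ℝ) (i : Fin (m + 2)) :
    HasDerivAt (fun s => normalVec a x s i)
      (deriv x s i / (a i * √(∑ i, (x s i / a i) ^ 2)) -
        x s i * ((∑ i, x s i * deriv x s i / a i ^ 2) / √(∑ i, (x s i / a i) ^ 2)) /
          (a i * √(∑ i, (x s i / a i) ^ 2) ^ 2)) s := by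
  have hr := (Real.sqrt_pos.2 (hx.sum_sq_pos ha s)).ne'
  have ha' := ha i
  refine (((hx.hasDerivAt s i).div_const (a i)).div (hx.hasDerivAt_sqrt ha s) hr).congr_deriv ?_
  field_simp

theorem momentum_eq (hJ : joachimsthal a (x 0) (deriv x 0) ≠ 0) (s : ℝ) (i : Fin (m + 2)) :
    momentum a x s i = (√(∑ i, (x s i / a i) ^ 2) * deriv x s i -
      ((∑ i, x s i * deriv x s i / a i ^ 2) / √(∑ i, (x s i / a i) ^ 2)) * x s i) /
        (a i * √|joachimsthal a (x 0) (deriv x 0)|) := by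
  have hr := (Real.sqrt_pos.2 (hx.sum_sq_pos ha s)).ne'
  have hκ := (Real.sqrt_pos.2 (abs_pos.2 hJ)).ne'
  have ha' := ha i
  have hd : deriv (normalVec a x) s i = _ :=
    congrFun (hasDerivAt_pi.2 fun i => hx.hasDerivAt_normalVec ha s i).deriv i
  rw [momentum, hd, hx.timeSpeed_eq ha]
  field_simp

/-- The Gauss map takes the geodesics of the quadric to solutions of the Neumann system. -/
theorem exists_neumannMotion (hinj : Function.Injective a)
    (hJ : joachimsthal a (x 0) (deriv x 0) ≠ 0) :
    ∃ ν, NeumannMotion (bCoef a x) (momentum a x) (normalVec a x) (timeSpeed a x) ν := by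
  obtain ⟨lam, hl⟩ := hx.normal_acc
  set J := joachimsthal a (x 0) (deriv x 0) with hJdef
  have hκ := Real.sqrt_pos.2 (abs_pos.2 hJ)
  have hr : ∀ s, 0 < √(∑ i, (x s i / a i) ^ 2) := fun s => Real.sqrt_pos.2 (hx.sum_sq_pos ha s)
  have hε : Real.sign J ≠ 0 := fun h => hJ (Real.sign_eq_zero_iff.1 h)
  have hρ : ∀ s, ∃ ρ', HasDerivAt
      (fun s => (∑ i, x s i * deriv x s i / a i ^ 2) / √(∑ i, (x s i / a i) ^ 2)) ρ' s := fun s =>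
    ⟨_, (HasDerivAt.fun_sum fun i _ => ((hx.hasDerivAt s i).mul
      (hx.hasDerivAt_deriv s i)).div_const (a i ^ 2)).div (hx.hasDerivAt_sqrt ha s) (hr s).ne'⟩
  choose ρ' hρ' using hρ
  have hlam : ∀ s, lam s * √(∑ i, (x s i / a i) ^ 2) ^ 4 = Real.sign J * √|J| ^ 2 := by
    intro s
    have h1 := hx.joachimsthal_eq s
    rw [joachimsthal, hx.sum_deriv_sq hl, ← hJdef] at h1
    have h2 : Real.sign J * |J| = J := by
      rcases lt_or_gt_of_ne hJ with h | h
      · rw [Real.sign_of_neg h, abs_of_neg h]; ring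
      · rw [Real.sign_of_pos h, abs_of_pos h]; ring
    rw [Real.sq_sqrt (abs_nonneg J), h2, ← h1, show 4 = 2 * 2 by norm_num, pow_mul,
      Real.sq_sqrt (hx.sum_sq_pos ha s).le]
    ring
  -- With `r = |Bx|` and `ρ = r'` the momentum is `B (r x' - r' x) / √|J|`, so its derivative
  -- contains only `x''` and `r'' x`. The first gives the force `-b k q k`, because `λ = J / r ^ 4`;
  -- the second is along `q` and gives `ν`.
  refine ⟨fun s => -ρ' s * √(∑ i, (x s i / a i) ^ 2) ^ 3 / √|J| ^ 2,
    fun i j hij => ?_, fun s i => ?_, fun s i => ?_, fun s => ?_, fun s => ?_, fun s => ?_⟩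
  · simp only [bCoef, ← hJdef] at hij
    have := ha i
    have := ha j
    field_simp at hij
    exact hinj hij.symm
  · refine (hx.hasDerivAt_normalVec ha s i).congr_deriv ?_
    rw [hx.momentum_eq ha hJ, hx.timeSpeed_eq ha, ← hJdef]
    have := (hr s).ne'
    have := ha i
    field_simp
  · have h1 := ((((hx.hasDerivAt_sqrt ha s).mul (hx.hasDerivAt_deriv s i)).sub
      ((hρ' s).mul (hx.hasDerivAt s i))).div_const (a i * √|J|))
    rw [show (fun s => momentum a x s i) = _ from funext fun s => hx.momentum_eq ha hJ s i]
    refine h1.congr_deriv ?_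
    rw [hl, hx.timeSpeed_eq ha, bCoef, normalVec, ← hJdef]
    have h2 := hlam s
    have hr' := (hr s).ne'
    have ha' := ha i
    set r := √(∑ i, (x s i / a i) ^ 2)
    set S := ∑ i, x s i * deriv x s i / a i ^ 2
    have h3 : lam s = Real.sign J * √|J| ^ 2 / r ^ 4 := by
      rw [eq_div_iff (pow_ne_zero 4 hr'), h2]
    rw [h3]
    field_simp
    ring
  · simp only [normalVec]
    rw [Finset.sum_congr rfl fun i _ => div_pow (x s i / a i) _ 2, ← Finset.sum_div,
      Real.sq_sqrt (hx.sum_sq_pos ha s).le]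
    exact div_self (hx.sum_sq_pos ha s).ne'
  · have h1 : ∀ i, momentum a x s i * normalVec a x s i =
        (x s i * deriv x s i / a i ^ 2 -
          (∑ i, x s i * deriv x s i / a i ^ 2) / √(∑ i, (x s i / a i) ^ 2) ^ 2 *
            (x s i / a i) ^ 2) / √|J| := by
      intro i
      rw [hx.momentum_eq ha hJ, normalVec, ← hJdef]
      have hr' := (hr s).ne'
      have ha' := ha i
      generalize √(∑ i, (x s i / a i) ^ 2) = r at hr' ⊢
      field_simp
    rw [Finset.sum_congr rfl fun i _ => h1 i, ← Finset.sum_div, Finset.sum_sub_distrib,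
      ← Finset.mul_sum, Real.sq_sqrt (hx.sum_sq_pos ha s).le,
      div_mul_cancel₀ _ (hx.sum_sq_pos ha s).ne', sub_self, zero_div]
  · rw [hx.timeSpeed_eq ha]
    exact div_pos hκ (pow_pos (hr s) 2)

theorem sum_normalVec_sq_div (hJ : joachimsthal a (x 0) (deriv x 0) ≠ 0) (s : ℝ) :
    ∑ k, normalVec a x s k ^ 2 / bCoef a x k =
      Real.sign (joachimsthal a (x 0) (deriv x 0)) / √(∑ i, (x s i / a i) ^ 2) ^ 2 := by
  set J := joachimsthal a (x 0) (deriv x 0) with hJdef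
  have hr := (Real.sqrt_pos.2 (hx.sum_sq_pos ha s)).ne'
  have hε : Real.sign J * Real.sign J = 1 := by
    rcases Real.sign_apply_eq_of_ne_zero J hJ with h | h <;> rw [h] <;> norm_num
  have hε0 : Real.sign J ≠ 0 := left_ne_zero_of_mul (hε ▸ one_ne_zero)
  have h1 : ∀ k, normalVec a x s k ^ 2 / bCoef a x k =
      Real.sign J / √(∑ i, (x s i / a i) ^ 2) ^ 2 * (x s k ^ 2 / a k) := by
    intro k
    have ha' := ha k
    rw [normalVec, bCoef, ← hJdef]
    generalize √(∑ i, (x s i / a i) ^ 2) = r at hr ⊢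
    field_simp
    linear_combination (-(x s k ^ 2)) * hε
  rw [Finset.sum_congr rfl fun k _ => h1 k, ← Finset.mul_sum, hx.mem, mul_one]

/-- In this form the speed is a constant multiple of `|∏ u i|`; its positivity keeps the points away
from the origin, and its decay drives one of them there. -/
theorem timeSpeed_eq_sum (hJ : joachimsthal a (x 0) (deriv x 0) ≠ 0) (s : ℝ) :
    timeSpeed a x s = √|joachimsthal a (x 0) (deriv x 0)| *
      |∑ k, normalVec a x s k ^ 2 / bCoef a x k| := by
  have h1 : |Real.sign (joachimsthal a (x 0) (deriv x 0))| = 1 := by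
    rcases Real.sign_apply_eq_of_ne_zero _ hJ with h | h <;> rw [h] <;> norm_num
  rw [hx.sum_normalVec_sq_div ha hJ, hx.timeSpeed_eq ha, abs_div, h1,
    abs_of_nonneg (sq_nonneg (√(∑ i, (x s i / a i) ^ 2)))]
  ring

/-- The zero level of `Ψ_0` consists of the images of the geodesics. -/
theorem psi_zero (hJ : joachimsthal a (x 0) (deriv x 0) ≠ 0) (s : ℝ) :
    psi (bCoef a x) (momentum a x s) (normalVec a x s) 0 = 0 := by
  have hq := hx.sum_normalVec_sq_div ha hJ s
  have hJs := hx.joachimsthal_eq s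
  set J := joachimsthal a (x 0) (deriv x 0) with hJdef
  have hr := (Real.sqrt_pos.2 (hx.sum_sq_pos ha s)).ne'
  have hr2 := Real.sq_sqrt (hx.sum_sq_pos ha s).le
  have hκ := (Real.sqrt_pos.2 (abs_pos.2 hJ)).ne'
  have hε : Real.sign J * Real.sign J = 1 := by
    rcases Real.sign_apply_eq_of_ne_zero J hJ with h | h <;> rw [h] <;> norm_num
  have hε0 : Real.sign J ≠ 0 := left_ne_zero_of_mul (hε ▸ one_ne_zero)
  have hεJ : Real.sign J * J = √|J| ^ 2 := by
    rw [Real.sq_sqrt (abs_nonneg J)]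
    rcases lt_or_gt_of_ne hJ with h | h
    · rw [Real.sign_of_neg h, abs_of_neg h]; ring
    · rw [Real.sign_of_pos h, abs_of_pos h]; ring
  rw [joachimsthal, ← hr2] at hJs
  set r := √(∑ i, (x s i / a i) ^ 2) with hrdef
  set ρ := (∑ i, x s i * deriv x s i / a i ^ 2) / r with hρ
  have hp : ∑ k, momentum a x s k ^ 2 / bCoef a x k =
      Real.sign J / √|J| ^ 2 * (J + ρ ^ 2) := by
    have h1 : ∀ k, momentum a x s k ^ 2 / bCoef a x k = Real.sign J / √|J| ^ 2 *
        (r ^ 2 * (deriv x s k ^ 2 / a k) - 2 * r * ρ * (x s k * deriv x s k / a k) +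
          ρ ^ 2 * (x s k ^ 2 / a k)) := by
      intro k
      have := ha k
      rw [hx.momentum_eq ha hJ, bCoef, ← hJdef, ← hrdef, ← hρ]
      field_simp
      linear_combination (-(r * deriv x s k - ρ * x s k) ^ 2) * hε
    rw [Finset.sum_congr rfl fun k _ => h1 k, ← Finset.mul_sum, Finset.sum_add_distrib,
      Finset.sum_sub_distrib, ← Finset.mul_sum, ← Finset.mul_sum, ← Finset.mul_sum, hx.mem,
      hx.sum_x_mul_deriv, hJs]
    ring
  have hpq : ∑ k, momentum a x s k * normalVec a x s k / bCoef a x k =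
      -(Real.sign J * ρ / (r * √|J|)) := by
    have h1 : ∀ k, momentum a x s k * normalVec a x s k / bCoef a x k = Real.sign J / (r * √|J|) *
        (r * (x s k * deriv x s k / a k) - ρ * (x s k ^ 2 / a k)) := by
      intro k
      have := ha k
      rw [hx.momentum_eq ha hJ, normalVec, bCoef, ← hJdef, ← hrdef, ← hρ]
      field_simp
      linear_combination (-(x s k * (r * deriv x s k - ρ * x s k))) * hε
    rw [Finset.sum_congr rfl fun k _ => h1 k, ← Finset.mul_sum, Finset.sum_sub_distrib,
      ← Finset.mul_sum, ← Finset.mul_sum, hx.mem, hx.sum_x_mul_deriv]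
    ring
  simp only [psi, zero_sub, div_neg, Finset.sum_neg_distrib]
  rw [hp, hq, hpq]
  field_simp
  linear_combination Real.sign J * hεJ
end IsGeodesic

/-! ### Passages through the branch points. -/

namespace BranchData

variable {m : ℕ} {R : ℝ[X]} {E : ℕ → ℝ} (h : BranchData m R E)
include h

theorem exists_eq_of_root {v : ℝ} (hv : R.eval v = 0) : ∃ j < 2 * m + 3, v = E j := by
  rw [h.eval_eq, mul_eq_zero, Finset.prod_eq_zero_iff] at hv
  obtain hv | ⟨j, hj, hv⟩ := hv
  · norm_num at hv
  · exact ⟨j, Finset.mem_range.1 hj, sub_eq_zero.1 hv⟩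

/-- All the branch points but the first one lie on ovals. -/
theorem exists_oval_of_lt {v w : ℝ} (hv : R.eval v = 0) (hw : R.eval w = 0) (hwv : w < v) :
    ∃ k : Fin (m + 1), (v, (0 : ℝ)) ∈ oval R k := by
  obtain ⟨j, hj, rfl⟩ := h.exists_eq_of_root hv
  obtain ⟨j', -, rfl⟩ := h.exists_eq_of_root hw
  have hjj := h.strictMono.lt_iff_lt.1 hwv
  -- As `E j` is not the smallest root, `j ≥ 1`, and `j` is `2 i + 1` or `2 i + 2` with `i = (j - 1)
  -- / 2`.
  refine ⟨⟨(j - 1) / 2, by omega⟩, ⟨?_, ?_⟩, by simp [hv]⟩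
  · rw [h.ovalLeft_eq]
    exact h.strictMono.monotone (by simp only; omega)
  · rw [h.ovalRight_eq]
    exact h.strictMono.monotone (by simp only; omega)

theorem finite_params (i : Fin (m + 1)) (α β : ℝ) (P : ℝ × ℝ) :
    {φ ∈ Set.Ioo α β | ovalParam R i φ = P}.Finite := by
  rcases Set.eq_empty_or_nonempty {φ ∈ Set.Ioo α β | ovalParam R i φ = P} with he | ⟨φ₀, hφ₀, h0⟩
  · rw [he]; exact Set.finite_empty
  have hp := Real.two_pi_pos
  refine ((Set.finite_Icc ⌊(α - φ₀) / (2 * Real.pi)⌋ ⌈(β - φ₀) / (2 * Real.pi)⌉).image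
    fun n : ℤ => φ₀ + n * (2 * Real.pi)).subset ?_
  rintro φ ⟨hφ, h1⟩
  obtain ⟨n, rfl⟩ := (h.param_eq_iff i φ φ₀).1 (h1.trans h0.symm)
  refine ⟨n, ⟨?_, ?_⟩, rfl⟩
  · have h2 : (α - φ₀) / (2 * Real.pi) ≤ n := by
      rw [div_le_iff₀ hp]; linarith [hφ.1]
    exact_mod_cast (Int.floor_le _).trans h2
  · have h2 : (n : ℝ) ≤ (β - φ₀) / (2 * Real.pi) := by
      rw [le_div_iff₀ hp]; linarith [hφ.2]
    exact_mod_cast h2.trans (Int.le_ceil _)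

end BranchData

theorem range_eq_Ioo_of_strictMono {f : ℝ → ℝ} (hf : Continuous f) (hmono : StrictMono f) {α β : ℝ}
    (hα : Tendsto f atBot (𝓝 α)) (hβ : Tendsto f atTop (𝓝 β)) : Set.range f = Set.Ioo α β := by
  ext φ
  constructor
  · rintro ⟨s, rfl⟩
    exact ⟨(hmono.monotone.le_of_tendsto hα (s - 1)).trans_lt (hmono (by linarith)),
      (hmono (by linarith)).trans_le (hmono.monotone.ge_of_tendsto hβ (s + 1))⟩
  · rintro ⟨h1, h2⟩
    obtain ⟨s₁, hs₁⟩ := (hα.eventually (gt_mem_nhds h1)).exists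
    obtain ⟨s₂, hs₂⟩ := (hβ.eventually (lt_mem_nhds h2)).exists
    exact (isPreconnected_range hf).ordConnected.out ⟨s₁, rfl⟩ ⟨s₂, rfl⟩ ⟨hs₁.le, hs₂.le⟩

/-- The passages of the moving points through a branch point are counted on the coverings. -/
theorem ncard_passages {m : ℕ} {R : ℝ[X]} {E : ℕ → ℝ} (h : BranchData m R E)
    {P : Fin (m + 1) → ℝ → ℝ × ℝ} {Θ : Fin (m + 1) → ℝ → ℝ}
    (hP : ∀ i s, ovalParam R i (Θ i s) = P i s) {θm θp : Fin (m + 1) → ℝ}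
    (hc : ∀ i, Continuous (Θ i)) (hmono : ∀ i, StrictMono (Θ i))
    (hm : ∀ i, Tendsto (Θ i) atBot (𝓝 (θm i))) (hp : ∀ i, Tendsto (Θ i) atTop (𝓝 (θp i)))
    (v : ℝ) :
    {s | ∃ i, P i s = (v, 0)}.Finite ∧ {s | ∃ i, P i s = (v, 0)}.ncard =
      ∑ i, {φ ∈ Set.Ioo (θm i) (θp i) | ovalParam R i φ = (v, 0)}.ncard := by
  by_cases hv : ∃ i : Fin (m + 1), (v, (0 : ℝ)) ∈ oval R i
  · obtain ⟨i, hi⟩ := hv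
    have hother : ∀ j ≠ i, ∀ φ, ovalParam R j φ ≠ (v, 0) := fun j hj φ hφ =>
      h.oval_disjoint hj (hφ ▸ h.param_mem j φ) hi
    have hS : {s | ∃ i, P i s = (v, 0)} = {s | P i s = (v, 0)} := by
      ext s
      constructor
      · rintro ⟨j, hj⟩
        by_cases hji : j = i
        · exact hji ▸ hj
        · exact absurd ((hP j s).trans hj) (hother j hji _)
      · exact fun hs => ⟨i, hs⟩
    -- The strictly increasing lift maps the time axis bijectively onto the open interval between
    -- its limits, so times and parameters can be counted interchangeably.
    have himg : Θ i '' {s | P i s = (v, 0)} =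
        {φ ∈ Set.Ioo (θm i) (θp i) | ovalParam R i φ = (v, 0)} := by
      ext φ
      constructor
      · rintro ⟨s, hs, rfl⟩
        refine ⟨?_, (hP i s).trans hs⟩
        rw [← range_eq_Ioo_of_strictMono (hc i) (hmono i) (hm i) (hp i)]
        exact ⟨s, rfl⟩
      · rintro ⟨hφ, h1⟩
        rw [← range_eq_Ioo_of_strictMono (hc i) (hmono i) (hm i) (hp i)] at hφ
        obtain ⟨s, rfl⟩ := hφ
        exact ⟨s, (hP i s).symm.trans h1, rfl⟩
    have hfin := h.finite_params i (θm i) (θp i) (v, 0)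
    rw [hS, Finset.sum_eq_single i]
    · constructor
      · rw [← himg] at hfin
        exact hfin.of_finite_image (hmono i).injective.injOn
      · rw [← himg, Set.ncard_image_of_injective _ (hmono i).injective]
    · intro j _ hj
      have : {φ ∈ Set.Ioo (θm j) (θp j) | ovalParam R j φ = (v, 0)} = ∅ :=
        Set.eq_empty_of_forall_notMem fun φ hφ => hother j hj φ hφ.2
      rw [this, Set.ncard_empty]
    · simp
  · have hno : ∀ i φ, ovalParam R i φ ≠ (v, 0) := fun i φ hφ => hv ⟨i, hφ ▸ h.param_mem i φ⟩
    have hS : {s | ∃ i, P i s = (v, 0)} = ∅ :=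
      Set.eq_empty_of_forall_notMem fun s ⟨i, hi⟩ => hno i _ ((hP i s).trans hi)
    rw [hS]
    refine ⟨Set.finite_empty, ?_⟩
    rw [Set.ncard_empty, Finset.sum_eq_zero]
    intro i _
    have : {φ ∈ Set.Ioo (θm i) (θp i) | ovalParam R i φ = (v, 0)} = ∅ :=
      Set.eq_empty_of_forall_notMem fun φ hφ => hno i φ hφ.2
    rw [this, Set.ncard_empty]

theorem eval_polyB_self {m : ℕ} (b : Fin (m + 2) → ℝ) (l : Fin (m + 2)) :
    (polyB b).eval (b l) = 0 := by
  rw [eval_polyB]; exact Finset.prod_eq_zero (Finset.mem_univ l) (sub_self _)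

theorem eval_fracNumerator_zero_of_psi {m : ℕ} {b p q : Fin (m + 2) → ℝ}
    (hinj : Function.Injective b) (hb : ∀ l, b l ≠ 0) (hpsi : psi b p q 0 = 0) :
    (fracNumerator b (integralF b p q)).eval 0 = 0 := by
  rw [eval_fracNumerator_of_ne fun l => (hb l).symm, ← psi_eq_sum hinj fun l => (hb l).symm, hpsi,
    mul_zero]

/-- A zero of `x l` is a passage of one of the points through the branch point `b l`. -/
theorem q_eq_zero_iff {m : ℕ} {b q : Fin (m + 2) → ℝ} (hinj : Function.Injective b)
    {u : Fin (m + 1) → ℝ} (hN : fracNumerator b (fun k => q k ^ 2) = ∏ i, (X - C (u i)))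
    (l : Fin (m + 2)) : q l = 0 ↔ ∃ i, u i = b l := by
  have h1 := congrArg (eval (b l)) hN
  rw [eval_fracNumerator_self, eval_prod] at h1
  simp only [eval_sub, eval_X, eval_C] at h1
  constructor
  · intro h0
    rw [h0, zero_pow two_ne_zero, zero_mul, eq_comm, Finset.prod_eq_zero_iff] at h1
    obtain ⟨i, -, hi⟩ := h1
    exact ⟨i, (sub_eq_zero.1 hi).symm⟩
  · rintro ⟨i, hi⟩
    rw [Finset.prod_eq_zero (Finset.mem_univ i) (by rw [hi, sub_self])] at h1
    exact pow_eq_zero_iff two_ne_zero |>.1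
      ((mul_eq_zero.1 h1).resolve_right (prod_erase_sub_ne_zero hinj l))

end GeodesicScattering

end

/-! ### The scattering theorem. -/

theorem theorem5p3 {m : ℕ} (a : Fin (m + 2) → ℝ) (ha0 : a 0 < 0) (ha1 : 0 < a 1)
    (ha : StrictMono a) (x : ℝ → Fin (m + 2) → ℝ) (hx : IsGeodesic a x)
    (hJ : joachimsthal a (x 0) (deriv x 0) ≠ 0)
    (R : ℝ[X]) (hRdef : R = geodesicPoly a x) (hR : Squarefree R) :
    -- the spectral curve: `Ψ_u` is an integral of motion with real zeros `0, d 1, …, d (n - 1)`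
    (∃ d : Fin m → ℝ,
      R = C (-4) * X * (∏ i, (X - C (d i))) * (∏ l, (X - C (bCoef a x l))) ∧
      ∀ s u, (∀ l, u ≠ bCoef a x l) →
        psi (bCoef a x) (momentum a x s) (normalVec a x s) u =
          u * (∏ i, (u - d i)) / ∏ l, (u - bCoef a x l)) ∧
    -- `k` is the oval that contains the origin
    ∃ k : Fin (m + 1), ((0, 0) : ℝ × ℝ) ∈ oval R k ∧
      -- the target of the Abel map is a torus, and the map is one-to-one and onto
      LinearIndependent ℝ (fun i : Fin m => ovalPeriod R (k.succAbove i)) ∧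
      Function.Bijective (abelMap R k) ∧
      -- the points `P i` on the ovals along the geodesic, and the limit divisors
      ∃ (P : Fin (m + 1) → ℝ → ℝ × ℝ) (Dm Dp : (i : Fin m) → oval R (k.succAbove i)),
        (∀ (i : Fin (m + 1)) (s : ℝ), P i s ∈ oval R i ∧
          IsSpectralPoint (bCoef a x) (momentum a x s) (normalVec a x s) (P i s)) ∧
        Tendsto (P k) atBot (𝓝 (0, 0)) ∧ Tendsto (P k) atTop (𝓝 (0, 0)) ∧
        (∀ i, Tendsto (P (k.succAbove i)) atBot (𝓝 (Dm i : ℝ × ℝ))) ∧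
        (∀ i, Tendsto (P (k.succAbove i)) atTop (𝓝 (Dp i : ℝ × ℝ))) ∧
        -- the scattering relation
        abelMap R k Dp = abelMap R k Dm - QuotientAddGroup.mk (ovalPeriod R k) ∧
        -- the lifts of the points to the universal coverings of the ovals
        ∃ (Θ : Fin (m + 1) → ℝ → ℝ) (θm θp : Fin (m + 1) → ℝ),
          (∀ i, Continuous (Θ i) ∧ StrictMono (Θ i) ∧
            (∀ s, ovalParam R i (Θ i s) = P i s) ∧
            Tendsto (Θ i) atBot (𝓝 (θm i)) ∧ Tendsto (Θ i) atTop (𝓝 (θp i))) ∧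
          θp k = θm k + 2 * Real.pi ∧
          -- the homotopy class of the path from `Dm` to `Dp` is the one given by `Δ`
          (∀ θ : Fin m → ℝ,
            liftedAbel R k θ = liftedAbel R k (fun i => θm (k.succAbove i)) - ovalPeriod R k ↔
              θ = fun i => θp (k.succAbove i)) ∧
          -- the numbers of full turns are read off from the cell that contains `-Δ`
          (∀ N : Fin m → ℤ,
            (∀ i, N i = ⌊(θp (k.succAbove i) - θm (k.succAbove i)) / (2 * Real.pi)⌋) ↔
              ∃ φ : Fin m → ℝ, (∀ i, φ i ∈ Set.Ico 0 (2 * Real.pi)) ∧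
                -ovalPeriod R k =
                  liftedAbel R k (fun i => θm (k.succAbove i) + φ i) -
                    liftedAbel R k (fun i => θm (k.succAbove i)) +
                    ∑ i, N i • ovalPeriod R (k.succAbove i)) ∧
          -- the sign changes of the coordinates are the passages through the branch points
          (∀ l, (∀ s, x s l = 0 → deriv x s l ≠ 0) ∧ {s | x s l = 0}.Finite ∧
            {s | x s l = 0}.ncard =
              ∑ i, {φ ∈ Set.Ioo (θm i) (θp i) | ovalParam R i φ = (bCoef a x l, 0)}.ncard) := by
  subst hRdef
  have hane : ∀ k, a k ≠ 0 := by
    intro k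
    by_cases hk : k = 0
    · rw [hk]; exact ha0.ne
    · have h1 : (1 : Fin (m + 2)) ≤ k := Fin.one_le_of_ne_zero hk
      exact (ha1.trans_le (ha.monotone h1)).ne'
  obtain ⟨ν, M⟩ := hx.exists_neumannMotion hane ha.injective hJ
  have hsign : Real.sign (joachimsthal a (x 0) (deriv x 0)) ≠ 0 :=
    fun h => hJ (Real.sign_eq_zero_iff.1 h)
  have hb : ∀ l, bCoef a x l ≠ 0 := fun l => div_ne_zero hsign (hane l)
  -- Because `a` has entries of both signs, some `b l` is negative for either sign of `J`. So `0` is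
  -- not the smallest root of `R` and therefore lies on an oval.
  have hbneg : ∃ l, bCoef a x l < 0 := by
    rcases lt_or_gt_of_ne hsign with h | h
    · exact ⟨1, div_neg_of_neg_of_pos h ha1⟩
    · exact ⟨0, div_neg_of_pos_of_neg h ha0⟩
  have hF0 := eval_fracNumerator_zero_of_psi M.inj hb (hx.psi_zero hane hJ 0)
  have hRb : ∀ l, (geodesicPoly a x).eval (bCoef a x l) = 0 := fun l => by
    rw [geodesicPoly, spectralPoly, eval_mul, eval_polyB_self, mul_zero]
  have hR0 : (geodesicPoly a x).eval 0 = 0 := by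
    rw [geodesicPoly, spectralPoly, eval_mul, eval_mul, hF0, mul_zero, zero_mul]
  obtain ⟨⟨d, hd⟩, E, h, hroots⟩ := M.exists_branchData hR
  obtain ⟨u, hu, hN⟩ := M.exists_ellipticCoordinates h hroots
  have hκ := Real.sqrt_pos.2 (abs_pos.2 hJ)
  have hTg := hx.timeSpeed_eq_sum hane hJ
  have hTc : Continuous (timeSpeed a x) := by
    rw [show timeSpeed a x = _ from funext hTg]
    exact continuous_const.mul (continuous_iff_continuousAt.2 fun s =>
      (M.hasDerivAt_sum_div s).continuousAt).abs
  have W := M.ovalMotion h hTc hu hN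
  change BranchData m (geodesicPoly a x) E at h
  change OvalMotion (geodesicPoly a x) _ _ _ at W
  refine ⟨?_, ?_⟩
  · have h0 := hF0
    rw [hd, eval_prod, Finset.prod_eq_zero_iff] at h0
    obtain ⟨i₀, -, hi₀⟩ := h0
    have hdi : d i₀ = 0 := by simpa using hi₀
    have hFe : fracNumerator (bCoef a x) (integralF (bCoef a x) (momentum a x 0)
        (normalVec a x 0)) = X * ∏ i, (X - C (d (i₀.succAbove i))) := by
      rw [hd, Fin.prod_univ_succAbove _ i₀, hdi, C_0, sub_zero]
    refine ⟨fun i => d (i₀.succAbove i), ?_, fun s u hu => ?_⟩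
    · rw [geodesicPoly, spectralPoly, hFe, polyB]
      ring
    · have h1 := congrArg (eval u) hFe
      rw [eval_fracNumerator_of_ne hu, eval_mul, eval_X, eval_prod] at h1
      simp only [eval_sub, eval_X, eval_C] at h1
      rw [psi_eq_sum M.inj hu, M.integralF_eq, ← h1, mul_div_cancel_left₀]
      exact Finset.prod_ne_zero_iff.2 fun l _ => sub_ne_zero.2 (hu l)
  obtain ⟨l₀, hl₀⟩ := hbneg
  obtain ⟨k, hk⟩ := h.exists_oval_of_lt hR0 (hRb l₀) hl₀
  refine ⟨k, hk, h.linearIndependent_period k, h.abelMap_bijective k, ?_⟩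
  have hprod := fun s => NeumannMotion.prod_ellipticCoordinates hb (hN s)
  have hgne : ∀ s, ∑ k, normalVec a x s k ^ 2 / bCoef a x k ≠ 0 := by
    intro s hs
    have := M.T_pos s
    rw [hTg, hs, abs_zero, mul_zero] at this
    exact lt_irrefl _ this
  -- The product of the elliptic coordinates is a nonzero multiple of a quantity whose absolute
  -- value is proportional to `dτ/ds > 0`.
  have hune : ∀ i s, u i s ≠ 0 := by
    intro i s
    have h1 : ∏ i, u i s ≠ 0 := by
      rw [hprod]
      refine mul_ne_zero (mul_ne_zero (pow_ne_zero _ (by norm_num)) ?_) (hgne s)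
      exact Finset.prod_ne_zero_iff.2 fun l _ => sub_ne_zero.2 (hb l).symm
    exact Finset.prod_ne_zero_iff.1 h1 i (Finset.mem_univ i)
  obtain ⟨Θ, hΘP⟩ := W.exists_lift h
  have hΘ := fun i s => (hΘP i s).1
  have hP := fun i s => (hΘP i s).2
  obtain ⟨α, hα, harc⟩ := OvalMotion.exists_arc h hΘ hP hk (hune k)
  have hTint := W.integrable_of_bounded h hΘ harc
  choose θm θp hm hp using W.exists_limits h hΘ hTint
  obtain ⟨hgm, hgp⟩ := M.tendsto_sum_div hTint hκ hTg
  have hum : Tendsto (fun s => ∏ i, u i s) atBot (𝓝 0) := by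
    simp only [hprod]; simpa using hgm.const_mul _
  have hup : Tendsto (fun s => ∏ i, u i s) atTop (𝓝 0) := by
    simp only [hprod]; simpa using hgp.const_mul _
  obtain ⟨hkm, hkp⟩ := W.turn_around h hΘ hP hk hα harc hm hp hum hup
  have hturn : θp k = θm k + 2 * Real.pi := by rw [hkp, hkm]
  have hscat := W.liftedAbel_scattering h hΘ hP hm hp hturn
  have hlim : ∀ i {l : Filter ℝ} {θ : ℝ}, Tendsto (Θ i) l (𝓝 θ) → Tendsto
      (fun s => (u i s, 2 * (fracNumerator (bCoef a x)
        (fun k => momentum a x s k * normalVec a x s k)).eval (u i s))) l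
        (𝓝 (ovalParam (geodesicPoly a x) i θ)) := by
    intro i l θ hl
    have := ((h.continuous_param i).tendsto θ).comp hl
    exact this.congr fun s => hP i s
  have hcont : ∀ i, Continuous (Θ i) := fun i =>
    continuous_iff_continuousAt.2 fun s => (hΘ i s).continuousAt
  have hmono := W.strictMono_lift h hΘ
  refine ⟨fun i s => (u i s, 2 * (fracNumerator (bCoef a x)
      (fun k => momentum a x s k * normalVec a x s k)).eval (u i s)),
    fun i => ⟨ovalParam _ (k.succAbove i) (θm (k.succAbove i)), h.param_mem _ _⟩,
    fun i => ⟨ovalParam _ (k.succAbove i) (θp (k.succAbove i)), h.param_mem _ _⟩,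
    fun i s => ⟨W.mem i s, ?_, rfl⟩, ?_, ?_, fun i => hlim _ (hm _), fun i => hlim _ (hp _), ?_,
    Θ, θm, θp, fun i => ⟨hcont i, hmono i, hP i, hm i, hp i⟩, hturn, fun θ => ?_, fun N => ?_,
    fun l => ?_⟩
  · simp only
    rw [hN, eval_prod]
    exact Finset.prod_eq_zero (Finset.mem_univ i) (by simp)
  · have := hlim k (hm k)
    rwa [hkm, hα] at this
  · have := hlim k (hp k)
    rwa [hkp, (h.param_eq_iff k _ α).2 ⟨1, by simp⟩, hα] at this
  · rw [h.abelMap_eq k (θ := fun i => θp (k.succAbove i)) fun i => rfl,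
      h.abelMap_eq k (θ := fun i => θm (k.succAbove i)) fun i => rfl, hscat]
    rfl
  · rw [← hscat, (h.liftedAbel_injective k).eq_iff]
  · exact h.floor_turns_iff k hscat N
  · have hz : {s | x s l = 0} = {s | ∃ i, (u i s, 2 * (fracNumerator (bCoef a x)
        (fun k => momentum a x s k * normalVec a x s k)).eval (u i s)) = (bCoef a x l, 0)} := by
      ext s
      rw [Set.mem_ofPred_eq, Set.mem_ofPred_eq, ← hx.normalVec_eq_zero_iff hane,
        q_eq_zero_iff M.inj (hN s)]
      refine exists_congr fun i => ⟨fun hi => ?_, fun hi => (Prod.mk.inj hi).1⟩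
      have h1 := (W.mem i s).2
      simp only at h1
      rw [hi, hRb, pow_eq_zero_iff two_ne_zero] at h1
      rw [hi, h1]
    rw [hz]
    refine ⟨fun s hs hds => ?_, ncard_passages h hP hcont hmono hm hp _⟩
    -- If `x l` and its derivative both vanished, so would `q l` and `p l`, and `b l` would be a
    -- double root of `R`.
    refine M.p_ne_zero_of_q_eq_zero hR ((hx.normalVec_eq_zero_iff hane s l).2 hs) ?_
    rw [hx.momentum_eq hane hJ, hs, hds]
    simp
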